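/- Let $\ell$ be a prime. Let $\hat{\mathcal S}$ be the category of simplicial profinite sets (a profinite set is a compact, Hausdorff, totally disconnected space). For a topological abelian group $\pi$ let $C^*(X;\pi)$ be the complex of continuous cochains of $X\in\hat{\mathcal S}$: $C^n(X;\pi)$ is the group of continuous maps $X_n\to\pi$, with differential $\delta\alpha=\sum_{i=0}^{n+1}(-1)^i\,\alpha\circ d_i$; let $Z^n(X;\pi)$ be its group of $n$-cocycles and $H^n(X;\pi)$ its cohomology. Let $\hat{\mathcal S}$ be enriched in simplicial sets by $\mathrm{Map}(X,Y)_n=\mathrm{Hom}_{\hat{\mathcal S}}(X\times\Delta[n],Y)$. For an abelian pro-$\ell$-group $M$ and $n\ge 0$ let $L(M,n)$ and $K(M,n)$ be the simplicial profinite sets that represent the functors $X\mapsto C^n(X;M)$ and $X\mapsto Z^n(X;M)$; explicitly, $L(M,n)_k=M^{\mathrm{Hom}_\Delta([n],[k])}$ and $K(M,n)_k=Z^n(\Delta[k];M)\subseteq L(M,n)_k$. The differential gives a map $L(M,n)\to K(M,n+1)$. For $n=-1$ put $L(M,-1)=*$ (as $C^{-1}=0$) and let $L(M,-1)=*\to K(M,0)$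 be the zero map. For a class $\mathcal M$ of abelian pro-$\ell$-groups put $$P_{\mathcal M}=\{L(M,n)\to K(M,n+1)\mid M\in\mathcal M,\ n\ge -1\}\cup\{K(M,n)\to *\mid M\in\mathcal M,\ n\ge 0\},$$ $$Q_{\mathcal M}=\{L(M,n)\to *\mid M\in\mathcal M,\ n\ge 0\}.$$ **Theorem.** There is a (closed) model structure on $\hat{\mathcal S}$ whose weak equivalences are the maps that induce isomorphisms on $H^n(-;\mathbb Z/\ell)$ for all $n\ge 0$ and whose cofibrations are the dimensionwise monomorphisms. With the above enrichment it is a simplicial model structure: $\hat{\mathcal S}$ is tensored and cotensored over simplicial sets, and for every cofibration $A\to B$ and fibration $X\to Y$ the map $$\mathrm{Map}(B,X)\to \mathrm{Map}(A,X)\times_{\mathrm{Map}(A,Y)}\mathrm{Map}(B,Y)$$ is a Kan fibration, which is trivial if one of the two given maps is a weak equivalence. The model structure is left proper, and it is fibrantly generated by the maps $P$ and $Q$ as follows. 1. Let $\mathcal M$ be the class of all abelian pro-$\ell$-groups. A map is a trivial cofibration if and only if it has the left lifting property with respect to all maps in $P_{\mathcal M}$, and a map is a cofibration if and only if it has the left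 lifting property with respect to all maps in $Q_{\mathcal M}$. 2. Let $\mathcal M$ be a (small) set of abelian pro-$\ell$-groups that contains a group isomorphic to $\mathbb Z/\ell$. Then the model structure is fibrantly generated with $P_{\mathcal M}$ as set of generating fibrations and $Q_{\mathcal M}$ as set of generating trivial fibrations: the statement of part 1 holds for $P_{\mathcal M}$ and $Q_{\mathcal M}$, and both sets permit the cosmall object argument. -/

import Mathlib

open CategoryTheory CategoryTheory.Limits HomotopicalAlgebra MonoidalCategory Opposite

universe u w

noncomputable section

/-! ### General notions for model categories -/

section General

/-- A model category is left proper if weak equivalences are stable under cobase change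
along cofibrations. -/
def IsLeftProper (C : Type*) [Category* C] [ModelCategory C] : Prop :=
  ∀ ⦃A B A' B' : C⦄ (w : A ⟶ A') (i : A ⟶ B) (j : A' ⟶ B') (w' : B ⟶ B'),
    IsPushout w i j w' → weakEquivalences C w → cofibrations C i → weakEquivalences C w'

variable {C : Type w} [Category.{u} C] [SimplicialCategory C]

/-- The map of simplicial sets `sHom T Y ⟶ [K, sHom X Y]` that is induced by composition with a
given `η : K ⟶ sHom X T`. -/
def tensorComparison {X T : C} {K : SSet.{u}} (η : K ⟶ SimplicialCategory.sHom X T) (Y : C) :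
    SimplicialCategory.sHom T Y ⟶ (ihom K).obj (SimplicialCategory.sHom X Y) :=
  MonoidalClosed.curry
    (η ▷ SimplicialCategory.sHom T Y ≫ SimplicialCategory.sHomComp X T Y)

/-- The map of simplicial sets `sHom X E ⟶ [K, sHom X Y]` that is induced by composition with a
given `ε : K ⟶ sHom E Y`. -/
def cotensorComparison {E Y : C} {K : SSet.{u}} (ε : K ⟶ SimplicialCategory.sHom E Y) (X : C) :
    SimplicialCategory.sHom X E ⟶ (ihom K).obj (SimplicialCategory.sHom X Y) :=
  MonoidalClosed.curry
    ((β_ K (SimplicialCategory.sHom X E)).hom ≫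
      SimplicialCategory.sHom X E ◁ ε ≫ SimplicialCategory.sHomComp X E Y)

/-- A model category `C` with a simplicial enrichment is a simplicial model category if it is
tensored and cotensored over simplicial sets and satisfies Quillen's axiom SM7: for a cofibration
`i : A ⟶ B` and a fibration `p : X ⟶ Y` the map
`sHom B X ⟶ sHom A X ×_{sHom A Y} sHom B Y` is a Kan fibration, which is trivial (it has the right
lifting property for all inclusions `∂Δ[n] ⟶ Δ[n]`) if `i` or `p` is a weak equivalence. -/
structure IsSimplicialModelCategory (C : Type w) [Category.{u} C] [SimplicialCategory C]
    [ModelCategory C] : Prop where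
  exists_tensor (X : C) (K : SSet.{u}) :
    ∃ (T : C) (η : K ⟶ SimplicialCategory.sHom X T), ∀ Y : C, IsIso (tensorComparison η Y)
  exists_cotensor (Y : C) (K : SSet.{u}) :
    ∃ (E : C) (ε : K ⟶ SimplicialCategory.sHom E Y), ∀ X : C, IsIso (cotensorComparison ε X)
  fibration ⦃A B X Y : C⦄ (i : A ⟶ B) (p : X ⟶ Y)
    (hi : cofibrations C i) (hp : fibrations C p) :
    SSet.modelCategoryQuillen.J.rlp
      (Functor.PullbackObjObj.ofHasPullback (SimplicialCategory.sHomFunctor C) i p).π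
  trivialFibration ⦃A B X Y : C⦄ (i : A ⟶ B) (p : X ⟶ Y)
    (hi : cofibrations C i) (hp : fibrations C p)
    (h : weakEquivalences C i ∨ weakEquivalences C p) :
    SSet.modelCategoryQuillen.I.rlp
      (Functor.PullbackObjObj.ofHasPullback (SimplicialCategory.sHomFunctor C) i p).π

/-- `P` and `Q` generate the model structure by lifting: the trivial cofibrations are the maps with
the left lifting property for all maps in `P`, the cofibrations are the maps with the left lifting
property for all maps in `Q`. -/
structure GeneratesByLifting {C : Type w} [Category.{u} C] [ModelCategory C]
    (P Q : MorphismProperty C) : Prop where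
  trivialCofibrations_eq : trivialCofibrations C = P.llp
  cofibrations_eq : cofibrations C = Q.llp

/-- The model category `C` is fibrantly generated, with `P` as a set of generating fibrations and
`Q` as a set of generating trivial fibrations: this is the dual of the notion of a cofibrantly
generated model category. The classes `P` and `Q` are small, they permit the cosmall object
argument, and they generate the model structure by lifting. -/
structure IsFibrantlyGenerated {C : Type w} [Category.{u} C] [ModelCategory C]
    (P Q : MorphismProperty C) : Prop extends GeneratesByLifting P Q where
  isSmall_P : MorphismProperty.IsSmall.{u} P
  isSmall_Q : MorphismProperty.IsSmall.{u} Q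
  cosmall_P : MorphismProperty.HasSmallObjectArgument.{u} P.op
  cosmall_Q : MorphismProperty.HasSmallObjectArgument.{u} Q.op

end General

/-! ### Profinite spaces and their continuous cohomology -/

/-- Profinite spaces, that is, simplicial profinite sets. The simplicial enrichment is the one that
Mathlib gives to the simplicial objects of any category; for profinite spaces `X` and `Y` an
`n`-simplex of `sHom X Y` is a natural family of continuous maps `X_k ⟶ Y_k`, indexed by the
`k`-simplices of `Δ[n]`. As `Δ[n]` is finite in each degree, this is a map `X × Δ[n] ⟶ Y` of
profinite spaces. -/
abbrev ProfiniteSpace := SimplicialObject Profinite.{u}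

namespace ProfiniteSpace

/-- The contravariant functor which sends a profinite set `S` to the group of continuous maps from
`S` to `π`. -/
def continuousMaps (π : Type w) [AddCommGroup π] [TopologicalSpace π] [IsTopologicalAddGroup π] :
    Profinite.{u}ᵒᵖ ⥤ AddCommGrpCat.{max u w} where
  obj S := AddCommGrpCat.of C(S.unop, π)
  map f := AddCommGrpCat.ofHom
    { toFun := fun α => α.comp f.unop.hom.hom
      map_zero' := rfl
      map_add' := fun _ _ => rfl }

/-- The complex `C^*(X; π)` of continuous cochains; its differential is the alternating sum of the
maps that are induced by the faces of `X`. -/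
def cochains (X : ProfiniteSpace.{u}) (π : Type w) [AddCommGroup π] [TopologicalSpace π]
    [IsTopologicalAddGroup π] : CochainComplex AddCommGrpCat.{max u w} ℕ :=
  (AlgebraicTopology.alternatingCofaceMapComplex _).obj (X.rightOp ⋙ continuousMaps π)

/-- The map `C^*(Y; π) ⟶ C^*(X; π)` that is induced by `f : X ⟶ Y`. -/
def cochainsMap {X Y : ProfiniteSpace.{u}} (f : X ⟶ Y) (π : Type w) [AddCommGroup π]
    [TopologicalSpace π] [IsTopologicalAddGroup π] : cochains Y π ⟶ cochains X π :=
  (AlgebraicTopology.alternatingCofaceMapComplex _).map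
    (Functor.whiskerRight (NatTrans.rightOp f) (continuousMaps π))

/-- The maps that induce isomorphisms `H^n(Y; ℤ/ℓ) ⟶ H^n(X; ℤ/ℓ)` in continuous cohomology for
all `n`, where `ℤ/ℓ` is discrete. -/
def cohomologyIsos (ℓ : ℕ) : MorphismProperty ProfiniteSpace.{u} :=
  fun _ _ f => ∀ n : ℕ, IsIso (HomologicalComplex.homologyMap (cochainsMap f (ZMod ℓ)) n)

/-- The dimensionwise monomorphisms. -/
def dimensionwiseMonos : MorphismProperty ProfiniteSpace.{u} :=
  fun _ _ f => ∀ n : ℕ, Mono (f.app (op (SimplexCategory.mk n)))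

/-- The profinite space with exactly one simplex in each dimension. -/
def point : ProfiniteSpace.{u} :=
  (SimplicialObject.const Profinite.{u}).obj (Profinite.of PUnit.{u + 1})

/-- The map to the one-point space. -/
def toPoint (X : ProfiniteSpace.{u}) : X ⟶ point where
  app _ := CompHausLike.ofHom _ (ContinuousMap.const _ PUnit.unit)
  naturality _ _ _ := rfl

/-- The profinite space `L(S, n)`, which represents the functor `X ↦ C(X_n, S)`. -/
def L (S : Type u) [TopologicalSpace S] [CompactSpace S] [T2Space S]
    [TotallyDisconnectedSpace S] (n : ℕ) : ProfiniteSpace.{u} where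
  obj k := Profinite.of ((SimplexCategory.mk n ⟶ k.unop) → S)
  map θ := CompHausLike.ofHom _
    { toFun := fun g φ => g (φ ≫ θ.unop)
      continuous_toFun := by fun_prop }

end ProfiniteSpace

/-! ### Abelian pro-`ℓ`-groups and profinite Eilenberg-Mac Lane spaces -/

/-- Abelian pro-`ℓ`-groups: profinite abelian groups all of whose finite quotients (by open
subgroups) have order a power of `ℓ`. -/
structure AbelianProGroup (ℓ : ℕ) where
  carrier : Type u
  [addCommGroup : AddCommGroup carrier]
  [topologicalSpace : TopologicalSpace carrier]
  [isTopologicalAddGroup : IsTopologicalAddGroup carrier]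
  [compactSpace : CompactSpace carrier]
  [t2Space : T2Space carrier]
  [totallyDisconnectedSpace : TotallyDisconnectedSpace carrier]
  index_eq_pow (U : OpenAddSubgroup carrier) : ∃ k : ℕ, U.toAddSubgroup.index = ℓ ^ k

namespace AbelianProGroup

attribute [instance] addCommGroup topologicalSpace isTopologicalAddGroup compactSpace t2Space
  totallyDisconnectedSpace

end AbelianProGroup

namespace ProfiniteSpace

variable {ℓ : ℕ} (M : AbelianProGroup.{u} ℓ)

/-- The differential `L(M, n)_k → L(M, n + 1)_k`. -/
def d (n : ℕ) (k : SimplexCategory) (g : (SimplexCategory.mk n ⟶ k) → M.carrier) :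
    (SimplexCategory.mk (n + 1) ⟶ k) → M.carrier :=
  fun ψ => ∑ i : Fin (n + 2), (-1 : ℤ) ^ (i : ℕ) • g (SimplexCategory.δ i ≫ ψ)

theorem continuous_d (n : ℕ) (k : SimplexCategory) : Continuous (d M n k) := by
  unfold d
  fun_prop

/-- The cosimplicial group `[n] ↦ L(M, n)_k`. -/
def cosimplicialL (k : SimplexCategory) : CosimplicialObject AddCommGrpCat.{u} where
  obj a := AddCommGrpCat.of ((a ⟶ k) → M.carrier)
  map f := AddCommGrpCat.ofHom
    { toFun := fun g φ => g (f ≫ φ)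
      map_zero' := rfl
      map_add' := fun _ _ => rfl }

theorem d_eq_objD (n : ℕ) (k : SimplexCategory) (g : (SimplexCategory.mk n ⟶ k) → M.carrier) :
    d M n k g = (AlgebraicTopology.AlternatingCofaceMapComplex.objD (cosimplicialL M k) n).hom g := by
  funext ψ
  let ev : (AddCommGrpCat.of ((SimplexCategory.mk n ⟶ k) → M.carrier) ⟶
      AddCommGrpCat.of ((SimplexCategory.mk (n + 1) ⟶ k) → M.carrier)) →+ M.carrier :=
    { toFun := fun f => f.hom g ψ
      map_zero' := rfl
      map_add' := fun _ _ => rfl }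
  exact (map_sum ev (fun i : Fin (n + 2) => (-1 : ℤ) ^ (i : ℕ) • (cosimplicialL M k).δ i)
    Finset.univ).symm

theorem d_d (n : ℕ) (k : SimplexCategory) (g : (SimplexCategory.mk n ⟶ k) → M.carrier) :
    d M (n + 1) k (d M n k g) = 0 := by
  rw [d_eq_objD, d_eq_objD]
  exact ConcreteCategory.congr_hom
    (AlgebraicTopology.AlternatingCofaceMapComplex.d_squared (cosimplicialL M k) n) g

theorem d_zero (n : ℕ) (k : SimplexCategory) : d M n k 0 = 0 := by
  funext ψ
  simp [d]

theorem d_naturality (n : ℕ) {k k' : SimplexCategory} (θ : k' ⟶ k)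
    (g : (SimplexCategory.mk n ⟶ k) → M.carrier) :
    d M n k' (fun φ => g (φ ≫ θ)) = fun ψ => d M n k g (ψ ≫ θ) := by
  funext ψ
  simp [d]

/-- The cocycles in `L(M, n)_k`, that is, the group `Z^n(Δ[k]; M)`. -/
abbrev Cocycles (n : ℕ) (k : SimplexCategory) : Type u :=
  {g : (SimplexCategory.mk n ⟶ k) → M.carrier // d M n k g = 0}

instance (n : ℕ) (k : SimplexCategory) : CompactSpace (Cocycles M n k) :=
  isCompact_iff_compactSpace.mp
    (isClosed_singleton.preimage (continuous_d M n k) :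
      IsClosed {g : (SimplexCategory.mk n ⟶ k) → M.carrier | d M n k g = 0}).isCompact

/-- The restriction map `Z^n(Δ[k]; M) → Z^n(Δ[k']; M)` along `θ : [k'] ⟶ [k]`. -/
def cocyclesMap (n : ℕ) {k k' : SimplexCategory} (θ : k' ⟶ k) (g : Cocycles M n k) :
    Cocycles M n k' :=
  ⟨fun φ => g.1 (φ ≫ θ), by rw [d_naturality, g.2]; rfl⟩

theorem continuous_cocyclesMap (n : ℕ) {k k' : SimplexCategory} (θ : k' ⟶ k) :
    Continuous (cocyclesMap M n θ) := by
  have h : Continuous fun g : Cocycles M n k => fun φ : SimplexCategory.mk n ⟶ k' => g.1 (φ ≫ θ) :=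
    continuous_pi fun φ => (continuous_apply (φ ≫ θ)).comp continuous_subtype_val
  exact h.subtype_mk _

/-- The profinite Eilenberg-Mac Lane space `K(M, n)`, which represents the functor
`X ↦ Z^n(X; M)`. -/
def K (n : ℕ) : ProfiniteSpace.{u} where
  obj k := Profinite.of (Cocycles M n k.unop)
  map θ := CompHausLike.ofHom _ ⟨cocyclesMap M n θ.unop, continuous_cocyclesMap M n θ.unop⟩
  map_id k := by
    ext (g : Cocycles M n k.unop) φ
    exact congrArg g.1 (Category.comp_id φ)
  map_comp {k k' k''} θ θ' := by
    ext (g : Cocycles M n k.unop) φ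
    exact congrArg g.1 (Category.assoc φ θ'.unop θ.unop).symm

/-- The map `L(M, n) ⟶ K(M, n + 1)` that is given by the differential. -/
def LToK (n : ℕ) : L M.carrier n ⟶ K M (n + 1) where
  app k := CompHausLike.ofHom _
    { toFun := fun g => ⟨d M n k.unop g, d_d M n k.unop g⟩
      continuous_toFun := (continuous_d M n k.unop).subtype_mk _ }
  naturality k k' θ := by
    ext g
    exact Subtype.ext (d_naturality M n θ.unop g)

/-- The zero map `* ⟶ K(M, 0)`. This is the map `L(M, n) ⟶ K(M, n + 1)` for `n = -1`, where the
cochain group `C^{-1}` is zero, so that `L(M, -1)` is a point. -/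
def pointToK : point ⟶ K M 0 where
  app k := CompHausLike.ofHom _ (ContinuousMap.const _ ⟨0, d_zero M 0 k.unop⟩)
  naturality _ _ _ := rfl

/-- The maps `L(M, n) ⟶ K(M, n + 1)` for `n ≥ -1` (with `L(M, -1) = *`) and `K(M, n) ⟶ *` for
`n ≥ 0`, for the groups `M` in `𝓜`. -/
inductive generatingFibrations (𝓜 : Set (AbelianProGroup.{u} ℓ)) :
    MorphismProperty ProfiniteSpace.{u}
  | lToK (M : AbelianProGroup.{u} ℓ) (hM : M ∈ 𝓜) (n : ℕ) : generatingFibrations 𝓜 (LToK M n)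
  | pointToK (M : AbelianProGroup.{u} ℓ) (hM : M ∈ 𝓜) : generatingFibrations 𝓜 (pointToK M)
  | kToPoint (M : AbelianProGroup.{u} ℓ) (hM : M ∈ 𝓜) (n : ℕ) :
      generatingFibrations 𝓜 (toPoint (K M n))

/-- The maps `L(M, n) ⟶ *` for `n ≥ 0`, for the groups `M` in `𝓜`. -/
inductive generatingTrivialFibrations (𝓜 : Set (AbelianProGroup.{u} ℓ)) :
    MorphismProperty ProfiniteSpace.{u}
  | lToPoint (M : AbelianProGroup.{u} ℓ) (hM : M ∈ 𝓜) (n : ℕ) :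
      generatingTrivialFibrations 𝓜 (toPoint (L M.carrier n))

end ProfiniteSpace

end

/-!
The cofibrations and trivial cofibrations are recognized by lifting cochains. As `L(M, n)` and
`K(M, n)` represent continuous `n`-cochains and `n`-cocycles, a map `f : A ⟶ B` has the left lifting
property for `Q_𝓜` if all cochains on `A` with coefficients in `M ∈ 𝓜` lift to `B` (`LiftsCochains`),
and for `P_𝓜` if a cochain on `A` lifts to a cochain on `B` with any prescribed compatible
coboundary (`LiftsCocycles`). For the coefficients `ℤ/ℓ` the first condition says that `f` is a
dimensionwise monomorphism (`dimensionwiseMonos_iff_liftsCochains`), since continuous functions to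
finite sets extend along injections and separate points, and the second one says that in addition
the cohomology of `f` is an isomorphism (`liftsCocycles_iff`). Both conditions pass from `ℤ/ℓ` to all
abelian pro-`ℓ`-groups `M` by dévissage (`AbelianProGroup.exists_continuousMap_of_forall_zmod`): by
Zorn's lemma there is a minimal closed subgroup `N` of `M` modulo which the lifting problem has a
solution, and a nonzero `N` has a character to `ℤ/ℓ`, with which the solution can be improved.
A closed relation between `B` and `M` takes the place of a continuous map to `M / N`. This gives
`llp_generatingFibrations_eq` and `llp_generatingTrivialFibrations_eq`.

Profinite sets are small limits of finite sets, so that they are cosmall, as are `L(M, n)` and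
`K(M, n)`. Hence the dual of the small object argument applies to `P_𝓜` and `Q_𝓜` if `𝓜` is small, and
gives the two factorizations. The model structure `modelCategory` follows from these by a retract
argument, once maps `p` with the right lifting property for all monomorphisms are known to be
cohomology isomorphisms (`rlp_dimensionwiseMonos_le`). Such a `p` has a section, and is a homotopy
inverse to it, by lifting along `X ⊗ {0, 1} ⟶ X ⊗ Δ[1]`.

Left properness is a diagram chase with cocycles, since cochains on a pushout are compatible pairs of
cochains and cochains extend along a monomorphism (`cohomologyIsos_of_isPushout`).

For the simplicial structure, `X ⊗ K` is the dimensionwise coproduct of copies of `X_n` indexed by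
`K_n`, and by adjunction the axiom becomes a statement about pushout products `i □ j`, where `i` is a
cofibration and `j` is the inclusion of a horn or of a boundary in a simplex. These are
monomorphisms because cochains extend. If `j` is the inclusion of a horn, then the horn and the
simplex contract to a vertex (`cohomologyIsos_tensorFst_of_isStar`), so that `X ⊗ j` is a cohomology
isomorphism for all `X`, and left properness gives the same for `i □ j`. If `i` is a trivial
cofibration and `j` is the inclusion of `∂Δ[n]`, one needs that `i ⊗ ∂Δ[n]` is a cohomology
isomorphism (`cohomologyIsos_tensorMap_boundary`); this follows by induction on `n`, because
`∂Δ[n + 1]` arises from a horn by attaching `Δ[n]` along `∂Δ[n]`.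
-/

/-! ### Homology of complexes of abelian groups in terms of cocycles -/

section AbHomology

open HomologicalComplex

variable {K K' : CochainComplex AddCommGrpCat.{w} ℕ} (φ ψ : K ⟶ K') (n : ℕ)

theorem exists_iCycles_eq (z : K.X n) (hz : K.d n (n + 1) z = 0) :
    ∃ y : K.cycles n, K.iCycles n y = z := by
  have hex : (ShortComplex.mk (K.iCycles n) (K.d n (n + 1)) (by simp)).Exact :=
    ShortComplex.exact_of_f_is_kernel _ (K.cyclesIsKernel n (n + 1) (by simp))
  exact ((ShortComplex.ab_exact_iff _).1 hex) z hz

theorem d_iCycles (y : K.cycles n) : K.d n (n + 1) (K.iCycles n y) = 0 := by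
  rw [← ConcreteCategory.comp_apply, iCycles_d]; rfl

theorem iCycles_injective : Function.Injective (K.iCycles n) :=
  (AddCommGrpCat.mono_iff_injective _).1 inferInstance

theorem homologyπ_surjective : Function.Surjective (K.homologyπ n) :=
  (AddCommGrpCat.epi_iff_surjective _).1 inferInstance

theorem homologyπ_eq_zero_iff (y : K.cycles n) :
    K.homologyπ n y = 0 ↔
      ∃ c : K.X ((ComplexShape.up ℕ).prev n), K.d _ n c = K.iCycles n y := by
  have hex : (ShortComplex.mk (K.toCycles ((ComplexShape.up ℕ).prev n) n) (K.homologyπ n)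
      (by simp)).Exact :=
    ShortComplex.exact_of_g_is_cokernel _ (K.homologyIsCokernel _ n rfl)
  constructor
  · intro h
    obtain ⟨c, hc⟩ := ((ShortComplex.ab_exact_iff _).1 hex) y h
    refine ⟨c, ?_⟩
    rw [← K.toCycles_i, ConcreteCategory.comp_apply]
    exact congrArg _ hc
  · rintro ⟨c, hc⟩
    have : K.toCycles _ n c = y := by
      apply iCycles_injective
      rw [← ConcreteCategory.comp_apply, K.toCycles_i, hc]
    rw [← this, ← ConcreteCategory.comp_apply, K.toCycles_comp_homologyπ]
    rfl

theorem homologyMap_homologyπ (y : K.cycles n) :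
    homologyMap φ n (K.homologyπ n y) = K'.homologyπ n (cyclesMap φ n y) := by
  rw [← ConcreteCategory.comp_apply, homologyπ_naturality, ConcreteCategory.comp_apply]

theorem iCycles_cyclesMap (y : K.cycles n) :
    K'.iCycles n (cyclesMap φ n y) = φ.f n (K.iCycles n y) := by
  rw [← ConcreteCategory.comp_apply, cyclesMap_i, ConcreteCategory.comp_apply]

theorem homologyMap_eq_of_cocycles
    (h : ∀ z : K.X n, K.d n (n + 1) z = 0 →
      ∃ c : K'.X ((ComplexShape.up ℕ).prev n), K'.d _ n c = φ.f n z - ψ.f n z) :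
    homologyMap φ n = homologyMap ψ n := by
  ext x
  obtain ⟨y, rfl⟩ := homologyπ_surjective n x
  change homologyMap φ n _ = homologyMap ψ n _
  rw [homologyMap_homologyπ, homologyMap_homologyπ, ← sub_eq_zero, ← map_sub,
    homologyπ_eq_zero_iff, map_sub, iCycles_cyclesMap, iCycles_cyclesMap]
  exact h _ (d_iCycles n y)

theorem isIso_homologyMap_iff :
    IsIso (homologyMap φ n) ↔
      (∀ z : K.X n, K.d n (n + 1) z = 0 →
        (∃ c : K'.X ((ComplexShape.up ℕ).prev n), K'.d _ n c = φ.f n z) →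
        ∃ c : K.X ((ComplexShape.up ℕ).prev n), K.d _ n c = z) ∧
      (∀ w : K'.X n, K'.d n (n + 1) w = 0 →
        ∃ z : K.X n, K.d n (n + 1) z = 0 ∧
          ∃ c : K'.X ((ComplexShape.up ℕ).prev n), K'.d _ n c = w - φ.f n z) := by
  rw [ConcreteCategory.isIso_iff_bijective]
  refine and_congr ?_ ?_
  · rw [injective_iff_map_eq_zero]
    constructor
    · intro h z hz hc
      obtain ⟨y, rfl⟩ := exists_iCycles_eq n z hz
      rw [← homologyπ_eq_zero_iff]
      refine h _ ?_
      rw [homologyMap_homologyπ, homologyπ_eq_zero_iff, iCycles_cyclesMap]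
      exact hc
    · intro h x hx
      obtain ⟨y, rfl⟩ := homologyπ_surjective n x
      rw [homologyMap_homologyπ, homologyπ_eq_zero_iff, iCycles_cyclesMap] at hx
      rw [homologyπ_eq_zero_iff]
      exact h _ (d_iCycles n y) hx
  · constructor
    · intro h w hw
      obtain ⟨y, rfl⟩ := exists_iCycles_eq n w hw
      obtain ⟨x, hx⟩ := h (K'.homologyπ n y)
      obtain ⟨z, rfl⟩ := homologyπ_surjective n x
      refine ⟨K.iCycles n z, d_iCycles n z, ?_⟩
      rw [← iCycles_cyclesMap, ← map_sub, ← homologyπ_eq_zero_iff, map_sub,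
        ← homologyMap_homologyπ, hx, sub_self]
    · intro h x
      obtain ⟨y, rfl⟩ := homologyπ_surjective n x
      obtain ⟨z, hz, hc⟩ := h (K'.iCycles n y) (d_iCycles n y)
      obtain ⟨z, rfl⟩ := exists_iCycles_eq n z hz
      refine ⟨K.homologyπ n z, ?_⟩
      rw [← iCycles_cyclesMap, ← map_sub, ← homologyπ_eq_zero_iff, map_sub, sub_eq_zero] at hc
      rw [homologyMap_homologyπ, hc]

end AbHomology

/-! ### Continuous cochains -/

namespace ProfiniteSpace

section Pull

variable {X Y Z : ProfiniteSpace.{u}} {S : Type w} [TopologicalSpace S]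

/-- The restriction of a continuous cochain along a map of profinite spaces. -/
def pull (f : X ⟶ Y) {n : ℕ} (c : C(Y.obj (op (.mk n)), S)) : C(X.obj (op (.mk n)), S) :=
  c.comp (f.app (op (.mk n))).hom.hom

theorem pull_apply (f : X ⟶ Y) {n : ℕ} (c : C(Y.obj (op (.mk n)), S)) (x : X.obj (op (.mk n))) :
    pull f c x = c (f.app (op (.mk n)) x) := rfl

theorem pull_comp (f : X ⟶ Y) (g : Y ⟶ Z) {n : ℕ} (c : C(Z.obj (op (.mk n)), S)) :
    pull (f ≫ g) c = pull f (pull g c) := rfl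

end Pull

section Cochains

variable {X Y Z : ProfiniteSpace.{u}} {π : Type w} [AddCommGroup π] [TopologicalSpace π]
  [IsTopologicalAddGroup π]

/-- The coboundary of a continuous cochain. -/
def coboundary {n : ℕ} (c : C(X.obj (op (.mk n)), π)) : C(X.obj (op (.mk (n + 1))), π) where
  toFun x := ∑ i : Fin (n + 2), (-1 : ℤ) ^ (i : ℕ) • c (X.δ i x)
  continuous_toFun := by
    refine continuous_finsetSum _ fun i _ => ?_
    exact (c.continuous.comp (X.δ i).hom.hom.continuous).zsmul _

theorem coboundary_apply {n : ℕ} (c : C(X.obj (op (.mk n)), π)) (x : X.obj (op (.mk (n + 1)))) :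
    coboundary c x = ∑ i : Fin (n + 2), (-1 : ℤ) ^ (i : ℕ) • c (X.δ i x) := rfl

theorem pull_add (f : X ⟶ Y) {n : ℕ} (c c' : C(Y.obj (op (.mk n)), π)) :
    pull f (c + c') = pull f c + pull f c' := rfl

theorem pull_sub (f : X ⟶ Y) {n : ℕ} (c c' : C(Y.obj (op (.mk n)), π)) :
    pull f (c - c') = pull f c - pull f c' := rfl

theorem cochains_d_apply {n : ℕ} (c : C(X.obj (op (.mk n)), π)) :
    (cochains X π).d n (n + 1) c = coboundary c := by
  have h : (cochains X π).d n (n + 1) =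
      AlgebraicTopology.AlternatingCofaceMapComplex.objD (X.rightOp ⋙ continuousMaps π) n :=
    CochainComplex.of_d (fun n => (X.rightOp ⋙ continuousMaps π).obj (SimplexCategory.mk n))
      (AlgebraicTopology.AlternatingCofaceMapComplex.objD (X.rightOp ⋙ continuousMaps π)) n
  rw [h]
  refine ContinuousMap.ext fun x => ?_
  let ev : ((X.rightOp ⋙ continuousMaps π).obj (SimplexCategory.mk n) ⟶
      (X.rightOp ⋙ continuousMaps π).obj (SimplexCategory.mk (n + 1))) →+ π :=
    { toFun := fun f => (show C(X.obj (op (.mk (n + 1))), π) from f.hom c) x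
      map_zero' := rfl
      map_add' := fun _ _ => rfl }
  exact (map_sum ev (fun i : Fin (n + 2) =>
    (-1 : ℤ) ^ (i : ℕ) • CosimplicialObject.δ (X.rightOp ⋙ continuousMaps π) i) Finset.univ)

theorem coboundary_add {n : ℕ} (c c' : C(X.obj (op (.mk n)), π)) :
    coboundary (c + c') = coboundary c + coboundary c' := by
  ext x
  simp [coboundary_apply, Finset.sum_add_distrib]

theorem coboundary_sub {n : ℕ} (c c' : C(X.obj (op (.mk n)), π)) :
    coboundary (c - c') = coboundary c - coboundary c' := by
  ext x
  simp [coboundary_apply, Finset.sum_sub_distrib, smul_sub]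

@[simp]
theorem coboundary_zero {n : ℕ} :
    coboundary (0 : C(X.obj (op (.mk n)), π)) = 0 := by
  ext x
  simp [coboundary_apply]

theorem coboundary_coboundary {n : ℕ} (c : C(X.obj (op (.mk n)), π)) :
    coboundary (coboundary c) = 0 := by
  have h := ConcreteCategory.congr_hom ((cochains X π).d_comp_d n (n + 1) (n + 2)) c
  have h' : (cochains X π).d (n + 1) (n + 2) ((cochains X π).d n (n + 1) c) = 0 := h
  rw [cochains_d_apply] at h'
  exact (cochains_d_apply _).symm.trans h'

theorem δ_app (f : X ⟶ Y) {n : ℕ} (i : Fin (n + 2)) (x : X.obj (op (.mk (n + 1)))) :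
    Y.δ i (f.app _ x) = f.app _ (X.δ i x) := by
  have := SimplicialObject.δ_naturality f i
  exact (ConcreteCategory.congr_hom this x).symm

theorem coboundary_pull (f : X ⟶ Y) {n : ℕ} (c : C(Y.obj (op (.mk n)), π)) :
    coboundary (pull f c) = pull f (coboundary c) := by
  ext x
  simp only [coboundary_apply, pull_apply, δ_app]

/-- A continuous `n`-cochain is a coboundary. There are no cochains in negative degree, so that
for `n = 0` this means that the cochain vanishes. -/
def IsCoboundary : ∀ {n : ℕ}, C(X.obj (op (.mk n)), π) → Prop
  | 0, z => z = 0
  | _ + 1, z => ∃ c, coboundary c = z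

theorem isCoboundary_iff {n : ℕ} (z : C(X.obj (op (.mk n)), π)) :
    IsCoboundary z ↔ ∃ c : (cochains X π).X ((ComplexShape.up ℕ).prev n),
      (cochains X π).d _ n c = z := by
  cases n with
  | zero =>
    have h : (cochains X π).d ((ComplexShape.up ℕ).prev 0) 0 = 0 :=
      HomologicalComplex.shape _ _ _ (by simp)
    rw [h]
    exact ⟨fun hz => ⟨0, hz.symm⟩, fun ⟨_, hc⟩ => hc.symm⟩
  | succ n =>
    have h : (ComplexShape.up ℕ).prev (n + 1) = n := by simp
    rw [h]
    simp only [IsCoboundary, ← cochains_d_apply]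
    rfl

theorem IsCoboundary.coboundary_eq_zero : ∀ {n : ℕ} {z : C(X.obj (op (.mk n)), π)},
    IsCoboundary z → coboundary z = 0
  | 0, _, h => by rw [h]; exact coboundary_zero
  | _ + 1, _, ⟨c, hc⟩ => by rw [← hc]; exact coboundary_coboundary c

/-- Continuous cohomology isomorphisms in terms of cocycles and coboundaries. -/
theorem cohomologyIsos_iff {ℓ : ℕ} (f : X ⟶ Y) :
    cohomologyIsos ℓ f ↔ ∀ n : ℕ,
      (∀ z : C(Y.obj (op (.mk n)), ZMod ℓ), coboundary z = 0 → IsCoboundary (pull f z) →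
        IsCoboundary z) ∧
      (∀ w : C(X.obj (op (.mk n)), ZMod ℓ), coboundary w = 0 →
        ∃ z : C(Y.obj (op (.mk n)), ZMod ℓ), coboundary z = 0 ∧ IsCoboundary (w - pull f z)) := by
  refine forall_congr' fun n => ?_
  rw [isIso_homologyMap_iff]
  simp only [isCoboundary_iff, ← cochains_d_apply]
  rfl

theorem cochainsMap_id : cochainsMap (𝟙 X) π = 𝟙 _ := by
  ext n c
  rfl

theorem cochainsMap_comp (f : X ⟶ Y) (g : Y ⟶ Z) :
    cochainsMap (f ≫ g) π = cochainsMap g π ≫ cochainsMap f π := by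
  ext n c
  rfl

end Cochains

/-- Continuous cohomology with coefficients in `π`, as a contravariant functor. -/
noncomputable def cohomologyFunctor (π : Type w) [AddCommGroup π] [TopologicalSpace π]
    [IsTopologicalAddGroup π] (n : ℕ) : ProfiniteSpace.{u}ᵒᵖ ⥤ AddCommGrpCat.{max u w} where
  obj X := (cochains X.unop π).homology n
  map f := HomologicalComplex.homologyMap (cochainsMap f.unop π) n
  map_id X := by simp [cochainsMap_id]
  map_comp f g := by simp [cochainsMap_comp, HomologicalComplex.homologyMap_comp]

instance (ℓ : ℕ) : (cohomologyIsos.{u} ℓ).HasTwoOutOfThreeProperty where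
  comp_mem f g hf hg n := by
    have := hf n
    have := hg n
    rw [cochainsMap_comp, HomologicalComplex.homologyMap_comp]
    infer_instance
  of_postcomp f g hg hfg n := by
    have := hg n
    have h := hfg n
    rw [cochainsMap_comp, HomologicalComplex.homologyMap_comp] at h
    exact IsIso.of_isIso_comp_left (HomologicalComplex.homologyMap (cochainsMap g (ZMod ℓ)) n) _
  of_precomp f g hf hfg n := by
    have := hf n
    have h := hfg n
    rw [cochainsMap_comp, HomologicalComplex.homologyMap_comp] at h
    exact IsIso.of_isIso_comp_right _ (HomologicalComplex.homologyMap (cochainsMap f (ZMod ℓ)) n)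

theorem cohomologyIsos_of_isIso {ℓ : ℕ} {X Y : ProfiniteSpace.{u}} (f : X ⟶ Y) [IsIso f] :
    cohomologyIsos ℓ f := fun n =>
  inferInstanceAs (IsIso ((cohomologyFunctor (ZMod ℓ) n).map f.op))

end ProfiniteSpace

/-! ### Simplicial homotopies and cohomology -/

section SimplicialHomotopy

open Simplicial SSet

variable {C : Type*} [Category* C] {X Y : SimplicialObject C}

/-- A natural family of maps `X_n ⟶ Y_n`, indexed by the `n`-simplices of `Δ[1]`, gives a
combinatorial homotopy between its restrictions to the two vertices of `Δ[1]`. -/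
def CategoryTheory.Functor.HomObj.toHomotopy (H : Functor.HomObj X Y (Δ[1] : SSet.{w}))
    {f g : X ⟶ Y}
    (hf : ∀ n : ℕ, H.app (op ⦋n⦌) (stdSimplex.objMk₁ (Fin.last (n + 1))) = f.app (op ⦋n⦌))
    (hg : ∀ n : ℕ, H.app (op ⦋n⦌) (stdSimplex.objMk₁ 0) = g.app (op ⦋n⦌)) :
    SimplicialObject.Homotopy f g := by
  have nδ {n : ℕ} (j : Fin (n + 2)) (a : (Δ[1] : SSet.{w}) _⦋n + 1⦌) :
      H.app (op ⦋n + 1⦌) a ≫ Y.δ j = X.δ j ≫ H.app (op ⦋n⦌) ((Δ[1] : SSet.{w}).δ j a) :=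
    (H.naturality (SimplexCategory.δ j).op a).symm
  have nσ {n : ℕ} (j : Fin (n + 1)) (a : (Δ[1] : SSet.{w}) _⦋n⦌) :
      H.app (op ⦋n⦌) a ≫ Y.σ j = X.σ j ≫ H.app (op ⦋n + 1⦌) ((Δ[1] : SSet.{w}).σ j a) :=
    (H.naturality (SimplexCategory.σ j).op a).symm
  exact
  { h := fun {n} i => X.σ i ≫ H.app (op ⦋n + 1⦌) (stdSimplex.objMk₁ i.succ.castSucc)
    h_zero_comp_δ_zero n := by
      rw [Category.assoc, nδ, ← hg, stdSimplex.δ_objMk₁_of_lt _ _ (by simp)]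
      exact (X.δ_comp_σ_self_assoc (i := (0 : Fin (n + 1))) _)
    h_last_comp_δ_last n := by
      rw [Category.assoc, nδ, ← hf, stdSimplex.δ_objMk₁_of_le _ _ (by simp)]
      exact (X.δ_comp_σ_succ_assoc (i := Fin.last n) _)
    h_succ_comp_δ_castSucc_of_lt {n} i j hij := by
      rw [Category.assoc, nδ, X.δ_comp_σ_of_le_assoc hij, stdSimplex.δ_objMk₁_of_lt]
      · rfl
      · rw [Fin.castSucc_lt_castSucc_iff]
        exact lt_of_le_of_lt (Fin.castSucc_le_castSucc_iff.2 hij)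
          (by rw [Fin.lt_def]; simp)
    h_succ_comp_δ_castSucc_succ {n} j := by
      rw [Category.assoc, Category.assoc, nδ, nδ, stdSimplex.δ_objMk₁_of_lt _ _ (by simp),
        stdSimplex.δ_objMk₁_of_le _ _ (by simp)]
      have h₁ := X.δ_comp_σ_self_assoc (i := j.succ)
        (H.app (op ⦋n + 1⦌) (stdSimplex.objMk₁ j.succ.castSucc))
      have h₂ := X.δ_comp_σ_succ_assoc (i := j.castSucc)
        (H.app (op ⦋n + 1⦌) (stdSimplex.objMk₁ j.succ.castSucc))
      exact h₁.trans h₂.symm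
    h_castSucc_comp_δ_succ_of_lt {n} i j hij := by
      rw [Category.assoc, nδ, X.δ_comp_σ_of_gt_assoc hij, stdSimplex.δ_objMk₁_of_le]
      · rfl
      · simpa using! Fin.le_of_lt hij
    h_comp_σ_castSucc_of_le {n} i j hij := by
      rw [Category.assoc, nσ, X.σ_comp_σ_assoc hij, stdSimplex.σ_objMk₁_of_lt _ _ (by simpa)]
      rfl
    h_comp_σ_succ_of_lt {n} i j hij := by
      rw [Category.assoc, nσ, stdSimplex.σ_objMk₁_of_le _ _ (by simpa)]
      have := X.σ_comp_σ_assoc hij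
        (H.app (op ⦋n + 2⦌) (stdSimplex.objMk₁ j.succ.castSucc.castSucc))
      exact this.symm }

end SimplicialHomotopy

namespace ProfiniteSpace

open Simplicial SSet

variable {X Y : ProfiniteSpace.{u}}

theorem unop_alternatingFaceMapComplex_d_apply {π : Type w} [AddCommGroup π] [TopologicalSpace π]
    [IsTopologicalAddGroup π] {n : ℕ} (c : C(X.obj (op (.mk n)), π)) :
    (show C(X.obj (op (.mk n)), π) →+ C(X.obj (op (.mk (n + 1))), π) from
      (((AlgebraicTopology.alternatingFaceMapComplex _).obj
      (((SimplicialObject.whiskering _ _).obj (continuousMaps π).rightOp).obj X)).d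
        (n + 1) n).unop.hom) c = coboundary c := by
  let A : CosimplicialObject AddCommGrpCat := X.rightOp ⋙ continuousMaps π
  have h : (cochains X π).d n (n + 1) = _ :=
    (CochainComplex.of_d (fun n => A.obj (SimplexCategory.mk n))
      (AlgebraicTopology.AlternatingCofaceMapComplex.objD A) n).trans
      (AlgebraicTopology.AlternatingCofaceMapComplex.d_eq_unop_d A n)
  rw [← cochains_d_apply, h, AlgebraicTopology.alternatingFaceMapComplex_obj_d]
  rfl

/-- Homotopic maps of profinite spaces differ by coboundaries on cocycles: the chain homotopy is
obtained in the opposite of the category of abelian groups, where the continuous cochains of a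
profinite space form a simplicial object. -/
theorem isCoboundary_pull_sub_pull {π : Type w} [AddCommGroup π] [TopologicalSpace π]
    [IsTopologicalAddGroup π] {f g : X ⟶ Y} (H : SimplicialObject.Homotopy f g) (n : ℕ)
    (z : C(Y.obj (op (.mk n)), π)) (hz : coboundary z = 0) :
    IsCoboundary (pull f z - pull g z) := by
  let T := (H.whiskerRight (continuousMaps π).rightOp).toChainHomotopy
  have hT := T.comm n
  cases n with
  | zero =>
    rw [prevD_eq T.hom (j' := 1) (w := by simp), dNext_eq_zero _ _ (by simp), zero_add] at hT
    let a : C(Y.obj (op (.mk 1)), π) →+ C(X.obj (op (.mk 0)), π) := (T.hom 0 1).unop.hom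
    have h : pull f z = a ((show C(Y.obj (op (.mk 0)), π) →+ C(Y.obj (op (.mk 1)), π) from
        (((AlgebraicTopology.alternatingFaceMapComplex _).obj
          (((SimplicialObject.whiskering _ _).obj (continuousMaps π).rightOp).obj Y)).d
            1 0).unop.hom) z) + pull g z :=
      ConcreteCategory.congr_hom (congrArg Quiver.Hom.unop hT) z
    rw [unop_alternatingFaceMapComplex_d_apply, hz, map_zero, zero_add] at h
    exact sub_eq_zero.2 h
  | succ n =>
    rw [prevD_eq T.hom (j' := n + 2) (w := by simp), dNext_eq T.hom (i' := n) (w := by simp)] at hT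
    let a : C(Y.obj (op (.mk (n + 2))), π) →+ C(X.obj (op (.mk (n + 1))), π) :=
      (T.hom (n + 1) (n + 2)).unop.hom
    let b : C(Y.obj (op (.mk (n + 1))), π) →+ C(X.obj (op (.mk n)), π) :=
      (T.hom n (n + 1)).unop.hom
    have h : pull f z = (show C(X.obj (op (.mk n)), π) →+ C(X.obj (op (.mk (n + 1))), π) from
        (((AlgebraicTopology.alternatingFaceMapComplex _).obj
          (((SimplicialObject.whiskering _ _).obj (continuousMaps π).rightOp).obj X)).d
            (n + 1) n).unop.hom) (b z) +
        a ((show C(Y.obj (op (.mk (n + 1))), π) →+ C(Y.obj (op (.mk (n + 2))), π) from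
        (((AlgebraicTopology.alternatingFaceMapComplex _).obj
          (((SimplicialObject.whiskering _ _).obj (continuousMaps π).rightOp).obj Y)).d
            (n + 2) (n + 1)).unop.hom) z) + pull g z :=
      ConcreteCategory.congr_hom (congrArg Quiver.Hom.unop hT) z
    rw [unop_alternatingFaceMapComplex_d_apply, unop_alternatingFaceMapComplex_d_apply, hz,
      map_zero, add_zero] at h
    exact ⟨b z, by rw [h, add_sub_cancel_right]⟩

theorem homologyMap_cochainsMap_eq {ℓ : ℕ} {f g : X ⟶ Y} (H : SimplicialObject.Homotopy f g)
    (n : ℕ) : HomologicalComplex.homologyMap (cochainsMap f (ZMod ℓ)) n =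
      HomologicalComplex.homologyMap (cochainsMap g (ZMod ℓ)) n :=
  homologyMap_eq_of_cocycles _ _ _ fun z hz =>
    (isCoboundary_iff _).1 (isCoboundary_pull_sub_pull H n z
      ((cochains_d_apply (X := Y) (π := ZMod ℓ) (n := n) z).symm.trans hz))

/-- A map that has an inverse up to maps inducing the identity in cohomology is a cohomology
isomorphism. -/
theorem cohomologyIsos_of_inverse {ℓ : ℕ} {f : X ⟶ Y} (g : Y ⟶ X)
    (h : ∀ n, HomologicalComplex.homologyMap (cochainsMap (f ≫ g) (ZMod ℓ)) n =
      HomologicalComplex.homologyMap (cochainsMap (𝟙 X) (ZMod ℓ)) n)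
    (h' : ∀ n, HomologicalComplex.homologyMap (cochainsMap (g ≫ f) (ZMod ℓ)) n =
      HomologicalComplex.homologyMap (cochainsMap (𝟙 Y) (ZMod ℓ)) n) :
    cohomologyIsos ℓ f := fun n => by
  refine ⟨HomologicalComplex.homologyMap (cochainsMap g (ZMod ℓ)) n, ?_, ?_⟩
  · rw [← HomologicalComplex.homologyMap_comp, ← cochainsMap_comp,
      ← HomologicalComplex.homologyMap_id, ← cochainsMap_id, h']
  · rw [← HomologicalComplex.homologyMap_comp, ← cochainsMap_comp,
      ← HomologicalComplex.homologyMap_id, ← cochainsMap_id, h]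

end ProfiniteSpace

/-! ### Lifting properties for the maps between the representing spaces -/

namespace ProfiniteSpace

section Representability

variable {X Y : ProfiniteSpace.{u}} {S : Type u} [TopologicalSpace S] [CompactSpace S] [T2Space S]
  [TotallyDisconnectedSpace S] {ℓ : ℕ} (M : AbelianProGroup.{u} ℓ)

theorem hom_app_map (f : X ⟶ Y) {k k' : SimplexCategoryᵒᵖ} (θ : k ⟶ k') (x : X.obj k) :
    f.app k' (X.map θ x) = Y.map θ (f.app k x) :=
  ConcreteCategory.congr_hom (f.naturality θ) x

theorem map_comp_apply (X : ProfiniteSpace.{u}) {k k' k'' : SimplexCategoryᵒᵖ} (θ : k ⟶ k')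
    (θ' : k' ⟶ k'') (x : X.obj k) : X.map (θ ≫ θ') x = X.map θ' (X.map θ x) :=
  ConcreteCategory.congr_hom (X.map_comp θ θ') x

theorem map_id_apply (X : ProfiniteSpace.{u}) {k : SimplexCategoryᵒᵖ} (x : X.obj k) :
    X.map (𝟙 k) x = x :=
  ConcreteCategory.congr_hom (X.map_id k) x

/-- The map to `L(S, n)` that corresponds to a continuous map on the `n`-simplices. -/
def toL {n : ℕ} (c : C(X.obj (op (.mk n)), S)) : X ⟶ L S n where
  app k := CompHausLike.ofHom _
    { toFun := fun x (φ : SimplexCategory.mk n ⟶ k.unop) => c (X.map φ.op x)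
      continuous_toFun := continuous_pi fun φ =>
        c.continuous.comp (X.map φ.op).hom.hom.continuous }
  naturality _ _ θ := by
    ext x
    funext φ
    exact congrArg c (map_comp_apply X θ φ.op x).symm

/-- The continuous map on the `n`-simplices that corresponds to a map to `L(S, n)`. -/
def ofL {n : ℕ} (g : X ⟶ L S n) : C(X.obj (op (.mk n)), S) where
  toFun x := (show (SimplexCategory.mk n ⟶ SimplexCategory.mk n) → S from
    g.app (op (.mk n)) x) (𝟙 _)
  continuous_toFun := (continuous_apply (𝟙 (SimplexCategory.mk n))).comp
    (g.app (op (.mk n))).hom.hom.continuous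

@[simp]
theorem ofL_toL {n : ℕ} (c : C(X.obj (op (.mk n)), S)) : ofL (toL c) = c := by
  ext x
  exact congrArg c (map_id_apply X x)

@[simp]
theorem toL_ofL {n : ℕ} (g : X ⟶ L S n) : toL (ofL g) = g := by
  ext k x
  funext φ
  refine (congrFun (hom_app_map g φ.op x) (𝟙 _)).trans ?_
  change (show (SimplexCategory.mk n ⟶ k.unop) → S from g.app k x) (𝟙 _ ≫ φ) = _
  rw [Category.id_comp]

theorem ofL_injective {n : ℕ} : Function.Injective (ofL : (X ⟶ L S n) → _) :=
  Function.LeftInverse.injective toL_ofL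

theorem ofL_comp {n : ℕ} (f : X ⟶ Y) (g : Y ⟶ L S n) : ofL (f ≫ g) = pull f (ofL g) := rfl

/-- The inclusion of the space `K(M, n)` in `L(M, n)`. -/
def KToL (n : ℕ) : K M n ⟶ L M.carrier n where
  app _ := CompHausLike.ofHom _ ⟨Subtype.val, continuous_subtype_val⟩
  naturality _ _ _ := rfl

theorem KToL_injective {n : ℕ} {g g' : X ⟶ K M n} (h : g ≫ KToL M n = g' ≫ KToL M n) :
    g = g' := by
  ext k x
  have hx := ConcreteCategory.congr_hom (NatTrans.congr_app h k) (show X.obj k from x)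
  exact Subtype.ext hx

/-- The cochain that corresponds to a map to `K(M, n)`. -/
def ofK {n : ℕ} (g : X ⟶ K M n) : C(X.obj (op (.mk n)), M.carrier) := ofL (g ≫ KToL M n)

theorem ofK_injective {n : ℕ} : Function.Injective (ofK M : (X ⟶ K M n) → _) :=
  fun _ _ h => KToL_injective M (ofL_injective h)

theorem ofK_comp {n : ℕ} (f : X ⟶ Y) (g : Y ⟶ K M n) : ofK M (f ≫ g) = pull f (ofK M g) := rfl

theorem d_toL {n : ℕ} (c : C(X.obj (op (.mk n)), M.carrier)) {k : SimplexCategoryᵒᵖ}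
    (x : X.obj k) (ψ : SimplexCategory.mk (n + 1) ⟶ k.unop) :
    d M n k.unop ((toL c).app k x) ψ = coboundary c (X.map ψ.op x) := by
  refine Finset.sum_congr rfl fun i _ => ?_
  congr 1
  exact congrArg c (map_comp_apply X ψ.op (SimplexCategory.δ i).op x)

theorem coboundary_ofK {n : ℕ} (g : X ⟶ K M n) : coboundary (ofK M g) = 0 := by
  ext x
  have h := d_toL M (ofK M g) x (𝟙 _)
  rw [ofK, toL_ofL] at h
  rw [op_id, map_id_apply] at h
  exact h.symm.trans (congrFun (show Cocycles M n _ from g.app _ x).2 _)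

/-- The map to `K(M, n)` that corresponds to a cocycle. -/
def toK {n : ℕ} (c : C(X.obj (op (.mk n)), M.carrier)) (hc : coboundary c = 0) : X ⟶ K M n where
  app k := CompHausLike.ofHom _
    { toFun := fun x => ⟨(toL c).app k x, by
        funext ψ
        exact (d_toL M c x ψ).trans (by rw [hc]; rfl)⟩
      continuous_toFun := by exact ((toL c).app k).hom.hom.continuous.subtype_mk _ }
  naturality _ _ θ := by
    ext x
    apply Subtype.ext
    exact hom_app_map (toL c) θ x

@[simp]
theorem ofK_toK {n : ℕ} (c : C(X.obj (op (.mk n)), M.carrier)) (hc : coboundary c = 0) :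
    ofK M (toK M c hc) = c := ofL_toL c

theorem ofK_comp_LToK {n : ℕ} (g : X ⟶ L M.carrier n) :
    ofK M (g ≫ LToK M n) = coboundary (ofL g) := by
  ext x
  have h := d_toL M (ofL g) x (𝟙 _)
  rw [toL_ofL] at h
  rw [op_id, map_id_apply] at h
  exact h

instance : Subsingleton (X ⟶ point) :=
  ⟨fun _ _ => by ext; rfl⟩

end Representability

section Lifting

variable {A B : ProfiniteSpace.{u}} (f : A ⟶ B) {ℓ : ℕ} (M : AbelianProGroup.{u} ℓ)

theorem hasLiftingProperty_LToPoint_iff (S : Type u) [TopologicalSpace S] [CompactSpace S]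
    [T2Space S] [TotallyDisconnectedSpace S] (n : ℕ) :
    HasLiftingProperty f (toPoint (L S n)) ↔
      Function.Surjective (pull f : C(B.obj (op (.mk n)), S) → C(A.obj (op (.mk n)), S)) := by
  constructor
  · intro h c
    have sq : CommSq (toL c) f (toPoint (L S n)) (toPoint B) := ⟨Subsingleton.elim _ _⟩
    exact ⟨ofL sq.lift, by rw [← ofL_comp, sq.fac_left, ofL_toL]⟩
  · intro h
    refine ⟨fun {g _} sq => ?_⟩
    obtain ⟨c, hc⟩ := h (ofL g)
    exact ⟨⟨{ l := toL c
              fac_left := ofL_injective (by rw [ofL_comp, ofL_toL, hc])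
              fac_right := Subsingleton.elim _ _ }⟩⟩

theorem hasLiftingProperty_KToPoint_iff (n : ℕ) :
    HasLiftingProperty f (toPoint (K M n)) ↔
      ∀ z : C(A.obj (op (.mk n)), M.carrier), coboundary z = 0 →
        ∃ z' : C(B.obj (op (.mk n)), M.carrier), coboundary z' = 0 ∧ pull f z' = z := by
  constructor
  · intro h z hz
    have sq : CommSq (toK M z hz) f (toPoint (K M n)) (toPoint B) := ⟨Subsingleton.elim _ _⟩
    exact ⟨ofK M sq.lift, coboundary_ofK M _, by rw [← ofK_comp, sq.fac_left, ofK_toK]⟩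
  · intro h
    refine ⟨fun {g _} sq => ?_⟩
    obtain ⟨c, hc, hc'⟩ := h (ofK M g) (coboundary_ofK M g)
    exact ⟨⟨{ l := toK M c hc
              fac_left := ofK_injective M (by rw [ofK_comp, ofK_toK, hc'])
              fac_right := Subsingleton.elim _ _ }⟩⟩

theorem hasLiftingProperty_LToK_iff (n : ℕ) :
    HasLiftingProperty f (LToK M n) ↔
      ∀ (c : C(A.obj (op (.mk n)), M.carrier)) (z : C(B.obj (op (.mk (n + 1))), M.carrier)),
        coboundary z = 0 → coboundary c = pull f z →
        ∃ c' : C(B.obj (op (.mk n)), M.carrier), pull f c' = c ∧ coboundary c' = z := by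
  constructor
  · intro h c z hz hc
    have sq : CommSq (toL c) f (LToK M n) (toK M z hz) :=
      ⟨ofK_injective M (by rw [ofK_comp_LToK, ofK_comp, ofK_toK, ofL_toL, hc])⟩
    refine ⟨ofL sq.lift, by rw [← ofL_comp, sq.fac_left, ofL_toL], ?_⟩
    rw [← ofK_comp_LToK, sq.fac_right, ofK_toK]
  · intro h
    refine ⟨fun {g g'} sq => ?_⟩
    obtain ⟨c, hc, hc'⟩ := h (ofL g) (ofK M g') (coboundary_ofK M g')
      (by rw [← ofK_comp_LToK, sq.w, ofK_comp])
    exact ⟨⟨{ l := toL c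
              fac_left := ofL_injective (by rw [ofL_comp, ofL_toL, hc])
              fac_right := ofK_injective M (by rw [ofK_comp_LToK, ofL_toL, hc']) }⟩⟩

theorem ofK_pointToK (g : A ⟶ point) : ofK M (g ≫ pointToK M) = 0 := rfl

theorem hasLiftingProperty_pointToK_iff :
    HasLiftingProperty f (pointToK M) ↔
      ∀ z : C(B.obj (op (.mk 0)), M.carrier), coboundary z = 0 → pull f z = 0 → z = 0 := by
  constructor
  · intro h z hz hc
    have sq : CommSq (toPoint A) f (pointToK M) (toK M z hz) :=
      ⟨ofK_injective M (by rw [ofK_pointToK, ofK_comp, ofK_toK, hc])⟩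
    rw [← ofK_toK M z hz, ← sq.fac_right, ofK_pointToK]
  · intro h
    refine ⟨fun {g g'} sq => ?_⟩
    have hz := h (ofK M g') (coboundary_ofK M g') (by rw [← ofK_comp, ← sq.w, ofK_pointToK])
    exact ⟨⟨{ l := toPoint B
              fac_left := Subsingleton.elim _ _
              fac_right := ofK_injective M (by rw [ofK_pointToK, hz]) }⟩⟩

end Lifting

end ProfiniteSpace

/-! ### Extension of continuous functions, and characters of abelian pro-`ℓ`-groups -/

/-- Continuous functions with values in a finite discrete set extend along injective continuous
maps of profinite sets. -/
theorem exists_continuousMap_extension {A B F : Type*} [TopologicalSpace A] [CompactSpace A]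
    [TopologicalSpace B] [CompactSpace B] [T2Space B] [TotallyDisconnectedSpace B]
    [TopologicalSpace F] [DiscreteTopology F] [Finite F] [Nonempty F]
    {f : A → B} (hf : Continuous f) (hf' : Function.Injective f) (c : C(A, F)) :
    ∃ c' : C(B, F), ∀ a, c' (f a) = c a := by
  classical
  obtain ⟨C, hC, hZ, -, hcov, hdis⟩ := exists_clopen_partition_of_clopen_cover
    (Z := fun v : F => f '' (c ⁻¹' {v})) (D := fun _ => Set.univ)
    (fun v => (((isClosed_discrete {v}).preimage c.continuous).isCompact.image hf).isClosed)
    (fun _ => isClopen_univ) (fun _ => Set.subset_univ _) (by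
      intro v _ v' _ hv
      refine Set.disjoint_left.2 ?_
      rintro _ ⟨a, ha, rfl⟩ ⟨a', ha', h⟩
      rw [hf' h] at ha'
      exact hv (ha.symm.trans ha'))
  have huniq : ∀ {b v v'}, b ∈ C v → b ∈ C v' → v = v' := fun {b v v'} h h' => by
    by_contra hne
    exact Set.disjoint_left.1 (hdis (Set.mem_univ v) (Set.mem_univ v') hne) h h'
  have hex : ∀ b, ∃ v, b ∈ C v := fun b =>
    Set.mem_iUnion.1 (hcov (Set.mem_iUnion.2 ⟨Classical.arbitrary F, Set.mem_univ b⟩))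
  choose g hg using hex
  refine ⟨⟨g, continuous_discrete_rng.2 fun v => ?_⟩, fun a => ?_⟩
  · have : g ⁻¹' {v} = C v := by
      ext b
      exact ⟨fun h => by rw [← show g b = v from h]; exact hg b, fun h => huniq (hg b) h⟩
    rw [this]
    exact (hC v).isOpen
  · exact huniq (hg (f a)) (hZ _ ⟨a, rfl, rfl⟩)

namespace AbelianProGroup

variable {ℓ : ℕ} [Fact ℓ.Prime]

theorem exists_addMonoidHom_ne_zero_of_module {V : Type*} [AddCommGroup V] [Module (ZMod ℓ) V]
    {v : V} (hv : v ≠ 0) : ∃ φ : V →+ ZMod ℓ, φ v ≠ 0 := by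
  obtain ⟨φ, hφ⟩ := Module.Projective.exists_dual_ne_zero (ZMod ℓ) hv
  exact ⟨φ.toAddMonoidHom, hφ⟩

/-- A nonzero finite abelian `ℓ`-group has a nonzero homomorphism to `ℤ/ℓ`: it is not
`ℓ`-divisible, and a nonzero vector space over `ℤ/ℓ` has a nonzero linear form. -/
theorem exists_addMonoidHom_ne_zero {Q : Type*} [AddCommGroup Q] [Finite Q] {k : ℕ}
    (hk : Nat.card Q ∣ ℓ ^ k) [Nontrivial Q] : ∃ χ : Q →+ ZMod ℓ, χ ≠ 0 := by
  let R : AddSubgroup Q := (zsmulAddGroupHom (ℓ : ℤ) : Q →+ Q).range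
  have hR : R ≠ ⊤ := by
    intro h
    have hsurj : Function.Surjective (zsmulAddGroupHom (ℓ : ℤ) : Q →+ Q) :=
      AddMonoidHom.range_eq_top.1 h
    have hit : ∀ (j : ℕ) (q : Q), ∃ q', (ℓ ^ j) • q' = q := by
      intro j
      induction j with
      | zero => exact fun q => ⟨q, by simp⟩
      | succ j ih =>
        intro q
        obtain ⟨q₁, rfl⟩ := ih q
        obtain ⟨q₂, rfl⟩ := hsurj q₁
        exact ⟨q₂, by simp [pow_succ, mul_nsmul']⟩
    obtain ⟨q, hq⟩ := exists_ne (0 : Q)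
    obtain ⟨q', rfl⟩ := hit k q
    apply hq
    obtain ⟨m, hm⟩ := hk
    rw [hm, mul_nsmul, card_nsmul_eq_zero', nsmul_zero]
  let _ : Module (ZMod ℓ) (Q ⧸ R) := AddCommGroup.zmodModule (n := ℓ) (by
    intro x
    induction x using QuotientAddGroup.induction_on with
    | H q =>
      rw [← QuotientAddGroup.mk_nsmul, QuotientAddGroup.eq_zero_iff]
      exact ⟨q, by simp⟩)
  obtain ⟨q, hq⟩ : ∃ q : Q, q ∉ R := by
    by_contra h
    push Not at h
    exact hR (eq_top_iff.2 fun q _ => h q)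
  have hq0 : (q : Q ⧸ R) ≠ 0 := by rwa [Ne, QuotientAddGroup.eq_zero_iff]
  obtain ⟨φ, hφ⟩ := exists_addMonoidHom_ne_zero_of_module (ℓ := ℓ) hq0
  exact ⟨φ.comp (QuotientAddGroup.mk' R), fun h => hφ (DFunLike.congr_fun h q)⟩

/-- A nonzero subgroup `N` of an abelian pro-`ℓ`-group has a nonzero homomorphism `χ` to `ℤ/ℓ`
that is the restriction of a continuous, `χ`-equivariant function on the whole group. -/
theorem exists_character (M : AbelianProGroup ℓ) (N : AddSubgroup M.carrier) (hN : N ≠ ⊥) :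
    ∃ (χ : N →+ ZMod ℓ) (ρ : C(M.carrier, ZMod ℓ)), Function.Surjective χ ∧
      ∀ (x : M.carrier) (n : N), ρ (x + n) = ρ x + χ n := by
  obtain ⟨⟨n₀, hn₀⟩, hne⟩ := (AddSubgroup.nontrivial_iff_exists_ne_zero N).1
    ((AddSubgroup.nontrivial_iff_ne_bot N).2 hN) |> fun ⟨x, hx, h⟩ =>
      (⟨⟨x, hx⟩, h⟩ : ∃ x : N, (x : M.carrier) ≠ 0)
  obtain ⟨U, hU, hU₀, hnU⟩ := exists_isClopen_of_totally_separated (Ne.symm hne)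
  obtain ⟨V, hV⟩ := IsTopologicalAddGroup.exist_openAddSubgroup_sub_clopen_nhds_of_zero hU hU₀
  let mk : M.carrier →+ M.carrier ⧸ V.toAddSubgroup := QuotientAddGroup.mk' V.toAddSubgroup
  obtain ⟨k, hk⟩ := M.index_eq_pow V
  have hfin : Finite (M.carrier ⧸ V.toAddSubgroup) := by
    apply Nat.finite_of_card_ne_zero
    change V.toAddSubgroup.index ≠ 0
    rw [hk]
    exact pow_ne_zero _ (Fact.out : ℓ.Prime).ne_zero
  let Q : AddSubgroup (M.carrier ⧸ V.toAddSubgroup) := N.map mk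
  have hQ : Nontrivial Q := by
    refine ⟨⟨mk n₀, AddSubgroup.mem_map_of_mem mk hn₀⟩, 0, fun h => ?_⟩
    have h' : mk n₀ = 0 := congrArg Subtype.val h
    exact hnU (hV ((QuotientAddGroup.eq_zero_iff n₀).1 h'))
  obtain ⟨χ, hχ⟩ := exists_addMonoidHom_ne_zero (ℓ := ℓ) (Q := Q) (k := k)
    (by rw [← hk]; exact AddSubgroup.card_addSubgroup_dvd_card Q)
  have hdisc : DiscreteTopology (M.carrier ⧸ V.toAddSubgroup) :=
    QuotientAddGroup.discreteTopology V.isOpen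
  -- the equivariant extension of `χ` depends on the choice of representatives modulo `Q`
  let r : (M.carrier ⧸ V.toAddSubgroup) → Q := fun q =>
    ⟨-((QuotientAddGroup.mk q : (M.carrier ⧸ V.toAddSubgroup) ⧸ Q).out) + q,
      QuotientAddGroup.eq.1 (Quotient.out_eq' _)⟩
  refine ⟨χ.comp (mk.addSubgroupMap N), ⟨fun x => χ (r (mk x)), ?_⟩, ?_, ?_⟩
  · exact (continuous_of_discreteTopology (f := fun q => χ (r q))).comp continuous_quot_mk
  · obtain ⟨q, hq⟩ : ∃ q, χ q ≠ 0 := by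
      by_contra h
      push Not at h
      exact hχ (AddMonoidHom.ext h)
    have hs : Function.Surjective χ := by
      intro y
      refine ⟨(y * (χ q)⁻¹).val • q, ?_⟩
      rw [map_nsmul, nsmul_eq_mul, ZMod.natCast_zmod_val, inv_mul_cancel_right₀ hq]
    exact hs.comp (AddMonoidHom.addSubgroupMap_surjective _ _)
  · intro x n
    have hr : r (mk (x + n)) = r (mk x) + mk.addSubgroupMap N n := by
      apply Subtype.ext
      have h : (QuotientAddGroup.mk (mk (x + n)) : (M.carrier ⧸ V.toAddSubgroup) ⧸ Q) =
          QuotientAddGroup.mk (mk x) := by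
        rw [eq_comm, QuotientAddGroup.eq, map_add, neg_add_cancel_left]
        exact AddSubgroup.mem_map_of_mem mk n.2
      change -(QuotientAddGroup.mk (mk (x + n)) : (M.carrier ⧸ V.toAddSubgroup) ⧸ Q).out +
        mk (x + n) = (-(QuotientAddGroup.mk (mk x) : (M.carrier ⧸ V.toAddSubgroup) ⧸ Q).out +
          mk x) + mk n
      rw [h, map_add, add_assoc]
    change χ (r (mk (x + n))) = χ (r (mk x)) + χ (mk.addSubgroupMap N n)
    rw [hr, map_add]

end AbelianProGroup

namespace AbelianProGroup

/-! ### Dévissage -/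

section Devissage

variable {ℓ : ℕ} {A B B' ι : Type*} [TopologicalSpace B] [Fintype ι] (M : AbelianProGroup ℓ)
  (f : A → B) (δ : ι → B' → B) (ε : ι → ℤ) (c : A → M.carrier) (z : B' → M.carrier)

/-- An approximate solution `s : B → M` of the equations `s ∘ f = c` and
`∑ i, ε i • s ∘ δ i = z`, which is determined and satisfies the second equation only modulo a
closed subgroup `N` of `M`. It is given by a closed relation `G` between `B` and `M`, the relation
`x ∈ s b + N`. -/
structure IsApproximateSolution (N : AddSubgroup M.carrier) (G : Set (B × M.carrier)) :
    Prop where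
  isClosed_subgroup : IsClosed (N : Set M.carrier)
  isClosed : IsClosed G
  exists_mem : ∀ b, ∃ x, (b, x) ∈ G
  mem_iff : ∀ {b x}, (b, x) ∈ G → ∀ y, (b, y) ∈ G ↔ y - x ∈ N
  map_mem : ∀ a, (f a, c a) ∈ G
  sub_mem : ∀ (b' : B') (y : ι → M.carrier), (∀ i, (δ i b', y i) ∈ G) →
    z b' - ∑ i, ε i • y i ∈ N

variable {M f δ ε c z}

theorem isApproximateSolution_top : IsApproximateSolution M f δ ε c z ⊤ Set.univ where
  isClosed_subgroup := isClosed_univ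
  isClosed := isClosed_univ
  exists_mem _ := ⟨0, trivial⟩
  mem_iff _ _ := by simp
  map_mem _ := trivial
  sub_mem _ _ _ := trivial

/-- Approximate solutions can be intersected along a chain, because `M` is compact. -/
theorem IsApproximateSolution.sInf {C : Set (AddSubgroup M.carrier × Set (B × M.carrier))}
    (hC : ∀ p ∈ C, IsApproximateSolution M f δ ε c z p.1 p.2)
    (hchain : IsChain (· ≤ ·) C) (hne : C.Nonempty) :
    IsApproximateSolution M f δ ε c z (⨅ p : C, p.1.1) (⋂ p : C, p.1.2) where
  isClosed_subgroup := by
    rw [AddSubgroup.coe_iInf]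
    exact isClosed_iInter fun p => (hC p.1 p.2).isClosed_subgroup
  isClosed := isClosed_iInter fun p => (hC p.1 p.2).isClosed
  exists_mem b := by
    have : Nonempty C := hne.to_subtype
    have hcl : ∀ p : C, IsClosed {x | (b, x) ∈ p.1.2} := fun p =>
      (hC p.1 p.2).isClosed.preimage (by fun_prop)
    obtain ⟨x, hx⟩ := IsCompact.nonempty_iInter_of_directed_nonempty_isCompact_isClosed
      (fun p : C => {x | (b, x) ∈ p.1.2})
      (fun p q => by
        rcases hchain.total p.2 q.2 with h | h
        · exact ⟨p, subset_rfl, fun x hx => h.2 hx⟩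
        · exact ⟨q, fun x hx => h.2 hx, subset_rfl⟩)
      (fun p => (hC p.1 p.2).exists_mem b) (fun p => (hcl p).isCompact) hcl
    exact ⟨x, Set.mem_iInter.2 fun p => Set.mem_iInter.1 hx p⟩
  mem_iff {b x} hx y := by
    rw [Set.mem_iInter, AddSubgroup.mem_iInf]
    exact forall_congr' fun p => (hC p.1 p.2).mem_iff (Set.mem_iInter.1 hx p) y
  map_mem a := Set.mem_iInter.2 fun p => (hC p.1 p.2).map_mem a
  sub_mem b' y hy := by
    rw [AddSubgroup.mem_iInf]
    exact fun p => (hC p.1 p.2).sub_mem b' y fun i => Set.mem_iInter.1 (hy i) p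

theorem IsApproximateSolution.exists_continuousMap {G : Set (B × M.carrier)}
    (h : IsApproximateSolution M f δ ε c z ⊥ G) :
    ∃ s : C(B, M.carrier), (∀ a, s (f a) = c a) ∧ ∀ b', ∑ i, ε i • s (δ i b') = z b' := by
  choose s hs using h.exists_mem
  have hG : ∀ b x, (b, x) ∈ G ↔ x = s b := fun b x => by
    rw [h.mem_iff (hs b), AddSubgroup.mem_bot, sub_eq_zero]
  have hcont : Continuous s := by
    refine continuous_iff_isClosed.2 fun Z hZ => ?_
    convert isClosedMap_fst_of_compactSpace _ (h.isClosed.inter (hZ.preimage continuous_snd))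
    ext b
    simp [hG]
  refine ⟨⟨s, hcont⟩, fun a => ((hG _ _).1 (h.map_mem a)).symm, fun b' => ?_⟩
  exact (sub_eq_zero.1 ((AddSubgroup.mem_bot).1 (h.sub_mem b' _ fun i => hs _))).symm

/-- If the problem can be solved for the coefficients `ℤ/ℓ`, then every approximate solution can be
improved, unless it is exact. Given a character `χ` of `N` and its equivariant extension `ρ` to `M`,
the relation `x ∈ s b + N` is refined to `x ∈ s b + ker χ` by prescribing the value of `ρ x` as a
function `t` of `b`. The equations for the refined solution are equations for `t`, in which the
representatives `x` of the cosets `s b + N` need not depend continuously on `b`. -/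
theorem IsApproximateSolution.exists_lt [Fact ℓ.Prime] [TopologicalSpace A]
    [TopologicalSpace B'] [CompactSpace B'] [T2Space B']
    (hδ : ∀ i, Continuous (δ i)) (hc : Continuous c) (hz : Continuous z)
    (hsolve : ∀ (N : AddSubgroup M.carrier) (χ : N →+ ZMod ℓ) (x : B → M.carrier)
      (e : C(A, ZMod ℓ)) (w : C(B', ZMod ℓ)),
      (∀ a, ∃ h : c a - x (f a) ∈ N, χ ⟨_, h⟩ = e a) →
      (∀ b', ∃ h : z b' - ∑ i, ε i • x (δ i b') ∈ N, χ ⟨_, h⟩ = w b') →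
      ∃ t : C(B, ZMod ℓ), (∀ a, t (f a) = e a) ∧ ∀ b', ∑ i, ε i • t (δ i b') = w b')
    {N : AddSubgroup M.carrier} {G : Set (B × M.carrier)}
    (h : IsApproximateSolution M f δ ε c z N G) (hN : N ≠ ⊥) :
    ∃ N' G', IsApproximateSolution M f δ ε c z N' G' ∧ N' < N ∧ G' ⊆ G := by
  obtain ⟨χ, ρ, hχ, hρ⟩ := M.exists_character N hN
  have hρ' : ∀ {b x y} (hx : (b, x) ∈ G) (hy : (b, y) ∈ G),
      χ ⟨y - x, (h.mem_iff hx y).1 hy⟩ = ρ y - ρ x := fun {b x y} hx hy => by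
    rw [eq_sub_iff_add_eq', ← hρ, add_sub_cancel]
  have hχρ : ∀ n : N, χ n = ρ n - ρ 0 := fun n => by
    rw [eq_sub_iff_add_eq', ← hρ, zero_add]
  have hex : ∀ b v, ∃ x, (b, x) ∈ G ∧ ρ x = v := fun b v => by
    obtain ⟨x, hx⟩ := h.exists_mem b
    obtain ⟨n, hn⟩ := hχ (v - ρ x)
    refine ⟨x + n, (h.mem_iff hx _).2 (by simp), by rw [hρ, hn, add_sub_cancel]⟩
  choose x₀ hx₀ hρx₀ using fun b => hex b 0
  -- The error `w` of the representatives `x₀` is continuous, although `x₀` need not be: its value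
  -- does not depend on the choice of representatives at which `ρ` vanishes, so that it is continuous
  -- on the compact space `T` of all such choices, which maps onto `B'`.
  have hw : Continuous fun b' => ρ (z b' - ∑ i, ε i • x₀ (δ i b')) - ρ 0 := by
    let T : Set (B' × (ι → M.carrier)) := {p | ∀ i, (δ i p.1, p.2 i) ∈ G ∧ ρ (p.2 i) = 0}
    have hT : IsClosed T := by
      have : T = ⋂ i, ((fun p : B' × (ι → M.carrier) => (δ i p.1, p.2 i)) ⁻¹' G) ∩
          ((fun p : B' × (ι → M.carrier) => ρ (p.2 i)) ⁻¹' {0}) := by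
        ext p
        simp [T]
      rw [this]
      exact isClosed_iInter fun i => (h.isClosed.preimage (((hδ i).comp continuous_fst).prodMk
        ((continuous_apply i).comp continuous_snd))).inter
        (isClosed_singleton.preimage (by fun_prop))
    have : CompactSpace T := isCompact_iff_compactSpace.1 hT.isCompact
    let p : T → B' := fun q => q.1.1
    have hp : Continuous p := by fun_prop
    have hq : Topology.IsQuotientMap p := hp.isClosedMap.isQuotientMap hp fun b' =>
      ⟨⟨(b', fun i => x₀ (δ i b')), fun i => ⟨hx₀ _, hρx₀ _⟩⟩, rfl⟩
    rw [hq.continuous_iff]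
    have : (fun b' => ρ (z b' - ∑ i, ε i • x₀ (δ i b')) - ρ 0) ∘ p =
        fun q : T => ρ (z q.1.1 - ∑ i, ε i • q.1.2 i) - ρ 0 := by
      funext ⟨⟨b', y⟩, hy⟩
      have h₁ := h.sub_mem b' _ fun i => hx₀ (δ i b')
      have h₂ := h.sub_mem b' _ fun i => (hy i).1
      have key : (⟨_, h₁⟩ : N) - ⟨_, h₂⟩ =
          ∑ i, ε i • ⟨_, (h.mem_iff (hx₀ _) _).1 (hy i).1⟩ := by
        apply Subtype.ext
        simp [smul_sub]
      have := congrArg χ key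
      simp only [map_sub, map_sum, map_zsmul, hρ' (hx₀ _) (hy _).1, (hy _).2, hρx₀, sub_zero,
        smul_zero, Finset.sum_const_zero] at this
      have := sub_eq_zero.1 this
      rwa [hχρ, hχρ] at this
    rw [this]
    fun_prop
  obtain ⟨t, ht, ht'⟩ := hsolve N χ x₀ ⟨fun a => ρ (c a), by fun_prop⟩ ⟨_, hw⟩
    (fun a => ⟨(h.mem_iff (hx₀ _) _).1 (h.map_mem a), by
      rw [hρ' (hx₀ _) (h.map_mem a), hρx₀, sub_zero]; rfl⟩)
    (fun b' => ⟨h.sub_mem b' _ fun i => hx₀ _, hχρ _⟩)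
  have hmem : ∀ n, n ∈ χ.ker.map N.subtype ↔ ∃ h : n ∈ N, χ ⟨n, h⟩ = 0 := fun n => by
    simp [AddSubgroup.mem_map, AddMonoidHom.mem_ker]
  refine ⟨χ.ker.map N.subtype, {p | p ∈ G ∧ ρ p.2 = t p.1}, ⟨?_, ?_, ?_, ?_, ?_, ?_⟩, ?_,
    fun p hp => hp.1⟩
  · have : ((χ.ker.map N.subtype : AddSubgroup M.carrier) : Set M.carrier) =
        (N : Set M.carrier) ∩ {n | ρ n = ρ 0} := by
      ext n
      rw [SetLike.mem_coe, hmem]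
      exact ⟨fun ⟨hn, h⟩ => ⟨hn, by rwa [hχρ, sub_eq_zero] at h⟩,
        fun ⟨hn, h⟩ => ⟨hn, by rwa [hχρ, sub_eq_zero]⟩⟩
    rw [this]
    exact h.isClosed_subgroup.inter (isClosed_eq (by fun_prop) continuous_const)
  · exact h.isClosed.inter (isClosed_eq (ρ.continuous.comp continuous_snd)
      (t.continuous.comp continuous_fst))
  · exact fun b => hex b (t b)
  · rintro b x ⟨hx, hx'⟩ y
    rw [hmem]
    constructor
    · rintro ⟨hy, hy'⟩
      exact ⟨(h.mem_iff hx y).1 hy, by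
        rw [hρ' hx hy, show ρ y = t b from hy', show ρ x = t b from hx', sub_self]⟩
    · rintro ⟨hn, hn'⟩
      have hy := (h.mem_iff hx y).2 hn
      exact ⟨hy, (sub_eq_zero.1 ((hρ' hx hy).symm.trans hn')).trans hx'⟩
  · exact fun a => ⟨h.map_mem a, (ht a).symm⟩
  · intro b' y hy
    rw [hmem]
    refine ⟨h.sub_mem b' y fun i => (hy i).1, ?_⟩
    have h₁ := h.sub_mem b' _ fun i => hx₀ (δ i b')
    have key : (⟨_, h.sub_mem b' y fun i => (hy i).1⟩ : N) = ⟨_, h₁⟩ -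
        ∑ i, ε i • ⟨_, (h.mem_iff (hx₀ _) _).1 (hy i).1⟩ := by
      apply Subtype.ext
      simp [smul_sub]
    rw [key, map_sub, map_sum, hχρ, sub_eq_zero]
    refine (ht' b').symm.trans (Finset.sum_congr rfl fun i _ => ?_)
    rw [map_zsmul, hρ' (hx₀ _) (hy i).1, hρx₀, sub_zero, show ρ (y i) = t _ from (hy i).2]
  · refine lt_of_le_of_ne (fun n hn => ((hmem n).1 hn).1) fun heq => ?_
    obtain ⟨n, hn⟩ := hχ 1
    obtain ⟨hn', h0⟩ := (hmem n).1 (heq.ge n.2)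
    exact one_ne_zero (hn.symm.trans h0)

/-- Dévissage: equations of the form `s ∘ f = c` and `∑ i, ε i • s ∘ δ i = z` for a continuous
function `s` with values in an abelian pro-`ℓ`-group have a solution, if certain equations of the
same form with values in `ℤ/ℓ` have one. -/
theorem exists_continuousMap_of_forall_zmod [Fact ℓ.Prime] [TopologicalSpace A]
    [TopologicalSpace B'] [CompactSpace B'] [T2Space B']
    (hδ : ∀ i, Continuous (δ i)) (hc : Continuous c) (hz : Continuous z)
    (hsolve : ∀ (N : AddSubgroup M.carrier) (χ : N →+ ZMod ℓ) (x : B → M.carrier)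
      (e : C(A, ZMod ℓ)) (w : C(B', ZMod ℓ)),
      (∀ a, ∃ h : c a - x (f a) ∈ N, χ ⟨_, h⟩ = e a) →
      (∀ b', ∃ h : z b' - ∑ i, ε i • x (δ i b') ∈ N, χ ⟨_, h⟩ = w b') →
      ∃ t : C(B, ZMod ℓ), (∀ a, t (f a) = e a) ∧ ∀ b', ∑ i, ε i • t (δ i b') = w b') :
    ∃ s : C(B, M.carrier), (∀ a, s (f a) = c a) ∧ ∀ b', ∑ i, ε i • s (δ i b') = z b' := by
  obtain ⟨m, -, hm⟩ := zorn_le_nonempty₀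
    (α := (AddSubgroup M.carrier × Set (B × M.carrier))ᵒᵈ)
    {p | IsApproximateSolution M f δ ε c z p.ofDual.1 p.ofDual.2}
    (fun C hC hchain y hy => ⟨OrderDual.toDual (⨅ p : C, p.1.ofDual.1, ⋂ p : C, p.1.ofDual.2),
      IsApproximateSolution.sInf (C := C) (fun p hp => hC hp) hchain.symm ⟨y, hy⟩,
      fun p hp => ⟨iInf_le (fun p : C => p.1.ofDual.1) ⟨p, hp⟩,
        Set.iInter_subset (fun p : C => p.1.ofDual.2) ⟨p, hp⟩⟩⟩)
    (OrderDual.toDual (⊤, Set.univ)) isApproximateSolution_top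
  obtain ⟨N, G⟩ := m
  by_cases hN : N = ⊥
  · subst hN
    exact IsApproximateSolution.exists_continuousMap hm.prop
  · obtain ⟨N', G', h', hlt, hle⟩ :=
      IsApproximateSolution.exists_lt hδ hc hz hsolve hm.prop hN
    exact absurd (hm.le_of_ge (y := OrderDual.toDual (N', G')) h' ⟨hlt.le, hle⟩).1 hlt.not_ge

end Devissage

end AbelianProGroup

namespace ProfiniteSpace

/-! ### Lifting of cochains and cocycles -/

section LiftsCochains

variable {A B : ProfiniteSpace.{u}} (f : A ⟶ B)

/-- All continuous cochains on `A` with values in `S` lift to `B`. -/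
def LiftsCochains (S : Type w) [TopologicalSpace S] : Prop :=
  ∀ n, Function.Surjective (pull f : C(B.obj (op (.mk n)), S) → C(A.obj (op (.mk n)), S))

/-- The relative cohomology groups of `f` with coefficients in `π` vanish, in a form that also
provides lifts of cochains: a cochain on `A` lifts to a cochain on `B` with a given coboundary. The
first condition is the second one in degree `-1`. -/
structure LiftsCocycles (π : Type w) [AddCommGroup π] [TopologicalSpace π]
    [IsTopologicalAddGroup π] : Prop where
  eq_zero : ∀ z : C(B.obj (op (.mk 0)), π), coboundary z = 0 → pull f z = 0 → z = 0
  exists_lift : ∀ (n : ℕ) (c : C(A.obj (op (.mk n)), π)) (z : C(B.obj (op (.mk (n + 1))), π)),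
    coboundary z = 0 → coboundary c = pull f z →
      ∃ c' : C(B.obj (op (.mk n)), π), pull f c' = c ∧ coboundary c' = z

variable {f} {π : Type w} [AddCommGroup π] [TopologicalSpace π] [IsTopologicalAddGroup π]

theorem LiftsCocycles.exists_cocycle (h : LiftsCocycles f π) {n : ℕ}
    (z : C(A.obj (op (.mk n)), π)) (hz : coboundary z = 0) :
    ∃ z' : C(B.obj (op (.mk n)), π), coboundary z' = 0 ∧ pull f z' = z := by
  obtain ⟨z', h₁, h₂⟩ := h.exists_lift n z 0 coboundary_zero hz
  exact ⟨z', h₂, h₁⟩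

theorem LiftsCocycles.liftsCochains (h : LiftsCocycles f π) : LiftsCochains f π := by
  intro n c
  obtain ⟨z, hz, hz'⟩ := h.exists_cocycle (coboundary c) (coboundary_coboundary c)
  obtain ⟨c', hc', -⟩ := h.exists_lift n c z hz hz'.symm
  exact ⟨c', hc'⟩

theorem isCoboundary_zero : ∀ {n : ℕ}, IsCoboundary (0 : C(A.obj (op (.mk n)), π))
  | 0 => rfl
  | _ + 1 => ⟨0, coboundary_zero⟩

theorem liftsCocycles_iff {ℓ : ℕ} :
    LiftsCocycles f (ZMod ℓ) ↔ LiftsCochains f (ZMod ℓ) ∧ cohomologyIsos ℓ f := by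
  rw [cohomologyIsos_iff]
  refine ⟨fun h => ⟨h.liftsCochains, fun n => ⟨?_, fun w hw => ?_⟩⟩, fun ⟨hs, h⟩ => ?_⟩
  · cases n with
    | zero => exact h.eq_zero
    | succ n =>
      rintro z hz ⟨c, hc⟩
      obtain ⟨c', -, hc'⟩ := h.exists_lift n c z hz hc
      exact ⟨c', hc'⟩
  · obtain ⟨z, hz, rfl⟩ := h.exists_cocycle w hw
    exact ⟨z, hz, by rw [sub_self]; exact isCoboundary_zero⟩
  · have hcoc : ∀ {n} (z : C(A.obj (op (.mk n)), ZMod ℓ)), coboundary z = 0 →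
        ∃ z' : C(B.obj (op (.mk n)), ZMod ℓ), coboundary z' = 0 ∧ pull f z' = z := by
      intro n z hz
      obtain ⟨z', hz', hb⟩ := (h n).2 z hz
      cases n with
      | zero => exact ⟨z', hz', (sub_eq_zero.1 hb).symm⟩
      | succ n =>
        obtain ⟨c, hc⟩ := hb
        obtain ⟨c', rfl⟩ := hs n c
        refine ⟨z' + coboundary c', ?_, ?_⟩
        · rw [coboundary_add, hz', coboundary_coboundary, add_zero]
        · rw [pull_add, ← coboundary_pull, hc, add_sub_cancel]
    refine ⟨fun z hz hz' => (h 0).1 z hz hz', fun n c z hz hc => ?_⟩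
    obtain ⟨b, rfl⟩ := (h (n + 1)).1 z hz ⟨c, hc⟩
    obtain ⟨z', hz', h'⟩ := hcoc (c - pull f b) (by
      rw [coboundary_sub, hc, coboundary_pull, sub_self])
    refine ⟨b + z', ?_, ?_⟩
    · rw [pull_add, h', add_sub_cancel]
    · rw [coboundary_add, hz', add_zero]

theorem LiftsCochains.of_homeomorph {S : Type*} {S' : Type*} [TopologicalSpace S]
    [TopologicalSpace S'] (e : S ≃ₜ S') (h : LiftsCochains f S) : LiftsCochains f S' := by
  intro n c
  obtain ⟨c', hc'⟩ := h n ((e.symm : C(S', S)).comp c)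
  refine ⟨(e : C(S, S')).comp c', ?_⟩
  ext a
  exact (congrArg e (DFunLike.congr_fun hc' a)).trans (e.apply_symm_apply _)

theorem coboundary_comp {π' : Type*} [AddCommGroup π'] [TopologicalSpace π']
    [IsTopologicalAddGroup π'] (e : π ≃ₜ+ π') {n : ℕ} (c : C(A.obj (op (.mk n)), π)) :
    coboundary ((e.toHomeomorph : C(π, π')).comp c) =
      (e.toHomeomorph : C(π, π')).comp (coboundary c) := by
  ext a
  have h := map_sum e (fun i : Fin (n + 2) => (-1 : ℤ) ^ (i : ℕ) • c (A.δ i a)) Finset.univ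
  simp only [map_zsmul] at h
  exact h.symm

theorem LiftsCocycles.of_equiv {π' : Type*} [AddCommGroup π'] [TopologicalSpace π']
    [IsTopologicalAddGroup π'] (e : π ≃ₜ+ π') (h : LiftsCocycles f π) : LiftsCocycles f π' := by
  have hinj : ∀ {X : ProfiniteSpace.{u}} {n : ℕ} {c c' : C(X.obj (op (.mk n)), π)},
      (e.toHomeomorph : C(π, π')).comp c = (e.toHomeomorph : C(π, π')).comp c' → c = c' := by
    intro X n c c' hc
    ext x
    exact e.injective (DFunLike.congr_fun hc x)
  have hsurj : ∀ {X : ProfiniteSpace.{u}} {n : ℕ} (c : C(X.obj (op (.mk n)), π')),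
      ∃ c' : C(X.obj (op (.mk n)), π), (e.toHomeomorph : C(π, π')).comp c' = c := by
    intro X n c
    refine ⟨(e.symm.toHomeomorph : C(π', π)).comp c, ?_⟩
    ext x
    exact e.apply_symm_apply (c x)
  have h0 : ∀ {X : ProfiniteSpace.{u}} {n : ℕ},
      (e.toHomeomorph : C(π, π')).comp (0 : C(X.obj (op (.mk n)), π)) = 0 := by
    intro X n
    ext x
    exact map_zero e
  refine ⟨fun z hz hz' => ?_, fun n c z hz hc => ?_⟩
  · obtain ⟨z, rfl⟩ := hsurj z
    rw [coboundary_comp, ← h0] at hz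
    rw [h.eq_zero z (hinj hz) (hinj (hz'.trans h0.symm)), h0]
  · obtain ⟨z, rfl⟩ := hsurj z
    obtain ⟨c, rfl⟩ := hsurj c
    rw [coboundary_comp, ← h0] at hz
    rw [coboundary_comp] at hc
    obtain ⟨c', rfl, rfl⟩ := h.exists_lift n c z (hinj hz) (hinj hc)
    exact ⟨(e.toHomeomorph : C(π, π')).comp c', rfl, coboundary_comp e c'⟩

end LiftsCochains

section Monos

variable {A B : ProfiniteSpace.{u}} {f : A ⟶ B}

theorem dimensionwiseMonos_iff :
    dimensionwiseMonos f ↔ ∀ n, Function.Injective (f.app (op (.mk n))) :=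
  forall_congr' fun _ => ConcreteCategory.mono_iff_injective_of_preservesPullback _

theorem dimensionwiseMonos.liftsCochains (hf : dimensionwiseMonos f) (S : Type w)
    [TopologicalSpace S] [DiscreteTopology S] [Finite S] [Nonempty S] : LiftsCochains f S := by
  intro n c
  obtain ⟨c', hc'⟩ := exists_continuousMap_extension (f.app (op (.mk n))).hom.hom.continuous
    (dimensionwiseMonos_iff.1 hf n) c
  exact ⟨c', ContinuousMap.ext hc'⟩

theorem dimensionwiseMonos_iff_liftsCochains (S : Type w) [TopologicalSpace S]
    [DiscreteTopology S] [Finite S] [Nontrivial S] : dimensionwiseMonos f ↔ LiftsCochains f S := by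
  classical
  refine ⟨fun h => h.liftsCochains S, fun h => dimensionwiseMonos_iff.2 fun n a a' haa' => ?_⟩
  by_contra hne
  obtain ⟨U, hU, ha, ha'⟩ := exists_isClopen_of_totally_separated hne
  obtain ⟨s, s', hs⟩ := exists_pair_ne S
  obtain ⟨c', hc'⟩ := h n ⟨fun a => if a ∈ U then s else s', by
    refine continuous_const.if (fun a ha => ?_) continuous_const
    rw [show {a | a ∈ U} = U from rfl, hU.frontier_eq] at ha
    exact ha.elim⟩
  have h₁ : c' (f.app _ a) = if a ∈ U then s else s' := DFunLike.congr_fun hc' a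
  have h₂ : c' (f.app _ a') = if a' ∈ U then s else s' := DFunLike.congr_fun hc' a'
  rw [if_pos ha] at h₁
  rw [if_neg ha'] at h₂
  exact hs (h₁.symm.trans ((congrArg c' haa').trans h₂))

end Monos

section Devissage

variable {A B : ProfiniteSpace.{u}} {f : A ⟶ B} {ℓ : ℕ} [Fact ℓ.Prime]

/-- The square of the differential vanishes also on cochains that are not continuous. -/
theorem sum_sum_δ_eq_zero (X : ProfiniteSpace.{u}) {H : Type w} [AddCommGroup H] {n : ℕ}
    (x : X.obj (op (.mk n)) → H) (b : X.obj (op (.mk (n + 2)))) :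
    ∑ i : Fin (n + 3), (-1 : ℤ) ^ (i : ℕ) •
      ∑ j : Fin (n + 2), (-1 : ℤ) ^ (j : ℕ) • x (X.δ j (X.δ i b)) = 0 := by
  let _ : TopologicalSpace H := ⊤
  have : IsTopologicalAddGroup H :=
    { continuous_add := continuous_top, continuous_neg := continuous_top }
  exact DFunLike.congr_fun (coboundary_coboundary (X := X) (⟨x, continuous_top⟩ : C(_, H))) b

/-- This is the case of the dévissage without the second equation. -/
theorem LiftsCochains.of_zmod (h : LiftsCochains f (ZMod ℓ)) (M : AbelianProGroup.{u} ℓ) :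
    LiftsCochains f M.carrier := by
  intro n c
  obtain ⟨s, hs, -⟩ := AbelianProGroup.exists_continuousMap_of_forall_zmod (M := M)
    (f := f.app (op (.mk n))) (δ := fun (_ : Empty) (b : Empty) => b.elim) (ε := fun _ => 0)
    (c := c) (z := fun b : Empty => b.elim) (fun i => i.elim) c.continuous
    continuous_of_discreteTopology (fun N χ x e w _ _ => by
      obtain ⟨t, ht⟩ := h n e
      exact ⟨t, DFunLike.congr_fun ht, fun b => b.elim⟩)
  exact ⟨s, ContinuousMap.ext hs⟩

theorem coboundary_eq_zero_iff {X : ProfiniteSpace.{u}} {π : Type w} [AddCommGroup π]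
    [TopologicalSpace π] [IsTopologicalAddGroup π] (z : C(X.obj (op (.mk 0)), π)) :
    coboundary z = 0 ↔ ∀ x, z (X.δ (0 : Fin 2) x) = z (X.δ (1 : Fin 2) x) := by
  rw [ContinuousMap.ext_iff]
  refine forall_congr' fun x => ?_
  rw [coboundary_apply, Fin.sum_univ_two]
  simp [← sub_eq_add_neg, sub_eq_zero]

/-- The existence of lifts is obtained by dévissage. The equations with values in `ℤ/ℓ` that occur in
it are of the same form: their right hand sides are the images under a character of a cocycle on `B`
and of a cochain on `A` that are corrected by discontinuous cochains. -/
theorem LiftsCocycles.of_zmod (h : LiftsCocycles f (ZMod ℓ)) (M : AbelianProGroup.{u} ℓ) :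
    LiftsCocycles f M.carrier where
  eq_zero z hz hz' := by
    classical
    ext b
    by_contra hb
    obtain ⟨U, hU, hbU, h0⟩ := exists_isClopen_of_totally_separated hb
    -- A cocycle in degree `0` remains a cocycle under composition with any function.
    let φ : C(M.carrier, ZMod ℓ) := ⟨fun x => if x ∈ U then 1 else 0, by
      refine continuous_const.if (fun a ha => ?_) continuous_const
      rw [show {a | a ∈ U} = U from rfl, hU.frontier_eq] at ha
      exact ha.elim⟩
    have hφ := h.eq_zero (φ.comp z) ((coboundary_eq_zero_iff _).2 fun x =>
      congrArg φ ((coboundary_eq_zero_iff z).1 hz x)) (by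
        ext a
        exact (congrArg φ (DFunLike.congr_fun hz' a)).trans (if_neg h0))
    exact one_ne_zero ((if_pos hbU).symm.trans (DFunLike.congr_fun hφ b))
  exists_lift n c z hz hc := by
    obtain ⟨s, hs, hs'⟩ := AbelianProGroup.exists_continuousMap_of_forall_zmod (M := M)
      (f := f.app (op (.mk n))) (δ := fun (i : Fin (n + 2)) b => B.δ i b)
      (ε := fun i => (-1) ^ (i : ℕ)) (c := c) (z := z) (fun i => (B.δ i).hom.hom.continuous)
      c.continuous z.continuous (fun N χ x e w he hw => by
        choose he' he using he
        choose hw' hw using hw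
        have hw₀ : coboundary w = 0 := by
          ext b
          have key : ∑ i : Fin (n + 3), (-1 : ℤ) ^ (i : ℕ) •
              (⟨_, hw' (B.δ i b)⟩ : N) = 0 := by
            apply Subtype.ext
            have h₁ := sum_sum_δ_eq_zero B x b
            have h₂ : ∑ i : Fin (n + 3), (-1 : ℤ) ^ (i : ℕ) • z (B.δ i b) = 0 :=
              DFunLike.congr_fun hz b
            simp only [AddSubgroup.val_finsetSum, AddSubgroup.coe_zsmul, smul_sub,
              Finset.sum_sub_distrib, h₁, h₂, sub_zero, AddSubgroup.coe_zero]
          have := congrArg χ key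
          simp only [map_sum, map_zsmul, hw, map_zero] at this
          exact this
        have he₀ : coboundary e = pull f w := by
          ext a
          have key : ∑ i : Fin (n + 2), (-1 : ℤ) ^ (i : ℕ) • (⟨_, he' (A.δ i a)⟩ : N) =
              ⟨_, hw' (f.app _ a)⟩ := by
            apply Subtype.ext
            have h₁ : ∑ i : Fin (n + 2), (-1 : ℤ) ^ (i : ℕ) • c (A.δ i a) = z (f.app _ a) :=
              DFunLike.congr_fun hc a
            simp only [AddSubgroup.val_finsetSum, AddSubgroup.coe_zsmul, smul_sub,
              Finset.sum_sub_distrib, h₁, δ_app]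
          have := congrArg χ key
          simp only [map_sum, map_zsmul, he, hw] at this
          exact this
        obtain ⟨t, ht, ht'⟩ := h.exists_lift n e w hw₀ he₀
        exact ⟨t, DFunLike.congr_fun ht, DFunLike.congr_fun ht'⟩)
    exact ⟨s, ContinuousMap.ext hs, ContinuousMap.ext hs'⟩

end Devissage

section Generators

variable {ℓ : ℕ} {𝓜 : Set (AbelianProGroup.{u} ℓ)}

theorem llp_generatingFibrations_iff {A B : ProfiniteSpace.{u}} (f : A ⟶ B) :
    (generatingFibrations 𝓜).llp f ↔ ∀ M ∈ 𝓜, LiftsCocycles f M.carrier := by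
  constructor
  · intro h M hM
    exact ⟨(hasLiftingProperty_pointToK_iff f M).1 (h _ (.pointToK M hM)),
      fun n => (hasLiftingProperty_LToK_iff f M n).1 (h _ (.lToK M hM n))⟩
  · rintro h _ _ _ (⟨M, hM, n⟩ | ⟨M, hM⟩ | ⟨M, hM, n⟩)
    · exact (hasLiftingProperty_LToK_iff f M n).2 ((h M hM).exists_lift n)
    · exact (hasLiftingProperty_pointToK_iff f M).2 (h M hM).eq_zero
    · exact (hasLiftingProperty_KToPoint_iff f M n).2 fun z hz => (h M hM).exists_cocycle z hz

theorem llp_generatingTrivialFibrations_iff {A B : ProfiniteSpace.{u}} (f : A ⟶ B) :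
    (generatingTrivialFibrations 𝓜).llp f ↔ ∀ M ∈ 𝓜, LiftsCochains f M.carrier := by
  constructor
  · intro h M hM n
    exact (hasLiftingProperty_LToPoint_iff f _ n).1 (h _ (.lToPoint M hM n))
  · rintro h _ _ _ ⟨M, hM, n⟩
    exact (hasLiftingProperty_LToPoint_iff f _ n).2 (h M hM n)

variable [Fact ℓ.Prime]

theorem llp_generatingFibrations_eq (h𝓜 : ∃ M ∈ 𝓜, Nonempty (M.carrier ≃ₜ+ ZMod ℓ)) :
    (generatingFibrations 𝓜).llp = dimensionwiseMonos ⊓ cohomologyIsos ℓ := by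
  ext A B f
  obtain ⟨M₀, hM₀, ⟨e⟩⟩ := h𝓜
  rw [llp_generatingFibrations_iff]
  change _ ↔ dimensionwiseMonos f ∧ cohomologyIsos ℓ f
  rw [dimensionwiseMonos_iff_liftsCochains (ZMod ℓ), ← liftsCocycles_iff]
  exact ⟨fun h => (h M₀ hM₀).of_equiv e, fun h M _ => h.of_zmod M⟩

theorem llp_generatingTrivialFibrations_eq (h𝓜 : ∃ M ∈ 𝓜, Nonempty (M.carrier ≃ₜ+ ZMod ℓ)) :
    (generatingTrivialFibrations 𝓜).llp = dimensionwiseMonos := by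
  ext A B f
  obtain ⟨M₀, hM₀, ⟨e⟩⟩ := h𝓜
  rw [llp_generatingTrivialFibrations_iff, dimensionwiseMonos_iff_liftsCochains (ZMod ℓ)]
  exact ⟨fun h => (h M₀ hM₀).of_homeomorph e.toHomeomorph, fun h M _ => h.of_zmod M⟩

variable (ℓ) in
/-- The group `ℤ/ℓ`, as an abelian pro-`ℓ`-group in a given universe. -/
def zmodGroup : AbelianProGroup.{u} ℓ where
  carrier := ULift.{u} (ZMod ℓ)
  index_eq_pow U := by
    have h : U.toAddSubgroup.index ∣ ℓ ^ 1 := by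
      rw [pow_one]
      have := U.toAddSubgroup.index_dvd_card
      rwa [Nat.card_congr Equiv.ulift, Nat.card_zmod] at this
    obtain ⟨k, -, hk⟩ := (Nat.dvd_prime_pow Fact.out).1 h
    exact ⟨k, hk⟩

variable (ℓ) in
/-- The canonical isomorphism of `zmodGroup ℓ` with `ℤ/ℓ`. -/
def zmodGroupEquiv : (zmodGroup.{u} ℓ).carrier ≃ₜ+ ZMod ℓ :=
  { AddEquiv.ulift with
    continuous_toFun := continuous_uliftDown
    continuous_invFun := continuous_uliftUp }

end Generators

end ProfiniteSpace

/-! ### Tensors and cotensors of simplicial objects -/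

namespace CategoryTheory.SimplicialObject

variable {D : Type w} [Category.{u} D]

section Hom

variable (X Y : SimplicialObject D) (K : SSet.{u})

/-- Maps from `K` to the simplicial set of maps from `X` to `Y` correspond to families of maps
from `X` to `Y` that are indexed by the simplices of `K`. -/
def sHomEquiv : (K ⟶ SimplicialCategory.sHom X Y) ≃ Functor.HomObj X Y K :=
  Functor.functorHomEquiv X Y K

variable {X Y K}

theorem sHomEquiv_comp_map_right {Y' : SimplicialObject D} (φ : K ⟶ SimplicialCategory.sHom X Y)
    (g : Y ⟶ Y') :
    sHomEquiv X Y' K (φ ≫ ((SimplicialCategory.sHomFunctor _).obj (op X)).map g) =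
      (sHomEquiv X Y K φ).comp (.ofNatTrans g) := rfl

theorem sHomEquiv_comp_map_left {X' : SimplicialObject D} (φ : K ⟶ SimplicialCategory.sHom X Y)
    (f : X' ⟶ X) :
    sHomEquiv X' Y K (φ ≫ ((SimplicialCategory.sHomFunctor _).map f.op).app Y) =
      Functor.HomObj.comp (.ofNatTrans f) (sHomEquiv X Y K φ) := rfl

end Hom

section Tensor

variable [HasCoproducts.{u} D]

/-- The tensor product of a simplicial object `X` with a simplicial set `K`: in degree `n` it is
the coproduct of copies of `X_n` that are indexed by `K_n`. -/
noncomputable def tensor (X : SimplicialObject D) (K : SSet.{u}) : SimplicialObject D where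
  obj n := ∐ fun _ : K.obj n => X.obj n
  map {n m} θ := Limits.Sigma.desc fun k =>
    X.map θ ≫ Limits.Sigma.ι (fun _ : K.obj m => X.obj m) (K.map θ k)
  map_id n := by
    refine Limits.Sigma.hom_ext _ _ fun k => ?_
    simp
  map_comp θ θ' := by
    refine Limits.Sigma.hom_ext _ _ fun k => ?_
    simp

/-- The universal family of maps from `X` to `X ⊗ K`. -/
noncomputable def tensorUnit (X : SimplicialObject D) (K : SSet.{u}) :
    Functor.HomObj X (tensor X K) K where
  app n k := Limits.Sigma.ι (fun _ : K.obj n => X.obj n) k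
  naturality θ k := by
    exact (Limits.Sigma.ι_desc (fun k => X.map θ ≫
      Limits.Sigma.ι (fun _ : K.obj _ => X.obj _) (K.map θ k)) k).symm

/-- The map from `(X ⊗ K)_n` that is given by a family of maps from `X_n`. -/
noncomputable def tensorObjDesc {X : SimplicialObject D} {K : SSet.{u}} {n : SimplexCategoryᵒᵖ}
    {Z : D} (φ : K.obj n → (X.obj n ⟶ Z)) : (tensor X K).obj n ⟶ Z :=
  Limits.Sigma.desc φ

@[simp]
theorem tensorUnit_app_tensorObjDesc {X : SimplicialObject D} {K : SSet.{u}}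
    {n : SimplexCategoryᵒᵖ} {Z : D} (φ : K.obj n → (X.obj n ⟶ Z)) (k : K.obj n) :
    (tensorUnit X K).app n k ≫ tensorObjDesc φ = φ k :=
  Limits.Sigma.ι_desc _ _

@[simp]
theorem tensorUnit_app_tensorObjDesc_assoc {X : SimplicialObject D} {K : SSet.{u}}
    {n : SimplexCategoryᵒᵖ} {Z Z' : D} (φ : K.obj n → (X.obj n ⟶ Z)) (k : K.obj n) (h : Z ⟶ Z') :
    (tensorUnit X K).app n k ≫ tensorObjDesc φ ≫ h = φ k ≫ h := by
  rw [← Category.assoc, tensorUnit_app_tensorObjDesc]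

theorem tensor_obj_hom_ext {X : SimplicialObject D} {K : SSet.{u}} {n : SimplexCategoryᵒᵖ} {Z : D}
    {f g : (tensor X K).obj n ⟶ Z}
    (h : ∀ k, (tensorUnit X K).app n k ≫ f = (tensorUnit X K).app n k ≫ g) : f = g :=
  Limits.Sigma.hom_ext _ _ h

/-- The map from `X ⊗ K` that is given by a family of maps from `X`. -/
noncomputable def tensorDesc {X Y : SimplicialObject D} {K : SSet.{u}}
    (φ : Functor.HomObj X Y K) : tensor X K ⟶ Y where
  app n := tensorObjDesc (φ.app n)
  naturality n m θ := by
    refine tensor_obj_hom_ext fun k => ?_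
    rw [← (tensorUnit X K).naturality_assoc θ k, tensorUnit_app_tensorObjDesc,
      tensorUnit_app_tensorObjDesc_assoc]
    exact φ.naturality θ k

@[simp]
theorem tensorUnit_app_tensorDesc_app {X Y : SimplicialObject D} {K : SSet.{u}}
    (φ : Functor.HomObj X Y K) (n : SimplexCategoryᵒᵖ) (k : K.obj n) :
    (tensorUnit X K).app n k ≫ (tensorDesc φ).app n = φ.app n k :=
  Limits.Sigma.ι_desc _ _

@[simp]
theorem tensorUnit_app_tensorDesc_app_assoc {X Y : SimplicialObject D} {K : SSet.{u}}
    (φ : Functor.HomObj X Y K) (n : SimplexCategoryᵒᵖ) (k : K.obj n) {Z : D} (h : Y.obj n ⟶ Z) :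
    (tensorUnit X K).app n k ≫ (tensorDesc φ).app n ≫ h = φ.app n k ≫ h := by
  rw [← Category.assoc, tensorUnit_app_tensorDesc_app]

/-- The universal property of `X ⊗ K`. -/
noncomputable def tensorEquiv (X Y : SimplicialObject D) (K : SSet.{u}) :
    (tensor X K ⟶ Y) ≃ Functor.HomObj X Y K where
  toFun f := (tensorUnit X K).comp (.ofNatTrans f)
  invFun φ := tensorDesc φ
  left_inv f := by
    ext n
    refine tensor_obj_hom_ext fun k => ?_
    simp
  right_inv φ := by
    ext n k
    simp

theorem tensor_hom_ext {X Y : SimplicialObject D} {K : SSet.{u}} {f g : tensor X K ⟶ Y}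
    (h : ∀ n k, (tensorUnit X K).app n k ≫ f.app n = (tensorUnit X K).app n k ≫ g.app n) :
    f = g := by
  ext n
  exact tensor_obj_hom_ext (h n)

/-- The functoriality of `X ⊗ K` in both variables. -/
noncomputable def tensorMap {X X' : SimplicialObject D} {K K' : SSet.{u}} (f : X ⟶ X')
    (g : K ⟶ K') : tensor X K ⟶ tensor X' K' :=
  tensorDesc ((Functor.HomObj.ofNatTrans f).comp ((tensorUnit X' K').map g))

@[simp]
theorem tensorUnit_app_tensorMap_app {X X' : SimplicialObject D} {K K' : SSet.{u}} (f : X ⟶ X')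
    (g : K ⟶ K') (n : SimplexCategoryᵒᵖ) (k : K.obj n) :
    (tensorUnit X K).app n k ≫ (tensorMap f g).app n =
      f.app n ≫ (tensorUnit X' K').app n (g.app n k) := by
  simp [tensorMap]

@[simp]
theorem tensorUnit_app_tensorMap_app_assoc {X X' : SimplicialObject D} {K K' : SSet.{u}}
    (f : X ⟶ X') (g : K ⟶ K') (n : SimplexCategoryᵒᵖ) (k : K.obj n) {Z : D}
    (h : (tensor X' K').obj n ⟶ Z) :
    (tensorUnit X K).app n k ≫ (tensorMap f g).app n ≫ h =
      f.app n ≫ (tensorUnit X' K').app n (g.app n k) ≫ h := by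
  rw [← Category.assoc, tensorUnit_app_tensorMap_app, Category.assoc]

variable (D) in
/-- The bifunctor which sends `X` and `K` to `X ⊗ K`. -/
noncomputable def tensorFunctor : SimplicialObject D ⥤ SSet.{u} ⥤ SimplicialObject D where
  obj X :=
    { obj := fun K => tensor X K
      map := fun g => tensorMap (𝟙 X) g
      map_id := fun K => tensor_hom_ext (by simp)
      map_comp := fun g g' => tensor_hom_ext (by simp) }
  map f :=
    { app := fun K => tensorMap f (𝟙 K)
      naturality := fun K K' g => tensor_hom_ext (by simp) }
  map_id X := by
    ext K : 2
    exact tensor_hom_ext (by simp)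
  map_comp f g := by
    ext K : 2
    exact tensor_hom_ext (by simp)

variable (D) in
/-- The tensor product is left adjoint, with a parameter, to the simplicial enrichment. -/
noncomputable def tensorAdjunction :
    tensorFunctor D ⊣₂ SimplicialCategory.sHomFunctor (SimplicialObject D) :=
  .mk' (fun X => Adjunction.mkOfHomEquiv
    { homEquiv := fun K Y => (tensorEquiv X Y K).trans (sHomEquiv X Y K).symm
      homEquiv_naturality_left_symm := fun {K K' Y} g φ => by
        refine (tensorEquiv X Y K).injective ?_
        refine ((tensorEquiv X Y K).apply_symm_apply _).trans ?_
        ext n k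
        have := tensorUnit_app_tensorDesc_app (sHomEquiv X Y K' φ) n (g.app n k)
        have h := tensorUnit_app_tensorMap_app_assoc (𝟙 X) g n k
          ((tensorDesc (sHomEquiv X Y K' φ)).app n)
        rw [this] at h
        exact (h.trans (Category.id_comp _)).symm
      homEquiv_naturality_right := fun {K Y Y'} f g => by
        refine (sHomEquiv X Y' K).injective ?_
        refine ((sHomEquiv X Y' K).apply_symm_apply _).trans ?_
        refine Eq.trans ?_ (sHomEquiv_comp_map_right _ g).symm
        refine Eq.trans ?_ (congrArg (fun φ => Functor.HomObj.comp φ (.ofNatTrans g))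
          ((sHomEquiv X Y K).apply_symm_apply (tensorEquiv X Y K f)).symm)
        ext n k
        exact (Category.assoc _ _ _).symm })
    (fun {X X'} f {K Y} g => by
      rw [Adjunction.mkOfHomEquiv_homEquiv, Adjunction.mkOfHomEquiv_homEquiv]
      refine (sHomEquiv X Y K).injective ?_
      refine ((sHomEquiv X Y K).apply_symm_apply _).trans ?_
      refine Eq.trans ?_ (sHomEquiv_comp_map_left _ f).symm
      refine Eq.trans ?_ (congrArg (fun φ => Functor.HomObj.comp (.ofNatTrans f) φ)
          ((sHomEquiv X' Y K).apply_symm_apply (tensorEquiv X' Y K g)).symm)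
      ext n k
      have h := tensorUnit_app_tensorMap_app_assoc f (𝟙 K) n k (g.app n)
      exact h)

end Tensor

/-- A map from `K` to the internal hom from `X` to `T` exhibits `T` as a tensor product if the
corresponding family of maps is universal also with parameters. -/
theorem isIso_tensorComparison_of_bijective {X T : SimplicialObject D} {K : SSet.{u}}
    (η : K ⟶ SimplicialCategory.sHom X T) (Y : SimplicialObject D)
    (h : ∀ Z : SSet.{u}, Function.Bijective (fun φ : Functor.HomObj T Y Z =>
      (((sHomEquiv X T K η).map (SemiCartesianMonoidalCategory.fst K Z)).comp
        (φ.map (SemiCartesianMonoidalCategory.snd K Z)) : Functor.HomObj X Y (K ⊗ Z)))) :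
    IsIso (tensorComparison η Y) := by
  rw [isIso_iff_yoneda_map_bijective]
  intro Z
  let hb := ((sHomEquiv T Y Z).trans (Equiv.ofBijective _ (h Z))).trans
    ((sHomEquiv X Y (K ⊗ Z)).symm.trans
      ((ihom.adjunction K).homEquiv Z (SimplicialCategory.sHom X Y)))
  convert hb.bijective using 1
  funext x
  exact (MonoidalClosed.curry_natural_left x
    (η ▷ SimplicialCategory.sHom T Y ≫ SimplicialCategory.sHomComp X T Y)).symm.trans
      (congrArg MonoidalClosed.curry ((sHomEquiv X Y (K ⊗ Z)).symm_apply_apply _).symm)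

theorem isIso_cotensorComparison_of_bijective {E Y : SimplicialObject D} {K : SSet.{u}}
    (ε : K ⟶ SimplicialCategory.sHom E Y) (X : SimplicialObject D)
    (h : ∀ Z : SSet.{u}, Function.Bijective (fun φ : Functor.HomObj X E Z =>
      ((φ.map (SemiCartesianMonoidalCategory.snd K Z)).comp
        ((sHomEquiv E Y K ε).map (SemiCartesianMonoidalCategory.fst K Z)) :
          Functor.HomObj X Y (K ⊗ Z)))) :
    IsIso (cotensorComparison ε X) := by
  rw [isIso_iff_yoneda_map_bijective]
  intro Z
  let hb := ((sHomEquiv X E Z).trans (Equiv.ofBijective _ (h Z))).trans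
    ((sHomEquiv X Y (K ⊗ Z)).symm.trans
      ((ihom.adjunction K).homEquiv Z (SimplicialCategory.sHom X Y)))
  convert hb.bijective using 1
  funext x
  exact (MonoidalClosed.curry_natural_left x ((β_ K (SimplicialCategory.sHom X E)).hom ≫
    SimplicialCategory.sHom X E ◁ ε ≫ SimplicialCategory.sHomComp X E Y)).symm.trans
      (congrArg MonoidalClosed.curry ((sHomEquiv X Y (K ⊗ Z)).symm_apply_apply _).symm)

/-- The universal property of `X ⊗ K`, with parameters. -/
theorem bijective_tensorUnit_comp [HasCoproducts.{u} D] (X Y : SimplicialObject D)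
    (K Z : SSet.{u}) :
    Function.Bijective (fun φ : Functor.HomObj (tensor X K) Y Z =>
      (((tensorUnit X K).map (SemiCartesianMonoidalCategory.fst K Z)).comp
        (φ.map (SemiCartesianMonoidalCategory.snd K Z)) : Functor.HomObj X Y (K ⊗ Z))) := by
  constructor
  · intro φ φ' h
    ext n z
    refine tensor_obj_hom_ext fun k => ?_
    exact Functor.HomObj.congr_app h n (k, z)
  · intro ψ
    refine ⟨{ app := fun n z => tensorObjDesc fun k => ψ.app n (k, z), naturality := ?_ }, ?_⟩
    · intro n m θ z
      refine tensor_obj_hom_ext fun k => ?_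
      rw [← (tensorUnit X K).naturality_assoc θ k, tensorUnit_app_tensorObjDesc,
        tensorUnit_app_tensorObjDesc_assoc]
      exact ψ.naturality θ (k, z)
    · ext n ⟨k, z⟩
      exact tensorUnit_app_tensorObjDesc _ _

theorem exists_tensor [HasCoproducts.{u} D] (X : SimplicialObject D) (K : SSet.{u}) :
    ∃ (T : SimplicialObject D) (η : K ⟶ SimplicialCategory.sHom X T),
      ∀ Y, IsIso (tensorComparison η Y) := by
  refine ⟨tensor X K, (sHomEquiv _ _ _).symm (tensorUnit X K), fun Y =>
    isIso_tensorComparison_of_bijective _ Y fun Z => ?_⟩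
  rw [Equiv.apply_symm_apply]
  exact bijective_tensorUnit_comp X Y K Z

section Cotensor

variable [HasLimitsOfSize.{0, u} D]

/-- Families of maps that are indexed by isomorphic simplicial sets. -/
def homObjCongr (X Y : SimplicialObject D) {K K' : SSet.{u}} (e : K ≅ K') :
    Functor.HomObj X Y K' ≃ Functor.HomObj X Y K where
  toFun φ := φ.map e.hom
  invFun φ := φ.map e.inv
  left_inv φ := by
    ext
    simp
  right_inv φ := by
    ext
    simp

/-- Families of maps from `X` to `Y`, indexed by the simplices of `K`, as natural transformations
of functors on the category of elements of `K`. -/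
def homObjEquivElements (X Y : SimplicialObject D) (K : SSet.{u}) :
    Functor.HomObj X Y K ≃ (CategoryOfElements.π K ⋙ X ⟶ CategoryOfElements.π K ⋙ Y) where
  toFun φ :=
    { app := fun e => φ.app e.1 e.2
      naturality := fun e e' θ => by
        have := φ.naturality θ.1 e.2
        rw [θ.2] at this
        exact this }
  invFun α :=
    { app := fun n k => α.app ⟨n, k⟩
      naturality := fun {n m} θ k =>
        α.naturality (CategoryOfElements.homMk (F := K) ⟨n, k⟩ ⟨m, K.map θ k⟩ θ rfl) }
  left_inv _ := rfl
  right_inv _ := rfl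

/-- The cotensor product `Y^K`. Maps to `Y^K` are families of maps to `Y` that are indexed by the
simplices of `K`, so that `Y^K` is a right Kan extension along the projection from the category of
elements of `K`. -/
noncomputable def cotensor (Y : SimplicialObject D) (K : SSet.{u}) : SimplicialObject D :=
  (CategoryOfElements.π K).ran.obj (CategoryOfElements.π K ⋙ Y)

/-- The universal property of the cotensor product. -/
noncomputable def cotensorEquiv (X Y : SimplicialObject D) (K : SSet.{u}) :
    (X ⟶ cotensor Y K) ≃ Functor.HomObj X Y K :=
  (((CategoryOfElements.π K).ranAdjunction D).homEquiv X
    (CategoryOfElements.π K ⋙ Y)).symm.trans (homObjEquivElements X Y K).symm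

/-- The universal family of maps from `Y^K` to `Y`. -/
noncomputable def cotensorCounit (Y : SimplicialObject D) (K : SSet.{u}) :
    Functor.HomObj (cotensor Y K) Y K := cotensorEquiv _ _ _ (𝟙 _)

theorem cotensorEquiv_apply {X Y : SimplicialObject D} {K : SSet.{u}} (f : X ⟶ cotensor Y K) :
    cotensorEquiv X Y K f = (Functor.HomObj.ofNatTrans f).comp (cotensorCounit Y K) := by
  ext n k
  have h := ((CategoryOfElements.π K).ranAdjunction D).homEquiv_naturality_left_symm f
    (𝟙 (cotensor Y K))
  exact NatTrans.congr_app ((congrArg _ (Category.comp_id f).symm).trans h) ⟨n, k⟩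

variable [HasCoproducts.{u} D]

theorem exists_cotensor (Y : SimplicialObject D) (K : SSet.{u}) :
    ∃ (E : SimplicialObject D) (ε : K ⟶ SimplicialCategory.sHom E Y),
      ∀ X, IsIso (cotensorComparison ε X) := by
  refine ⟨cotensor Y K, (sHomEquiv _ _ _).symm (cotensorCounit Y K), fun X =>
    isIso_cotensorComparison_of_bijective _ X fun Z => ?_⟩
  rw [Equiv.apply_symm_apply]
  let e := ((((tensorEquiv X (cotensor Y K) Z).symm.trans (cotensorEquiv (tensor X Z) Y K)).trans
    (Equiv.ofBijective _ (bijective_tensorUnit_comp X Y Z K))).trans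
      (homObjCongr X Y (β_ K Z)))
  convert e.bijective using 1
  funext φ
  ext n kz
  have h := congrArg (fun g => (tensorUnit X Z).app n kz.2 ≫ g)
    (Functor.HomObj.congr_app (cotensorEquiv_apply (tensorDesc φ)) n kz.1)
  exact ((h.trans (tensorUnit_app_tensorDesc_app_assoc φ n kz.2 _))).symm

end Cotensor

end CategoryTheory.SimplicialObject

/-! ### Cochains and monomorphisms of tensor products -/

namespace ProfiniteSpace

open CategoryTheory.SimplicialObject Simplicial

section TensorCochains

variable {X Y : ProfiniteSpace.{u}} {K L : SSet.{u}} {S : Type u} [TopologicalSpace S]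
  [CompactSpace S] [T2Space S] [TotallyDisconnectedSpace S] {n : ℕ}

/-- The cochain on `X ⊗ K` that is given by a family of cochains on `X`, indexed by the simplices
of `K`. -/
noncomputable def tensorCochain (φ : K.obj (op ⦋n⦌) → C(X.obj (op ⦋n⦌), S)) :
    C((tensor X K).obj (op ⦋n⦌), S) :=
  (tensorObjDesc (X := X) (Z := Profinite.of S) fun k => CompHausLike.ofHom _ (φ k)).hom.hom

theorem tensorCochain_apply (φ : K.obj (op ⦋n⦌) → C(X.obj (op ⦋n⦌), S)) (k : K.obj (op ⦋n⦌))
    (x : X.obj (op ⦋n⦌)) : tensorCochain φ ((tensorUnit X K).app _ k x) = φ k x :=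
  ConcreteCategory.congr_hom (tensorUnit_app_tensorObjDesc (X := X) (K := K)
    (Z := Profinite.of S) (fun k => CompHausLike.ofHom _ (φ k)) k) x

theorem tensorCochain_ext {c c' : C((tensor X K).obj (op ⦋n⦌), S)}
    (h : ∀ k x, c ((tensorUnit X K).app _ k x) = c' ((tensorUnit X K).app _ k x)) : c = c' := by
  have : (CompHausLike.ofHom _ c : (tensor X K).obj (op ⦋n⦌) ⟶ Profinite.of S) =
      CompHausLike.ofHom _ c' := by
    refine tensor_obj_hom_ext fun k => ?_
    ext x
    exact h k x
  exact congrArg (fun f => f.hom.hom) this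

theorem tensorMap_app_apply (f : X ⟶ Y) (g : K ⟶ L) (k : K.obj (op ⦋n⦌)) (x : X.obj (op ⦋n⦌)) :
    (tensorMap f g).app _ ((tensorUnit X K).app _ k x) =
      (tensorUnit Y L).app _ (g.app _ k) (f.app _ x) :=
  ConcreteCategory.congr_hom (tensorUnit_app_tensorMap_app f g (op ⦋n⦌) k) x

/-- The restriction of a cochain on `X ⊗ K` to the copy of `X_n` with index `k`. -/
noncomputable def tensorComponent (c : C((tensor X K).obj (op ⦋n⦌), S)) (k : K.obj (op ⦋n⦌)) :
    C(X.obj (op ⦋n⦌), S) :=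
  c.comp ((tensorUnit X K).app _ k).hom.hom

end TensorCochains

section Monos

variable {A B : ProfiniteSpace.{u}} {K L : SSet.{u}} {i : A ⟶ B} {j : K ⟶ L}

/-- A finite set that serves to detect monomorphisms. -/
local notation "𝔹" => ULift Bool

theorem dimensionwiseMonos_tensorMap_id (hi : dimensionwiseMonos i) :
    dimensionwiseMonos (tensorMap i (𝟙 K)) := by
  refine (dimensionwiseMonos_iff_liftsCochains 𝔹).2 fun n c => ?_
  choose γ hγ using fun k => hi.liftsCochains 𝔹 n (tensorComponent c k)
  refine ⟨tensorCochain γ, tensorCochain_ext fun k a => ?_⟩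
  rw [pull_apply, tensorMap_app_apply, tensorCochain_apply]
  exact DFunLike.congr_fun (hγ k) a

theorem dimensionwiseMonos_tensorMap_of_injective
    (hj : ∀ n : ℕ, Function.Injective (j.app (op ⦋n⦌))) :
    dimensionwiseMonos (tensorMap (𝟙 A) j) := by
  classical
  refine (dimensionwiseMonos_iff_liftsCochains 𝔹).2 fun n c => ?_
  refine ⟨tensorCochain fun l => if h : ∃ k, j.app _ k = l then tensorComponent c h.choose
    else ContinuousMap.const _ default, tensorCochain_ext fun k a => ?_⟩
  have h : ∃ k', j.app _ k' = j.app _ k := ⟨k, rfl⟩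
  rw [pull_apply, tensorMap_app_apply, tensorCochain_apply, dif_pos h, hj n h.choose_spec]
  rfl

/-- The pushout product of monomorphisms is a monomorphism. -/
theorem dimensionwiseMonos_pushoutProduct (hi : dimensionwiseMonos i)
    (hj : ∀ n : ℕ, Function.Injective (j.app (op ⦋n⦌)))
    (sq : (tensorFunctor Profinite.{u}).PushoutObjObj i j) : dimensionwiseMonos sq.ι := by
  classical
  refine (dimensionwiseMonos_iff_liftsCochains 𝔹).2 fun n c => ?_
  let α : L.obj (op ⦋n⦌) → C(A.obj (op ⦋n⦌), 𝔹) := tensorComponent (pull sq.inr c)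
  let β : K.obj (op ⦋n⦌) → C(B.obj (op ⦋n⦌), 𝔹) := tensorComponent (pull sq.inl c)
  have hαβ : ∀ k, pull i (β k) = α (j.app _ k) := by
    intro k
    ext a : 1
    have h₁ := congrArg (fun f => tensorComponent (pull f c) k a) sq.isPushout.w
    have h₂ := tensorMap_app_apply i (𝟙 K) k a
    have h₃ := tensorMap_app_apply (𝟙 A) j k a
    exact ((congrArg (pull sq.inl c) h₂).symm.trans h₁).trans (congrArg (pull sq.inr c) h₃)
  choose γ hγ using fun l => hi.liftsCochains 𝔹 n (α l)
  let δ : L.obj (op ⦋n⦌) → C(B.obj (op ⦋n⦌), 𝔹) := fun l =>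
    if h : ∃ k, j.app _ k = l then β h.choose else γ l
  have hδ : ∀ k, δ (j.app _ k) = β k := by
    intro k
    have h : ∃ k', j.app _ k' = j.app _ k := ⟨k, rfl⟩
    simp only [δ]
    rw [dif_pos h, hj n h.choose_spec]
  have hδ' : ∀ l, pull i (δ l) = α l := by
    intro l
    by_cases h : ∃ k, j.app _ k = l
    · obtain ⟨k, rfl⟩ := h
      rw [hδ, hαβ]
    · simp only [δ]
      rw [dif_neg h, hγ]
  obtain ⟨ε, hε⟩ : ∃ ε : C((((tensorFunctor Profinite.{u}).obj B).obj L).obj (op ⦋n⦌), 𝔹),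
      ∀ l b, ε ((tensorUnit B L).app _ l b) = δ l b := ⟨tensorCochain δ, tensorCochain_apply δ⟩
  refine ⟨ε, ?_⟩
  have key : sq.ι ≫ toL ε = toL c := by
    refine sq.hom_ext (ofL_injective ?_) (ofL_injective ?_)
    · rw [sq.inl_ι_assoc, ofL_comp, ofL_comp, ofL_toL, ofL_toL]
      refine tensorCochain_ext fun k b => ?_
      refine (congrArg ε (tensorMap_app_apply (𝟙 B) j k b)).trans ?_
      exact (hε _ _).trans (DFunLike.congr_fun (hδ k) b)
    · rw [sq.inr_ι_assoc, ofL_comp, ofL_comp, ofL_toL, ofL_toL]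
      refine tensorCochain_ext fun l a => ?_
      refine (congrArg ε (tensorMap_app_apply i (𝟙 L) l a)).trans ?_
      exact (hε _ _).trans (DFunLike.congr_fun (hδ' l) a)
  have := congrArg ofL key
  rwa [ofL_comp, ofL_toL, ofL_toL] at this

end Monos

section Contraction

/-- The profinite space without simplices. -/
def empty : ProfiniteSpace.{u} :=
  (SimplicialObject.const Profinite.{u}).obj (Profinite.of PEmpty.{u + 1})

/-- The map from the profinite space without simplices. -/
def fromEmpty (X : ProfiniteSpace.{u}) : empty ⟶ X where
  app n := CompHausLike.ofHom _ ⟨fun x : PEmpty => x.elim, continuous_of_discreteTopology⟩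
  naturality _ _ _ := by
    ext x
    exact x.elim

theorem dimensionwiseMonos_fromEmpty (X : ProfiniteSpace.{u}) :
    dimensionwiseMonos (fromEmpty X) :=
  dimensionwiseMonos_iff.2 fun _ x => x.elim

/-- The inclusion of the two vertices of the interval, as constant simplicial sets. -/
def vertices : (Functor.const _).obj (ULift.{u} (Fin 2)) ⟶ (Δ[1] : SSet.{u}) where
  app n := ↾fun i => SSet.stdSimplex.const 1 i.down n

theorem vertices_injective (n : ℕ) : Function.Injective (vertices.{u}.app (op ⦋n⦌)) := by
  intro i i' h
  have := congrArg (fun s : Δ[1] _⦋n⦌ => s 0) h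
  exact ULift.ext _ _ this

/-- A map with the right lifting property for all monomorphisms has a section, and is a homotopy
inverse of this section, so that it is a cohomology isomorphism. -/
theorem rlp_dimensionwiseMonos_le (ℓ : ℕ) :
    dimensionwiseMonos.{u}.rlp ≤ cohomologyIsos ℓ := by
  intro X Y p hp
  have := hp _ (dimensionwiseMonos_fromEmpty Y)
  have sq : CommSq (fromEmpty X) (fromEmpty Y) p (𝟙 Y) := ⟨by
    ext n x
    exact x.elim⟩
  let s := sq.lift
  have hs : s ≫ p = 𝟙 Y := sq.fac_right
  have := hp _ (dimensionwiseMonos_tensorMap_of_injective (A := X) vertices_injective)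
  have sq' : CommSq (tensorDesc (Y := X) (K := (Functor.const _).obj (ULift.{u} (Fin 2)))
      { app := fun n i => if i.down = 0 then 𝟙 _ else (p ≫ s).app n
        naturality := fun {n m} θ i => by
          change X.map θ ≫ (if i.down = 0 then 𝟙 _ else _) = _
          split_ifs
          · rw [Category.comp_id, Category.id_comp]
          · exact (p ≫ s).naturality θ }) (tensorMap (𝟙 X) vertices) p
      (tensorDesc (.ofNatTrans p)) := ⟨by
    refine tensor_hom_ext fun n i => ?_
    rw [NatTrans.comp_app, NatTrans.comp_app, tensorUnit_app_tensorDesc_app_assoc,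
      tensorUnit_app_tensorMap_app_assoc, tensorUnit_app_tensorDesc_app]
    dsimp only
    split_ifs
    · rfl
    · rw [← NatTrans.comp_app, Category.assoc, hs, Category.comp_id]
      exact (Category.id_comp _).symm⟩
  let H : Functor.HomObj X X (Δ[1] : SSet.{u}) := tensorEquiv X X _ sq'.lift
  have hH : ∀ (n : ℕ) (i : Fin 2), H.app (op ⦋n⦌) (SSet.stdSimplex.const 1 i _) =
      if i = 0 then 𝟙 _ else (p ≫ s).app _ := by
    intro n i
    have h₁ := congrArg (fun f => (tensorUnit X _).app (op ⦋n⦌) (ULift.up i) ≫ f.app _) sq'.fac_left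
    have h₂ := tensorUnit_app_tensorMap_app_assoc (𝟙 X) vertices.{u} (op ⦋n⦌) (ULift.up i)
      (sq'.lift.app _)
    exact ((h₂.trans (Category.id_comp _)).symm.trans h₁).trans
      (tensorUnit_app_tensorDesc_app _ _ _)
  refine cohomologyIsos_of_inverse (f := p) s (fun n => (homologyMap_cochainsMap_eq
    (H.toHomotopy (f := 𝟙 X) (g := p ≫ s) (fun n => ?_) (fun n => ?_)) n).symm)
    (fun n => by rw [hs])
  · refine Eq.trans (congrArg _ ?_) (hH n 0)
    refine SSet.stdSimplex.ext _ _ fun i => ?_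
    rw [SSet.stdSimplex.objMk₁_apply, if_pos (Fin.castSucc_lt_last i)]
    rfl
  · refine Eq.trans (congrArg _ ?_) (hH n 1)
    refine SSet.stdSimplex.ext _ _ fun i => ?_
    rw [SSet.stdSimplex.objMk₁_apply, if_neg (Fin.not_lt_zero _)]
    rfl

end Contraction

end ProfiniteSpace

/-! ### Cosmall profinite spaces and factorizations -/

namespace Profinite

/-- If two maps to a discrete set become equal on a cofiltered limit of profinite sets, they become
equal at some stage. -/
theorem exists_comp_map_eq {J : Type u} [SmallCategory J] [IsCofiltered J]
    {F : J ⥤ Profinite.{u}} {C : Cone F} (hC : IsLimit C) {S : Type w} [TopologicalSpace S]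
    [DiscreteTopology S] {j : J} (g g' : C(F.obj j, S))
    (h : ∀ x, g (C.π.app j x) = g' (C.π.app j x)) :
    ∃ (k : J) (φ : k ⟶ j), ∀ x, g (F.map φ x) = g' (F.map φ x) := by
  by_contra! hne
  let T : Set (F.obj j) := {x | g x ≠ g' x}
  have hT : IsClosed T := (isOpen_discrete {p : S × S | p.1 = p.2}).isClosed_compl.preimage
    (g.continuous.prodMk g'.continuous)
  -- the points of the system `F` over `j` at which `g` and `g'` differ
  let G : Over j ⥤ TopCat.{u} :=
    { obj := fun φ => TopCat.of {x : F.obj φ.left // F.map φ.hom x ∈ T}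
      map := fun {φ φ'} θ => TopCat.ofHom
        { toFun := fun x => ⟨F.map θ.left x.1, by
            have := ConcreteCategory.congr_hom (F.map_comp θ.left φ'.hom) x.1
            rw [Over.w θ] at this
            exact this ▸ x.2⟩
          continuous_toFun := by
            exact ((F.map θ.left).hom.hom.continuous.comp continuous_subtype_val).subtype_mk _ }
      map_id := fun φ => by
        ext x
        exact ConcreteCategory.congr_hom (F.map_id φ.left) x.1
      map_comp := fun θ θ' => by
        ext x
        exact ConcreteCategory.congr_hom (F.map_comp θ.left θ'.left) x.1 }
  have (φ : Over j) : Nonempty (G.obj φ) := by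
    obtain ⟨x, hx⟩ := hne φ.left φ.hom
    exact ⟨⟨x, hx⟩⟩
  have (φ : Over j) : CompactSpace (G.obj φ) :=
    isCompact_iff_compactSpace.1 (hT.preimage (F.map φ.hom).hom.hom.continuous).isCompact
  have (φ : Over j) : T2Space (G.obj φ) := inferInstanceAs (T2Space (Subtype _))
  obtain ⟨u, hu⟩ := TopCat.nonempty_limitCone_of_compact_t2_cofiltered_system G
  let s : Cone (Over.forget j ⋙ F) :=
    { pt := Profinite.of PUnit.{u + 1}
      π :=
        { app := fun φ => CompHausLike.ofHom _ (ContinuousMap.const _ (u φ).1)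
          naturality := fun φ φ' θ => by
            ext
            exact (congrArg Subtype.val (hu θ)).symm } }
  let hC' := (Functor.Initial.isLimitWhiskerEquiv (Over.forget j) C).symm hC
  let x : C.pt := hC'.lift s PUnit.unit
  have hx : C.π.app j x = (u (Over.mk (𝟙 j))).1 :=
    ConcreteCategory.congr_hom (hC'.fac s (Over.mk (𝟙 j))) PUnit.unit
  have hu' : F.map (𝟙 j) (u (Over.mk (𝟙 j))).1 ∈ T := (u (Over.mk (𝟙 j))).2
  rw [F.map_id, ← hx] at hu'
  exact hu' (h x)

/-- Finite discrete sets are cosmall with respect to all cofiltered limits of profinite sets. -/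
instance isCardinalPresentable_op_of_finite (S : Profinite.{u}) [Finite S] [DiscreteTopology S] :
    letI : Fact Cardinal.aleph0.{u}.IsRegular := ⟨Cardinal.isRegular_aleph0⟩
    IsCardinalPresentable (op S) Cardinal.aleph0.{u} := by
  let _ : Fact Cardinal.aleph0.{u}.IsRegular := ⟨Cardinal.isRegular_aleph0⟩
  refine ⟨fun J _ _ => ⟨fun {F} => ⟨fun {c} hc => ⟨?_⟩⟩⟩⟩
  have : IsFiltered J := isFiltered_of_isCardinalFiltered J Cardinal.aleph0.{u}
  have hC : IsLimit (coneLeftOpOfCocone c) := isLimitConeLeftOpOfCocone _ hc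
  refine Types.FilteredColimit.isColimitOf' _ _ (fun f => ?_) (fun j g g' h => ?_)
  · obtain ⟨j, g, hg⟩ := Profinite.exists_locallyConstant _ hC
      (⟨f.unop, (IsLocallyConstant.iff_continuous _).2 f.unop.hom.hom.continuous⟩ :
        LocallyConstant c.pt.unop S)
    refine ⟨j.unop, Quiver.Hom.op (CompHausLike.ofHom _ ⟨g, g.continuous⟩), ?_⟩
    refine Quiver.Hom.unop_inj ?_
    ext x
    exact DFunLike.congr_fun hg x
  · obtain ⟨k, φ, hφ⟩ := exists_comp_map_eq hC (j := op j) g.unop.hom.hom g'.unop.hom.hom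
      (fun x => ConcreteCategory.congr_hom (congrArg Quiver.Hom.unop h) x)
    refine ⟨k.unop, φ.unop, Quiver.Hom.unop_inj ?_⟩
    ext x
    exact hφ x

/-- Every profinite set is a small limit of finite discrete sets, so that it is cosmall. -/
theorem isCardinalPresentable_op (S : Profinite.{u}) (κ : Cardinal.{u}) [Fact κ.IsRegular]
    (hκ : HasCardinalLT (Arrow (DiscreteQuotient S)ᵒᵖ) κ) : IsCardinalPresentable (op S) κ := by
  let _ : Fact Cardinal.aleph0.{u}.IsRegular := ⟨Cardinal.isRegular_aleph0⟩
  have (k : (DiscreteQuotient S)ᵒᵖ) : IsCardinalPresentable (S.diagram.op.obj k) κ := by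
    have : Finite (S.diagram.obj k.unop) := inferInstanceAs (Finite k.unop)
    have : DiscreteTopology (S.diagram.obj k.unop) := ⟨rfl⟩
    have : IsCardinalPresentable (S.diagram.op.obj k) Cardinal.aleph0.{u} :=
      isCardinalPresentable_op_of_finite (S.diagram.obj k.unop)
    exact isCardinalPresentable_of_le _ (Cardinal.IsRegular.aleph0_le Fact.out)
  exact isCardinalPresentable_of_isColimit _ S.asLimit.op κ hκ

end Profinite

namespace ProfiniteSpace

section Presentable

variable {κ : Cardinal.{u}} [Fact κ.IsRegular]

/-- The space `L(S, n)` is cosmall if `S` is, because it represents `X ↦ C(X_n, S)` and limits of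
simplicial objects are computed dimensionwise. -/
theorem isCardinalPresentable_op_L (S : Type u) [TopologicalSpace S] [CompactSpace S] [T2Space S]
    [TotallyDisconnectedSpace S] (n : ℕ) [IsCardinalPresentable (op (Profinite.of S)) κ] :
    IsCardinalPresentable (op (L S n)) κ := by
  let E : ProfiniteSpace.{u}ᵒᵖ ⥤ Profinite.{u}ᵒᵖ :=
    ((evaluation SimplexCategoryᵒᵖ Profinite.{u}).obj (op (.mk n))).op
  let e : E ⋙ coyoneda.obj (op (op (Profinite.of S))) ≅ coyoneda.obj (op (op (L S n))) :=
    NatIso.ofComponents (fun X => Equiv.toIso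
      { toFun := fun f => (toL (X := X.unop) f.unop.hom.hom).op
        invFun := fun g => Quiver.Hom.op (CompHausLike.ofHom _ (ofL g.unop))
        left_inv := fun f => by
          exact congrArg (fun c => Quiver.Hom.op (CompHausLike.ofHom _ c))
            (ofL_toL (X := X.unop) f.unop.hom.hom)
        right_inv := fun g => congrArg Quiver.Hom.op (toL_ofL g.unop) })
      (fun f => by
        ext g
        exact congrArg Quiver.Hom.op (ofL_injective (by
          rw [ofL_comp, ofL_toL]
          exact congrArg (pull f.unop) (ofL_toL _).symm)))
  have : E.IsCardinalAccessible κ := inferInstance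
  exact Functor.isCardinalAccessible_of_natIso e κ

theorem isCardinalPresentable_op_point : IsCardinalPresentable (op point.{u}) κ := by
  have h : IsTerminal point.{u} := IsTerminal.ofUniqueHom toPoint fun _ _ => Subsingleton.elim _ _
  have (k : Discrete PEmpty.{1}) :
      IsCardinalPresentable ((Functor.empty ProfiniteSpace.{u}ᵒᵖ).obj k) κ := k.as.elim
  exact isCardinalPresentable_of_isColimit _ (initialOpOfTerminal h) κ
    (hasCardinalLT_of_finite _ _ (Cardinal.IsRegular.aleph0_le Fact.out))

variable {ℓ : ℕ} (M : AbelianProGroup.{u} ℓ)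

/-- The differential, as a map of representing spaces. -/
def LToL (n : ℕ) : L M.carrier n ⟶ L M.carrier (n + 1) := LToK M n ≫ KToL M (n + 1)

theorem ofL_comp_LToL {X : ProfiniteSpace.{u}} {n : ℕ} (g : X ⟶ L M.carrier n) :
    ofL (g ≫ LToL M n) = coboundary (ofL g) := ofK_comp_LToK M g

theorem KToL_comp_LToL (n : ℕ) :
    KToL M n ≫ LToL M n = KToL M n ≫ (toL 0 : L M.carrier n ⟶ L M.carrier (n + 1)) := by
  refine ofL_injective ?_
  rw [ofL_comp_LToL, ofL_comp, ofL_toL]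
  exact coboundary_ofK M (𝟙 _)

/-- The space `K(M, n)` is the kernel of the differential. -/
def isLimitKToL (n : ℕ) : IsLimit (Fork.ofι (KToL M n) (KToL_comp_LToL M n)) :=
  Fork.IsLimit.mk' _ fun s => by
    have h : coboundary (ofL s.ι) = 0 := by
      rw [← ofL_comp_LToL, s.condition, ofL_comp, ofL_toL]
      rfl
    have h' : toK M (ofL s.ι) h ≫ KToL M n = s.ι := ofL_injective (ofK_toK M (ofL s.ι) h)
    exact ⟨toK M (ofL s.ι) h, h', fun {m} hm => KToL_injective M (Eq.trans hm h'.symm)⟩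

theorem isCardinalPresentable_op_K (n : ℕ)
    [IsCardinalPresentable (op (Profinite.of M.carrier)) κ] :
    IsCardinalPresentable (op (K M n)) κ := by
  have (k : WalkingParallelPairᵒᵖ) : IsCardinalPresentable
      ((parallelPair (LToL M n) (toL 0)).op.obj k) κ := by
    obtain ⟨_ | _⟩ := k
    · exact isCardinalPresentable_op_L M.carrier n
    · exact isCardinalPresentable_op_L M.carrier (n + 1)
  exact isCardinalPresentable_of_isColimit _ (isLimitKToL M n).op κ
    (hasCardinalLT_of_finite _ _ (Cardinal.IsRegular.aleph0_le Fact.out))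

end Presentable

section SmallObjectArgument

open MorphismProperty

variable {ℓ : ℕ} (𝓜 : Set (AbelianProGroup.{u} ℓ))

theorem isSmall_op {C : Type w} [Category.{u} C] (W : MorphismProperty C) [IsSmall.{u} W] :
    IsSmall.{u} W.op := by
  obtain ⟨ι, A, B, f, rfl⟩ := (isSmall_iff_eq_ofHoms.{u} W).1 inferInstance
  have : (ofHoms f).op = ofHoms fun i => (f i).op := by
    refine le_antisymm ?_ ?_
    · intro _ _ g hg
      obtain ⟨i, hi⟩ := (ofHoms_iff f g.unop).1 hg
      exact (ofHoms_iff _ g).2 ⟨i, congrArg (fun a : Arrow C => Arrow.mk a.hom.op) hi⟩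
    · rintro _ _ _ ⟨i⟩
      exact ofHoms.mk (f := f) i
  rw [this]
  infer_instance

theorem isSmall_sup {C : Type w} [Category.{u} C] (W W' : MorphismProperty C) [IsSmall.{u} W]
    [IsSmall.{u} W'] : IsSmall.{u} (W ⊔ W') :=
  ⟨inferInstanceAs (Small.{u} (W.toSet ∪ W'.toSet : Set (Arrow C)))⟩

theorem isSmall_generatingTrivialFibrations [Small.{u} 𝓜] :
    IsSmall.{u} (generatingTrivialFibrations 𝓜) := by
  have : generatingTrivialFibrations 𝓜 =
      ofHoms fun i : 𝓜 × ℕ => toPoint (L i.1.1.carrier i.2) := by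
    refine le_antisymm ?_ ?_
    · rintro _ _ _ ⟨M, hM, n⟩
      exact ⟨((⟨M, hM⟩, n) : 𝓜 × ℕ)⟩
    · rintro _ _ _ ⟨i⟩
      exact .lToPoint i.1.1 i.1.2 i.2
  rw [this]
  infer_instance

theorem isSmall_generatingFibrations [Small.{u} 𝓜] :
    IsSmall.{u} (generatingFibrations 𝓜) := by
  have : generatingFibrations 𝓜 =
      ofHoms (fun i : 𝓜 × ℕ => LToK i.1.1 i.2) ⊔
        (ofHoms (fun M : 𝓜 => pointToK M.1) ⊔
          ofHoms (fun i : 𝓜 × ℕ => toPoint (K i.1.1 i.2))) := by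
    refine le_antisymm ?_ (sup_le ?_ (sup_le ?_ ?_))
    · rintro _ _ _ (⟨M, hM, n⟩ | ⟨M, hM⟩ | ⟨M, hM, n⟩)
      · exact Or.inl ⟨((⟨M, hM⟩, n) : 𝓜 × ℕ)⟩
      · exact Or.inr (Or.inl ⟨(⟨M, hM⟩ : 𝓜)⟩)
      · exact Or.inr (Or.inr ⟨((⟨M, hM⟩, n) : 𝓜 × ℕ)⟩)
    · rintro _ _ _ ⟨i⟩
      exact .lToK i.1.1 i.1.2 i.2
    · rintro _ _ _ ⟨M⟩
      exact .pointToK M.1 M.2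
    · rintro _ _ _ ⟨i⟩
      exact .kToPoint i.1.1 i.1.2 i.2
  rw [this]
  have := isSmall_sup (ofHoms (fun M : 𝓜 => pointToK M.1))
    (ofHoms (fun i : 𝓜 × ℕ => toPoint (K i.1.1 i.2)))
  exact isSmall_sup _ _

/-- A set of maps whose sources are `κ`-presentable permits the small object argument. -/
theorem hasSmallObjectArgument_of_isCardinalPresentable {C : Type w} [Category.{u} C]
    [HasColimitsOfSize.{u, u} C] (I : MorphismProperty C) [IsSmall.{u} I] (κ : Cardinal.{u})
    [hκ : Fact κ.IsRegular]
    (h : ∀ ⦃A B : C⦄ (i : A ⟶ B), I i → IsCardinalPresentable A κ) :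
    HasSmallObjectArgument.{u} I := by
  have : Nonempty κ.ord.ToType := by simpa using hκ.out.ne_zero
  have := WellFoundedLT.toOrderBot κ.ord.ToType
  refine ⟨κ, inferInstance, inferInstance, { preservesColimit := fun {A B X Y} i hi f hf => ?_ }⟩
  have := h i hi
  have := preservesColimitsOfShape_of_isCardinalPresentable A κ κ.ord.ToType
  infer_instance

theorem exists_isCardinalPresentable [Small.{u} 𝓜] : ∃ (κ : Cardinal.{u}) (_ : Fact κ.IsRegular),
    ∀ M ∈ 𝓜, IsCardinalPresentable (op (Profinite.of M.carrier)) κ := by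
  obtain ⟨κ, hκ, h⟩ := HasCardinalLT.exists_regular_cardinal_forall.{u}
    (fun M : 𝓜 => Arrow (DiscreteQuotient (Profinite.of M.1.carrier))ᵒᵖ)
  have : Fact κ.IsRegular := ⟨hκ⟩
  exact ⟨κ, this, fun M hM => Profinite.isCardinalPresentable_op _ κ (h ⟨M, hM⟩)⟩

theorem hasSmallObjectArgument_generatingFibrations [Small.{u} 𝓜] :
    HasSmallObjectArgument.{u} (generatingFibrations 𝓜).op := by
  obtain ⟨κ, _, h⟩ := exists_isCardinalPresentable 𝓜
  have := isSmall_generatingFibrations 𝓜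
  have := isSmall_op (generatingFibrations 𝓜)
  refine hasSmallObjectArgument_of_isCardinalPresentable _ κ ?_
  have h' : ∀ ⦃X Y : ProfiniteSpace.{u}⦄ (f : X ⟶ Y), generatingFibrations 𝓜 f →
      IsCardinalPresentable (op Y) κ := by
    rintro _ _ _ (⟨M, hM, n⟩ | ⟨M, hM⟩ | ⟨M, hM, n⟩)
    · have := h M hM
      exact isCardinalPresentable_op_K M (n + 1)
    · have := h M hM
      exact isCardinalPresentable_op_K M 0
    · exact isCardinalPresentable_op_point
  exact fun A B i hi => h' i.unop hi

theorem hasSmallObjectArgument_generatingTrivialFibrations [Small.{u} 𝓜] :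
    HasSmallObjectArgument.{u} (generatingTrivialFibrations 𝓜).op := by
  obtain ⟨κ, _, h⟩ := exists_isCardinalPresentable 𝓜
  have := isSmall_generatingTrivialFibrations 𝓜
  have := isSmall_op (generatingTrivialFibrations 𝓜)
  refine hasSmallObjectArgument_of_isCardinalPresentable _ κ ?_
  have h' : ∀ ⦃X Y : ProfiniteSpace.{u}⦄ (f : X ⟶ Y), generatingTrivialFibrations 𝓜 f →
      IsCardinalPresentable (op Y) κ := by
    rintro _ _ _ ⟨M, hM, n⟩
    exact isCardinalPresentable_op_point
  exact fun A B i hi => h' i.unop hi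

/-- The dual of the small object argument. -/
theorem hasFactorization_llp_llp_rlp {C : Type w} [Category.{u} C] (P : MorphismProperty C)
    [HasSmallObjectArgument.{u} P.op] : HasFactorization P.llp P.llp.rlp := by
  have h₁ : P.op.rlp.unop = P.llp := by
    ext A B i
    exact ⟨fun h X Y p hp => (HasLiftingProperty.iff_op).2 (h p.op hp),
      fun h X Y p hp => (HasLiftingProperty.iff_unop _ _).2 (h p.unop hp)⟩
  have h₂ : P.op.rlp.llp.unop = P.llp.rlp := by
    rw [← h₁]
    ext X Y p
    exact ⟨fun h A B i hi => (HasLiftingProperty.iff_op).2 (h i.op hi),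
      fun h A B i hi => (HasLiftingProperty.iff_unop _ _).2 (h i.unop hi)⟩
  refine ⟨fun f => ⟨?_⟩⟩
  have := (factorizationData P.op.rlp.llp P.op.rlp f.op).unop
  rwa [h₁, h₂] at this

end SmallObjectArgument

end ProfiniteSpace

/-! ### The model structure -/

namespace ProfiniteSpace

open MorphismProperty

section ModelStructure

variable (ℓ : ℕ)

/-- The maps with the right lifting property for all dimensionwise monomorphisms that are cohomology
isomorphisms. -/
def fibrationsOfCohomologyIsos : MorphismProperty ProfiniteSpace.{u} :=
  (dimensionwiseMonos ⊓ cohomologyIsos ℓ).rlp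

theorem exists_mem_singleton_zmodGroup [Fact ℓ.Prime] :
    ∃ M ∈ ({zmodGroup.{u} ℓ} : Set (AbelianProGroup.{u} ℓ)), Nonempty (M.carrier ≃ₜ+ ZMod ℓ) :=
  ⟨_, rfl, ⟨zmodGroupEquiv ℓ⟩⟩

theorem hasFactorization_dimensionwiseMonos :
    HasFactorization dimensionwiseMonos.{u} dimensionwiseMonos.{u}.rlp := by
  have : Fact (Nat.Prime 2) := ⟨Nat.prime_two⟩
  have := hasSmallObjectArgument_generatingTrivialFibrations.{u} {zmodGroup.{u} 2}
  rw [← llp_generatingTrivialFibrations_eq (exists_mem_singleton_zmodGroup.{u} 2)]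
  exact hasFactorization_llp_llp_rlp _

/-- A fibration which is a cohomology isomorphism is a retract of a map with the right lifting
property for all monomorphisms. -/
theorem fibrations_inf_cohomologyIsos :
    fibrationsOfCohomologyIsos.{u} ℓ ⊓ cohomologyIsos ℓ = dimensionwiseMonos.{u}.rlp := by
  refine le_antisymm ?_ (le_inf (antitone_rlp inf_le_left) (rlp_dimensionwiseMonos_le ℓ))
  rintro X Y p ⟨hp, hp'⟩
  have := hasFactorization_dimensionwiseMonos.{u}
  have h := factorizationData dimensionwiseMonos.{u} dimensionwiseMonos.{u}.rlp p
  have hi : cohomologyIsos ℓ h.i := by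
    refine (cohomologyIsos ℓ).of_postcomp h.i h.p (rlp_dimensionwiseMonos_le ℓ _ h.hp) ?_
    rwa [h.fac]
  have := hp h.i ⟨h.hi, hi⟩
  exact of_retract (RetractArrow.ofRightLiftingProperty h.fac) h.hp

variable [Fact ℓ.Prime]

theorem hasFactorization_trivialCofibrations :
    HasFactorization (dimensionwiseMonos.{u} ⊓ cohomologyIsos ℓ)
      (fibrationsOfCohomologyIsos.{u} ℓ) := by
  have := hasSmallObjectArgument_generatingFibrations.{u} {zmodGroup.{u} ℓ}
  rw [fibrationsOfCohomologyIsos,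
    ← llp_generatingFibrations_eq (exists_mem_singleton_zmodGroup.{u} ℓ)]
  exact hasFactorization_llp_llp_rlp _

theorem llp_fibrationsOfCohomologyIsos :
    (fibrationsOfCohomologyIsos.{u} ℓ).llp = dimensionwiseMonos ⊓ cohomologyIsos ℓ := by
  rw [fibrationsOfCohomologyIsos,
    ← llp_generatingFibrations_eq (exists_mem_singleton_zmodGroup.{u} ℓ)]
  exact llp_rlp_llp _

theorem llp_rlp_dimensionwiseMonos : dimensionwiseMonos.{u}.rlp.llp = dimensionwiseMonos := by
  have : Fact (Nat.Prime 2) := ⟨Nat.prime_two⟩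
  rw [← llp_generatingTrivialFibrations_eq (exists_mem_singleton_zmodGroup.{u} 2)]
  exact llp_rlp_llp _

/-- The model structure whose weak equivalences are the cohomology isomorphisms, and whose
cofibrations are the dimensionwise monomorphisms. -/
@[reducible]
def modelCategory : ModelCategory ProfiniteSpace.{u} :=
  let _ : CategoryWithFibrations ProfiniteSpace.{u} := ⟨fibrationsOfCohomologyIsos ℓ⟩
  let _ : CategoryWithCofibrations ProfiniteSpace.{u} := ⟨dimensionwiseMonos⟩
  let _ : CategoryWithWeakEquivalences ProfiniteSpace.{u} := ⟨cohomologyIsos ℓ⟩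
  have : (weakEquivalences ProfiniteSpace.{u}).HasTwoOutOfThreeProperty :=
    inferInstanceAs (cohomologyIsos ℓ).HasTwoOutOfThreeProperty
  have : IsWeakFactorizationSystem (cofibrations ProfiniteSpace.{u})
      (trivialFibrations ProfiniteSpace.{u}) :=
    { rlp := (fibrations_inf_cohomologyIsos ℓ).symm
      llp := (congrArg MorphismProperty.llp (fibrations_inf_cohomologyIsos ℓ)).trans
        llp_rlp_dimensionwiseMonos
      hasFactorization := by
        have h := hasFactorization_dimensionwiseMonos.{u}
        rw [← fibrations_inf_cohomologyIsos ℓ] at h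
        exact h }
  have : IsWeakFactorizationSystem (trivialCofibrations ProfiniteSpace.{u})
      (fibrations ProfiniteSpace.{u}) :=
    { rlp := rfl
      llp := llp_fibrationsOfCohomologyIsos ℓ
      hasFactorization := hasFactorization_trivialCofibrations ℓ }
  ModelCategory.mk' ProfiniteSpace.{u}

theorem generatesByLifting {𝓜 : Set (AbelianProGroup.{u} ℓ)}
    (h𝓜 : ∃ M ∈ 𝓜, Nonempty (M.carrier ≃ₜ+ ZMod ℓ)) :
    letI := modelCategory.{u} ℓ
    GeneratesByLifting (generatingFibrations 𝓜) (generatingTrivialFibrations 𝓜) :=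
  letI := modelCategory.{u} ℓ
  { trivialCofibrations_eq := (llp_generatingFibrations_eq h𝓜).symm
    cofibrations_eq := (llp_generatingTrivialFibrations_eq h𝓜).symm }

theorem isFibrantlyGenerated {𝓜 : Set (AbelianProGroup.{u} ℓ)} [Small.{u} 𝓜]
    (h𝓜 : ∃ M ∈ 𝓜, Nonempty (M.carrier ≃ₜ+ ZMod ℓ)) :
    letI := modelCategory.{u} ℓ
    IsFibrantlyGenerated (generatingFibrations 𝓜) (generatingTrivialFibrations 𝓜) :=
  letI := modelCategory.{u} ℓ
  { generatesByLifting ℓ h𝓜 with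
    isSmall_P := isSmall_generatingFibrations 𝓜
    isSmall_Q := isSmall_generatingTrivialFibrations 𝓜
    cosmall_P := hasSmallObjectArgument_generatingFibrations 𝓜
    cosmall_Q := hasSmallObjectArgument_generatingTrivialFibrations 𝓜 }

end ModelStructure

end ProfiniteSpace

/-! ### Left properness -/

namespace ProfiniteSpace

section LeftProper

variable {A B A' B' : ProfiniteSpace.{u}} {w : A ⟶ A'} {i : A ⟶ B} {j : A' ⟶ B'} {w' : B ⟶ B'}

/-- Since the functor of cochains with values in a profinite set is representable, the cochains on
a pushout are the compatible pairs of cochains. -/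
theorem exists_cochain_of_isPushout (sq : IsPushout w i j w') {S : Type*} [TopologicalSpace S]
    {T : Type u} [TopologicalSpace T] [CompactSpace T] [T2Space T] [TotallyDisconnectedSpace T]
    (e : T ≃ₜ S) {n : ℕ} (a : C(A'.obj (op (.mk n)), S)) (b : C(B.obj (op (.mk n)), S))
    (h : pull w a = pull i b) :
    ∃ c : C(B'.obj (op (.mk n)), S), pull j c = a ∧ pull w' c = b := by
  let g : B' ⟶ L T n := sq.desc (toL ((e.symm : C(S, T)).comp a)) (toL ((e.symm : C(S, T)).comp b))
    (ofL_injective (by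
      rw [ofL_comp, ofL_comp, ofL_toL, ofL_toL]
      exact congrArg (e.symm : C(S, T)).comp h))
  have h₁ : pull j (ofL g) = (e.symm : C(S, T)).comp a := by
    rw [← ofL_comp, sq.inl_desc, ofL_toL]
  have h₂ : pull w' (ofL g) = (e.symm : C(S, T)).comp b := by
    rw [← ofL_comp, sq.inr_desc, ofL_toL]
  refine ⟨(e : C(T, S)).comp (ofL g), ContinuousMap.ext fun x => ?_, ContinuousMap.ext fun x => ?_⟩
  · exact (congrArg e (DFunLike.congr_fun h₁ x)).trans (e.apply_symm_apply _)
  · exact (congrArg e (DFunLike.congr_fun h₂ x)).trans (e.apply_symm_apply _)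

theorem cochain_ext_of_isPushout (sq : IsPushout w i j w') {S : Type*} [TopologicalSpace S]
    {T : Type u} [TopologicalSpace T] [CompactSpace T] [T2Space T] [TotallyDisconnectedSpace T]
    (e : T ≃ₜ S) {n : ℕ} {c c' : C(B'.obj (op (.mk n)), S)} (h : pull j c = pull j c')
    (h' : pull w' c = pull w' c') : c = c' := by
  have hc : (toL ((e.symm : C(S, T)).comp c) : B' ⟶ L T n) = toL ((e.symm : C(S, T)).comp c') := by
    refine sq.hom_ext (ofL_injective ?_) (ofL_injective ?_)
    · rw [ofL_comp, ofL_comp, ofL_toL, ofL_toL]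
      exact congrArg (e.symm : C(S, T)).comp h
    · rw [ofL_comp, ofL_comp, ofL_toL, ofL_toL]
      exact congrArg (e.symm : C(S, T)).comp h'
  have hc' := congrArg ofL hc
  rw [ofL_toL, ofL_toL] at hc'
  exact ContinuousMap.ext fun x => e.symm.injective (DFunLike.congr_fun hc' x)

theorem LiftsCochains.exists_isCoboundary {π : Type*} [AddCommGroup π] [TopologicalSpace π]
    [IsTopologicalAddGroup π] (hi : LiftsCochains i π) {n : ℕ} {a : C(A.obj (op (.mk n)), π)}
    (ha : IsCoboundary a) : ∃ b : C(B.obj (op (.mk n)), π), IsCoboundary b ∧ pull i b = a := by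
  cases n with
  | zero => exact ⟨0, isCoboundary_zero, Eq.symm ha⟩
  | succ n =>
    obtain ⟨c, rfl⟩ := ha
    obtain ⟨c, rfl⟩ := hi n c
    exact ⟨coboundary c, ⟨c, rfl⟩, (coboundary_pull i c).symm⟩

theorem cohomologyIsos_of_isPushout (ℓ : ℕ) [Fact ℓ.Prime] (sq : IsPushout w i j w')
    (hw : cohomologyIsos ℓ w) (hi : dimensionwiseMonos i) : cohomologyIsos ℓ w' := by
  have hi := hi.liftsCochains (ZMod ℓ)
  rw [cohomologyIsos_iff] at hw ⊢
  let e := (zmodGroupEquiv.{u} ℓ).toHomeomorph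
  have hsq {n : ℕ} (c : C(B'.obj (op (.mk n)), ZMod ℓ)) :
      pull w (pull j c) = pull i (pull w' c) := by
    rw [← pull_comp, ← pull_comp, sq.w]
  refine fun n => ⟨fun z hz hz' => ?_, fun b hb => ?_⟩
  · cases n with
    | zero =>
      replace hz' : pull w' z = 0 := hz'
      refine cochain_ext_of_isPushout (c' := 0) sq e ((hw 0).1 _ ?_ ?_) hz'
      · rw [coboundary_pull, hz]
        rfl
      · change pull w (pull j z) = 0
        rw [hsq, hz']
        rfl
    | succ n =>
      obtain ⟨b, hb⟩ := hz'
      obtain ⟨a, ha⟩ := (hw (n + 1)).1 (pull j z) (by rw [coboundary_pull, hz]; rfl)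
        ⟨pull i b, by rw [hsq, coboundary_pull, hb]⟩
      -- Correct `a` and `b` by cocycles so that they agree on `A`.
      obtain ⟨a', ha', h⟩ := (hw n).2 (pull w a - pull i b) (by
        rw [coboundary_sub, coboundary_pull, coboundary_pull, ha, hb, hsq, sub_self])
      obtain ⟨b', hb', h'⟩ := hi.exists_isCoboundary h
      obtain ⟨c, hc, hc'⟩ := exists_cochain_of_isPushout sq e (a - a') (b + b') (by
        rw [pull_sub, pull_add, h']
        abel)
      refine ⟨c, cochain_ext_of_isPushout sq e ?_ ?_⟩
      · rw [← coboundary_pull, hc, coboundary_sub, ha, ha', sub_zero]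
      · rw [← coboundary_pull, hc', coboundary_add, hb, hb'.coboundary_eq_zero, add_zero]
  · obtain ⟨a, ha, h⟩ := (hw n).2 (pull i b) (by rw [coboundary_pull, hb]; rfl)
    obtain ⟨b', hb', h'⟩ := hi.exists_isCoboundary h
    obtain ⟨c, hc, hc'⟩ := exists_cochain_of_isPushout sq e a (b - b') (by
      rw [pull_sub, h', sub_sub_cancel])
    refine ⟨c, cochain_ext_of_isPushout sq e ?_ ?_, ?_⟩
    · rw [← coboundary_pull, hc, ha]
      rfl
    · rw [← coboundary_pull, hc', coboundary_sub, hb, hb'.coboundary_eq_zero, sub_zero]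
      rfl
    · rwa [hc', sub_sub_cancel]

theorem isLeftProper (ℓ : ℕ) [Fact ℓ.Prime] :
    letI := modelCategory.{u} ℓ
    IsLeftProper ProfiniteSpace.{u} :=
  letI := modelCategory.{u} ℓ
  fun _ _ _ _ _ _ _ _ sq hw hi => cohomologyIsos_of_isPushout ℓ sq hw hi

end LeftProper

end ProfiniteSpace

/-! ### Tensor products with contractible simplicial sets -/

section Star

open Simplicial SSet

namespace SSet.Subcomplex

variable {n : ℕ} (K : (Δ[n] : SSet.{u}).Subcomplex) (k : Fin (n + 1))

/-- A subcomplex of `Δ[n]` is a star with center `k` if its simplices remain in the subcomplex when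
some of their vertices are replaced by `k`. -/
structure IsStar : Prop where
  const_mem (m : SimplexCategoryᵒᵖ) : stdSimplex.const n k m ∈ K.obj m
  mem ⦃m : SimplexCategoryᵒᵖ⦄ ⦃s s' : Δ[n].obj m⦄ (hs : s ∈ K.obj m)
    (h : ∀ a, stdSimplex.asOrderHom s' a = stdSimplex.asOrderHom s a ∨
      stdSimplex.asOrderHom s' a = k) : s' ∈ K.obj m

theorem isStar_top : (⊤ : (Δ[n] : SSet.{u}).Subcomplex).IsStar k :=
  ⟨fun _ => Set.mem_univ _, fun _ _ _ _ _ => Set.mem_univ _⟩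

theorem isStar_horn (k : Fin (n + 2)) :
    (Λ[n + 1, k] : (Δ[n + 1] : SSet.{u}).Subcomplex).IsStar k where
  const_mem _ := by
    rw [mem_horn_iff, Set.ne_univ_iff_exists_notMem]
    obtain ⟨j, hj⟩ := exists_ne k
    refine ⟨j, ?_⟩
    rintro (⟨a, rfl⟩ | h)
    exacts [hj rfl, hj h]
  mem _ s s' hs h := by
    rw [mem_horn_iff, Set.ne_univ_iff_exists_notMem] at hs ⊢
    obtain ⟨j, hj⟩ := hs
    refine ⟨j, fun hj' => hj ?_⟩
    rcases hj' with ⟨a, rfl⟩ | hj'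
    · rcases h a with h | h
      · exact Or.inl ⟨a, h.symm⟩
      · exact Or.inr h
    · exact Or.inr hj'

variable {K k}

/-- The endomorphism of a star with center `k` which is given by a monotone map that moves vertices
only to `k`. -/
def IsStar.map (hK : K.IsStar k) (φ : Fin (n + 1) →o Fin (n + 1))
    (hφ : ∀ x, φ x = x ∨ φ x = k) : (K : SSet.{u}) ⟶ K where
  app _ := ↾fun s => ⟨stdSimplex.objMk (φ.comp (stdSimplex.asOrderHom s.1)),
    hK.mem s.2 fun _ => hφ _⟩
  naturality _ _ _ := rfl

/-- For monotone maps `φ ≤ ψ` that move vertices only to `k`, the homotopy from the endomorphism of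
a star with center `k` which is given by `φ` to the one which is given by `ψ`. -/
def IsStar.homotopy (hK : K.IsStar k) {φ ψ : Fin (n + 1) →o Fin (n + 1)} (h : φ ≤ ψ)
    (hφ : ∀ x, φ x = x ∨ φ x = k) (hψ : ∀ x, ψ x = x ∨ ψ x = k) :
    Functor.HomObj (K : SSet.{u}) K (Δ[1] : SSet.{u}) where
  app m t := ↾fun s => ⟨stdSimplex.objMk
    { toFun := fun a => if stdSimplex.asOrderHom t a = 0 then φ (stdSimplex.asOrderHom s.1 a)
        else ψ (stdSimplex.asOrderHom s.1 a)
      monotone' := fun a b hab => by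
        have hs := (stdSimplex.asOrderHom s.1).monotone hab
        have ht := (stdSimplex.asOrderHom t).monotone hab
        dsimp only
        split_ifs with h₁ h₂ h₂
        · exact φ.monotone hs
        · exact (h _).trans (ψ.monotone hs)
        · exact absurd (le_antisymm (ht.trans h₂.le) (Fin.zero_le _)) h₁
        · exact ψ.monotone hs },
    hK.mem s.2 fun a => by
      change (if stdSimplex.asOrderHom t a = 0 then φ (stdSimplex.asOrderHom s.1 a)
        else ψ (stdSimplex.asOrderHom s.1 a)) = _ ∨
          (if stdSimplex.asOrderHom t a = 0 then φ (stdSimplex.asOrderHom s.1 a)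
        else ψ (stdSimplex.asOrderHom s.1 a)) = _
      split_ifs
      exacts [hφ _, hψ _]⟩
  naturality _ _ := rfl

theorem IsStar.homotopy_app_objMk₁_last (hK : K.IsStar k) {φ ψ : Fin (n + 1) →o Fin (n + 1)}
    (h : φ ≤ ψ) (hφ : ∀ x, φ x = x ∨ φ x = k) (hψ : ∀ x, ψ x = x ∨ ψ x = k) (m : ℕ) :
    (hK.homotopy h hφ hψ).app (op ⦋m⦌) (stdSimplex.objMk₁ (Fin.last (m + 1))) =
      (hK.map φ hφ).app (op ⦋m⦌) := by
  ext s
  refine Subtype.ext (stdSimplex.ext _ _ fun a => ?_)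
  exact if_pos (if_pos (Fin.castSucc_lt_last a))

theorem IsStar.homotopy_app_objMk₁_zero (hK : K.IsStar k) {φ ψ : Fin (n + 1) →o Fin (n + 1)}
    (h : φ ≤ ψ) (hφ : ∀ x, φ x = x ∨ φ x = k) (hψ : ∀ x, ψ x = x ∨ ψ x = k) (m : ℕ) :
    (hK.homotopy h hφ hψ).app (op ⦋m⦌) (stdSimplex.objMk₁ 0) = (hK.map ψ hψ).app (op ⦋m⦌) := by
  ext s
  refine Subtype.ext (stdSimplex.ext _ _ fun a => ?_)
  have ha : stdSimplex.asOrderHom (stdSimplex.objMk₁.{u} (0 : Fin (m + 2))) a = 1 :=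
    (stdSimplex.objMk₁_apply.{u} _ a).trans (if_neg (Fin.not_lt_zero a.castSucc))
  exact if_neg (t := φ (stdSimplex.asOrderHom s.1 a))
    (ha.trans_ne (one_ne_zero (α := Fin 2)))

theorem IsStar.map_id (hK : K.IsStar k) : hK.map .id (fun _ => .inl rfl) = 𝟙 _ := by
  ext m x
  refine Subtype.ext ?_
  change stdSimplex.objMk (OrderHom.id.comp (stdSimplex.asOrderHom x.1)) = x.1
  rw [OrderHom.id_comp]
  rfl

end SSet.Subcomplex

end Star

namespace ProfiniteSpace

open CategoryTheory.SimplicialObject Simplicial SSet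

variable (X : ProfiniteSpace.{u}) (ℓ : ℕ)

/-- The action of a homotopy on the second factor of a tensor product. -/
noncomputable def tensorHomotopy {K L : SSet.{u}} (h : Functor.HomObj K L (Δ[1] : SSet.{u})) :
    Functor.HomObj (tensor X K) (tensor X L) (Δ[1] : SSet.{u}) where
  app n t := tensorObjDesc fun k => (tensorUnit X L).app n (h.app n t k)
  naturality {n m} θ t := by
    refine tensor_obj_hom_ext fun k => ?_
    rw [← (tensorUnit X K).naturality_assoc θ k, tensorUnit_app_tensorObjDesc,
      tensorUnit_app_tensorObjDesc_assoc, ← (tensorUnit X L).naturality θ]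
    exact congrArg (fun l => X.map θ ≫ (tensorUnit X L).app m l)
      (ConcreteCategory.congr_hom (h.naturality θ t) k)

theorem homologyMap_tensorMap_eq {K L : SSet.{u}} {f₀ f₁ : K ⟶ L}
    (h : Functor.HomObj K L (Δ[1] : SSet.{u}))
    (h₀ : ∀ n : ℕ, h.app (op ⦋n⦌) (stdSimplex.objMk₁ (Fin.last (n + 1))) = f₀.app (op ⦋n⦌))
    (h₁ : ∀ n : ℕ, h.app (op ⦋n⦌) (stdSimplex.objMk₁ 0) = f₁.app (op ⦋n⦌)) (n : ℕ) :
    HomologicalComplex.homologyMap (cochainsMap (tensorMap (𝟙 X) f₀) (ZMod ℓ)) n =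
      HomologicalComplex.homologyMap (cochainsMap (tensorMap (𝟙 X) f₁) (ZMod ℓ)) n := by
  refine homologyMap_cochainsMap_eq ((tensorHomotopy X h).toHomotopy (fun n => ?_)
    (fun n => ?_)) n
  · refine tensor_obj_hom_ext fun k => ?_
    rw [tensorUnit_app_tensorMap_app, NatTrans.id_app, Category.id_comp, ← h₀]
    exact tensorUnit_app_tensorObjDesc _ _
  · refine tensor_obj_hom_ext fun k => ?_
    rw [tensorUnit_app_tensorMap_app, NatTrans.id_app, Category.id_comp, ← h₁]
    exact tensorUnit_app_tensorObjDesc _ _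

theorem tensorMap_id_id (K : SSet.{u}) : tensorMap (𝟙 X) (𝟙 K) = 𝟙 (tensor X K) :=
  ((tensorFunctor Profinite.{u}).obj X).map_id K

/-- The projection `X ⊗ K ⟶ X`. -/
noncomputable def tensorFst (K : SSet.{u}) : tensor X K ⟶ X := tensorDesc (.ofNatTrans (𝟙 X))

theorem tensorUnit_app_tensorFst_app (K : SSet.{u}) (n : SimplexCategoryᵒᵖ) (k : K.obj n) :
    (tensorUnit X K).app n k ≫ (tensorFst X K).app n = 𝟙 _ :=
  tensorUnit_app_tensorDesc_app _ _ _

theorem tensorMap_tensorFst {X Y : ProfiniteSpace.{u}} (f : X ⟶ Y) {K L : SSet.{u}} (g : K ⟶ L) :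
    tensorMap f g ≫ tensorFst Y L = tensorFst X K ≫ f := by
  refine tensor_hom_ext fun n k => ?_
  rw [NatTrans.comp_app, NatTrans.comp_app, tensorUnit_app_tensorMap_app_assoc,
    tensorUnit_app_tensorFst_app, ← Category.assoc, tensorUnit_app_tensorFst_app,
    Category.comp_id, Category.id_comp]

/-- A star contracts to its center: both the identity and the constant map to the center are
homotopic to the minimum with the center. -/
theorem cohomologyIsos_tensorFst_of_isStar {n : ℕ} {K : (Δ[n] : SSet.{u}).Subcomplex}
    {k : Fin (n + 1)} (hK : K.IsStar k) : cohomologyIsos ℓ (tensorFst X (K : SSet.{u})) := by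
  let φ : Fin (n + 1) →o Fin (n + 1) := ⟨fun x => min x k, fun x y h => min_le_min_right k h⟩
  have hφ (x) : φ x = x ∨ φ x = k := min_choice x k
  have h₁ (i : ℕ) := homologyMap_tensorMap_eq X ℓ _
    (hK.homotopy_app_objMk₁_last (φ := φ) (ψ := .id) (fun x => min_le_left x k) hφ
      (fun _ => Or.inl rfl))
    (hK.homotopy_app_objMk₁_zero _ _ _) i
  have h₂ (i : ℕ) := homologyMap_tensorMap_eq X ℓ _
    (hK.homotopy_app_objMk₁_last (φ := φ) (ψ := .const _ k) (fun x => min_le_right x k) hφ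
      (fun _ => Or.inr rfl))
    (hK.homotopy_app_objMk₁_zero _ _ _) i
  let s : X ⟶ tensor X K :=
    { app := fun m => (tensorUnit X K).app m ⟨stdSimplex.const n k m, hK.const_mem m⟩
      naturality := fun m m' θ => (tensorUnit X K).naturality θ ⟨stdSimplex.const n k m, hK.const_mem m⟩ }
  have hs : s ≫ tensorFst X K = 𝟙 X := by
    refine NatTrans.ext (funext fun m => ?_)
    exact tensorUnit_app_tensorFst_app X K m _
  have hs' : tensorFst X K ≫ s = tensorMap (𝟙 X) (hK.map (.const _ k) (fun _ => Or.inr rfl)) := by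
    refine tensor_hom_ext fun m x => ?_
    rw [NatTrans.comp_app, ← Category.assoc, tensorUnit_app_tensorFst_app,
      tensorUnit_app_tensorMap_app]
    rfl
  refine cohomologyIsos_of_inverse s (fun i => ?_) (fun i => by rw [hs])
  rw [hs', ← h₂, h₁, hK.map_id, tensorMap_id_id]

theorem cohomologyIsos_tensorFst_stdSimplex (n : ℕ) :
    cohomologyIsos ℓ (tensorFst X (Δ[n] : SSet.{u})) := by
  have h := cohomologyIsos_tensorFst_of_isStar X ℓ (Subcomplex.isStar_top (n := n) 0)
  have : IsIso (tensorMap (𝟙 X) (Subcomplex.topIso (Δ[n] : SSet.{u})).hom) :=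
    inferInstanceAs (IsIso (((tensorFunctor Profinite.{u}).obj X).map _))
  refine (cohomologyIsos ℓ).of_precomp (tensorMap (𝟙 X) (Subcomplex.topIso _).hom) _
    (cohomologyIsos_of_isIso (ℓ := ℓ) _) ?_
  rwa [tensorMap_tensorFst, Category.comp_id]

theorem cohomologyIsos_tensorMap_horn {n : ℕ} (k : Fin (n + 2)) :
    cohomologyIsos ℓ (tensorMap (𝟙 X) (Λ[n + 1, k] : (Δ[n + 1] : SSet.{u}).Subcomplex).ι) := by
  refine (cohomologyIsos ℓ).of_postcomp _ (tensorFst X _)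
    (cohomologyIsos_tensorFst_stdSimplex X ℓ (n + 1)) ?_
  rw [tensorMap_tensorFst, Category.comp_id]
  exact cohomologyIsos_tensorFst_of_isStar X ℓ (Subcomplex.isStar_horn k)

variable {ℓ} in
theorem cohomologyIsos_tensorMap_of_tensorFst {X Y : ProfiniteSpace.{u}} {f : X ⟶ Y}
    (hf : cohomologyIsos ℓ f) {K : SSet.{u}} (hX : cohomologyIsos ℓ (tensorFst X K))
    (hY : cohomologyIsos ℓ (tensorFst Y K)) : cohomologyIsos ℓ (tensorMap f (𝟙 K)) := by
  refine (cohomologyIsos ℓ).of_postcomp _ (tensorFst Y K) hY ?_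
  rw [tensorMap_tensorFst]
  exact (cohomologyIsos ℓ).comp_mem _ _ hX hf

end ProfiniteSpace

/-! ### The simplicial model structure -/

section Boundary

open Simplicial SSet

namespace SSet

theorem horn_le_boundary {n : ℕ} (k : Fin (n + 1)) :
    (Λ[n, k] : (Δ[n] : SSet.{u}).Subcomplex) ≤ ∂Δ[n] := by
  rw [horn_eq_iSup, boundary_eq_iSup]
  exact iSup_le fun j => le_iSup (fun j : Fin (n + 1) => stdSimplex.face {j}ᶜ) j.1

theorem homOfLE_app_injective {X : SSet.{u}} {K L : X.Subcomplex} (h : K ≤ L)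
    (m : SimplexCategoryᵒᵖ) : Function.Injective ((Subcomplex.homOfLE h).app m) :=
  fun x y hxy => Subtype.ext
    (show x.1 = y.1 from congrArg (fun z : (L : SSet.{u}).obj m => z.1) hxy)

/-- The map from the boundary of the face opposite to `k` to the horn with center `k`. -/
def boundaryToHorn {n : ℕ} (k : Fin (n + 2)) : (∂Δ[n] : SSet.{u}) ⟶ Λ[n + 1, k] :=
  Subcomplex.lift (∂Δ[n].ι ≫ stdSimplex.δ k) (by
    rintro ⟨⟨m⟩⟩ _ ⟨⟨s, hs⟩, rfl⟩
    obtain ⟨j, hj⟩ := (mem_boundary_iff_notMem_range (d := m) s).1 hs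
    refine (mem_horn_iff_notMem_range (d := m) _ k).2 ⟨k.succAbove j, Fin.succAbove_ne k j, ?_⟩
    rintro ⟨a, ha⟩
    exact hj ⟨a, Fin.succAbove_right_injective ha⟩)

/-- The boundary of a simplex is obtained from a horn by filling in the missing face. -/
theorem isPushout_boundaryToHorn {n : ℕ} (k : Fin (n + 2)) :
    IsPushout (boundaryToHorn.{u} k) ∂Δ[n].ι (Subcomplex.homOfLE (horn_le_boundary.{u} k))
      (boundary.ι k) := by
  refine .of_forall_isPushout_app fun ⟨⟨m⟩⟩ => ?_
  have hδ : Function.Injective ((boundary.ι.{u} k).app (op ⦋m⦌)) := by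
    intro x y hxy
    refine stdSimplex.ext _ _ fun a => Fin.succAbove_right_injective (p := k) ?_
    exact congrArg (fun s : (∂Δ[n + 1] : SSet.{u}).obj (op ⦋m⦌) =>
      (show (Δ[n + 1] : SSet.{u}) _⦋m⦌ from s.1) a) hxy
  have : Mono ((Subcomplex.homOfLE (horn_le_boundary.{u} k)).app (op ⦋m⦌)) :=
    (mono_iff_injective _).2 (homOfLE_app_injective _ _)
  refine Types.isPushout_of_isPullback_of_mono' ?_ ?_ fun x y _ _ hxy => hδ hxy
  · refine (Types.isPullback_iff _ _ _ _).2 ⟨rfl, fun x y h => Subtype.ext h.2, fun x y hxy => ?_⟩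
    have hy : y ∈ ∂Δ[n].obj (op ⦋m⦌) := by
      obtain ⟨j, hj, hx⟩ := (mem_horn_iff_notMem_range (d := m) x.1 k).1 x.2
      obtain ⟨j, rfl⟩ := Fin.exists_succAbove_eq hj
      refine (mem_boundary_iff_notMem_range (d := m) y).2 ⟨j, ?_⟩
      rintro ⟨a, rfl⟩
      exact hx ⟨a, congrArg (fun s : (∂Δ[n + 1] : SSet.{u}).obj (op ⦋m⦌) =>
        (show (Δ[n + 1] : SSet.{u}) _⦋m⦌ from s.1) a) hxy⟩
    exact ⟨⟨y, hy⟩, homOfLE_app_injective (horn_le_boundary k) _ hxy.symm, rfl⟩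
  · refine Set.eq_univ_of_forall fun s => ?_
    by_cases hs : s.1 ∈ Λ[n + 1, k].obj (op ⦋m⦌)
    · exact Or.inl ⟨⟨s.1, hs⟩, rfl⟩
    · refine Or.inr ?_
      obtain ⟨j, hj⟩ := (mem_boundary_iff_notMem_range (d := m) s.1).1 s.2
      have hjk : j = k := by
        by_contra h
        exact hs ((mem_horn_iff_notMem_range (d := m) _ k).2 ⟨j, h, hj⟩)
      have hs' : s.1 ∈ (stdSimplex.face {k}ᶜ).obj (op ⦋m⦌) :=
        (stdSimplex.mem_face_iff (d := m) _ _).2 fun a =>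
          Finset.mem_compl.2 fun ha => hj ⟨a, (Finset.mem_singleton.1 ha).trans hjk.symm⟩
      rw [← stdSimplex.range_δ] at hs'
      obtain ⟨y, hy⟩ := hs'
      exact ⟨y, Subtype.ext hy⟩

end SSet

end Boundary

namespace ProfiniteSpace

open CategoryTheory.SimplicialObject Simplicial SSet

section PushoutProduct

variable {ℓ : ℕ} [Fact ℓ.Prime] {A B : ProfiniteSpace.{u}} {K L : SSet.{u}} {i : A ⟶ B} {j : K ⟶ L}

theorem cohomologyIsos_pushoutProduct_of_right (hi : dimensionwiseMonos i)
    (hA : cohomologyIsos ℓ (tensorMap (𝟙 A) j)) (hB : cohomologyIsos ℓ (tensorMap (𝟙 B) j))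
    (sq : (tensorFunctor Profinite.{u}).PushoutObjObj i j) : cohomologyIsos ℓ sq.ι := by
  have h : cohomologyIsos ℓ sq.inl := cohomologyIsos_of_isPushout ℓ sq.isPushout.flip hA
    (dimensionwiseMonos_tensorMap_id hi)
  refine (cohomologyIsos ℓ).of_precomp _ _ h ?_
  rw [sq.inl_ι]
  exact hB

/-- The map from `A ⊗ L` to the source of the pushout product is a cobase change of
`i ⊗ K`. -/
theorem cohomologyIsos_pushoutProduct_inr (hj : ∀ n : ℕ, Function.Injective (j.app (op ⦋n⦌)))
    (hK : cohomologyIsos ℓ (tensorMap i (𝟙 K)))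
    (sq : (tensorFunctor Profinite.{u}).PushoutObjObj i j) : cohomologyIsos ℓ sq.inr :=
  cohomologyIsos_of_isPushout ℓ sq.isPushout hK (dimensionwiseMonos_tensorMap_of_injective hj)

theorem cohomologyIsos_pushoutProduct_of_left
    (hj : ∀ n : ℕ, Function.Injective (j.app (op ⦋n⦌)))
    (hK : cohomologyIsos ℓ (tensorMap i (𝟙 K))) (hL : cohomologyIsos ℓ (tensorMap i (𝟙 L)))
    (sq : (tensorFunctor Profinite.{u}).PushoutObjObj i j) : cohomologyIsos ℓ sq.ι := by
  refine (cohomologyIsos ℓ).of_precomp _ _ (cohomologyIsos_pushoutProduct_inr hj hK sq) ?_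
  rw [sq.inr_ι]
  exact hL

/-- By adjunction, the maps `j` whose pushout product with a given `i` is a trivial cofibration
are characterized by a left lifting property, so that they are stable under cobase change. -/
theorem pushoutProduct_of_isPushout {K' L' : SSet.{u}} {j' : K' ⟶ L'} {k : K ⟶ K'} {l : L ⟶ L'}
    (h : IsPushout k j j' l)
    (sq : (tensorFunctor Profinite.{u}).PushoutObjObj i j)
    (sq' : (tensorFunctor Profinite.{u}).PushoutObjObj i j')
    (hsq : (dimensionwiseMonos ⊓ cohomologyIsos ℓ) sq.ι) :
    (dimensionwiseMonos ⊓ cohomologyIsos ℓ) sq'.ι := by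
  rw [← llp_fibrationsOfCohomologyIsos]
  intro X Y p hp
  let sq'' := Functor.PullbackObjObj.ofHasPullback
    (SimplicialCategory.sHomFunctor ProfiniteSpace.{u}) i p
  rw [(tensorAdjunction Profinite.{u}).hasLiftingProperty_iff sq' sq'']
  have := hp _ hsq
  rw [(tensorAdjunction Profinite.{u}).hasLiftingProperty_iff sq sq''] at this
  exact h.hasLiftingProperty _

/-- The inclusion of a subcomplex is injective in each degree. -/
theorem subcomplex_ι_injective {K : SSet.{u}} (S : K.Subcomplex) (n : ℕ) :
    Function.Injective (S.ι.app (op ⦋n⦌)) :=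
  fun _ _ h => Subtype.ext h

/-- By induction on `n`, since `∂Δ[n + 1]` is obtained from a horn by a cobase change of
`∂Δ[n] ⟶ Δ[n]`. -/
theorem cohomologyIsos_tensorMap_boundary (hi : dimensionwiseMonos i) (hi' : cohomologyIsos ℓ i) :
    ∀ n : ℕ, cohomologyIsos ℓ (tensorMap i (𝟙 (∂Δ[n] : SSet.{u}))) := by
  intro n
  induction n with
  | zero =>
    have he (m) (s : (∂Δ[0] : SSet.{u}).obj m) : False := by
      obtain ⟨s, hs⟩ := s
      rw [boundary_zero] at hs
      exact hs
    have : IsIso (tensorMap i (𝟙 (∂Δ[0] : SSet.{u}))) :=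
      ⟨tensorDesc ⟨fun m s => (he m s).elim, fun _ s => (he _ s).elim⟩,
        tensor_hom_ext fun _ s => (he _ s).elim, tensor_hom_ext fun _ s => (he _ s).elim⟩
    exact cohomologyIsos_of_isIso _
  | succ n ih =>
    have hn := cohomologyIsos_tensorMap_of_tensorFst hi'
      (cohomologyIsos_tensorFst_stdSimplex A ℓ n) (cohomologyIsos_tensorFst_stdSimplex B ℓ n)
    have hh := cohomologyIsos_tensorMap_of_tensorFst hi'
      (cohomologyIsos_tensorFst_of_isStar A ℓ (Subcomplex.isStar_horn (n := n) 0))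
      (cohomologyIsos_tensorFst_of_isStar B ℓ (Subcomplex.isStar_horn 0))
    let sq := Functor.PushoutObjObj.ofHasPushout (tensorFunctor Profinite.{u}) i
      (∂Δ[n] : (Δ[n] : SSet.{u}).Subcomplex).ι
    let sq' := Functor.PushoutObjObj.ofHasPushout (tensorFunctor Profinite.{u}) i
      (Subcomplex.homOfLE (horn_le_boundary.{u} (0 : Fin (n + 2))))
    have h : (dimensionwiseMonos ⊓ cohomologyIsos ℓ) sq'.ι :=
      pushoutProduct_of_isPushout (isPushout_boundaryToHorn 0) sq sq'
        ⟨dimensionwiseMonos_pushoutProduct hi (subcomplex_ι_injective _) sq,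
          cohomologyIsos_pushoutProduct_of_left (subcomplex_ι_injective _) ih hn sq⟩
    have h' := (cohomologyIsos ℓ).comp_mem _ _
      (cohomologyIsos_pushoutProduct_inr (fun m => homOfLE_app_injective _ _) hh sq') h.2
    rw [sq'.inr_ι] at h'
    exact h'

theorem isSimplicialModelCategory :
    letI := modelCategory.{u} ℓ
    IsSimplicialModelCategory ProfiniteSpace.{u} :=
  letI := modelCategory.{u} ℓ
  have : HasLimitsOfSize.{0, u} Profinite.{u} := hasLimitsOfSizeShrink.{0, u, u, u} Profinite.{u}
  { exists_tensor := exists_tensor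
    exists_cotensor := exists_cotensor
    fibration := fun A B X Y i p hi hp => by
      intro K L j hj
      simp only [modelCategoryQuillen.J, MorphismProperty.iSup_iff] at hj
      obtain ⟨m, ⟨k⟩⟩ := hj
      rw [← (tensorAdjunction Profinite.{u}).hasLiftingProperty_iff
        (Functor.PushoutObjObj.ofHasPushout _ _ _)]
      exact hp _ ⟨dimensionwiseMonos_pushoutProduct hi (subcomplex_ι_injective _) _,
        cohomologyIsos_pushoutProduct_of_right hi (cohomologyIsos_tensorMap_horn _ _ _)
          (cohomologyIsos_tensorMap_horn _ _ _) _⟩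
    trivialFibration := fun A B X Y i p hi hp h => by
      rintro _ _ _ ⟨n⟩
      rw [← (tensorAdjunction Profinite.{u}).hasLiftingProperty_iff
        (Functor.PushoutObjObj.ofHasPushout _ _ _)]
      rcases h with h | h
      · exact hp _ ⟨dimensionwiseMonos_pushoutProduct hi (subcomplex_ι_injective _) _,
          cohomologyIsos_pushoutProduct_of_left (subcomplex_ι_injective _)
            (cohomologyIsos_tensorMap_boundary hi h n)
            (cohomologyIsos_tensorMap_of_tensorFst h (cohomologyIsos_tensorFst_stdSimplex A ℓ n)
              (cohomologyIsos_tensorFst_stdSimplex B ℓ n)) _⟩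
      · have hp' : dimensionwiseMonos.rlp p := by
          rw [← fibrations_inf_cohomologyIsos ℓ]
          exact ⟨hp, h⟩
        exact hp' _ (dimensionwiseMonos_pushoutProduct hi (subcomplex_ι_injective _) _) }

end PushoutProduct

end ProfiniteSpace

theorem mainTheorem3 (ℓ : ℕ) [Fact ℓ.Prime] :
    ∃ _ : ModelCategory ProfiniteSpace.{u},
      weakEquivalences ProfiniteSpace.{u} = ProfiniteSpace.cohomologyIsos ℓ ∧
      cofibrations ProfiniteSpace.{u} = ProfiniteSpace.dimensionwiseMonos ∧
      IsSimplicialModelCategory ProfiniteSpace.{u} ∧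
      IsLeftProper ProfiniteSpace.{u} ∧
      GeneratesByLifting
        (ProfiniteSpace.generatingFibrations (Set.univ : Set (AbelianProGroup.{u} ℓ)))
        (ProfiniteSpace.generatingTrivialFibrations (Set.univ : Set (AbelianProGroup.{u} ℓ))) ∧
      ∀ 𝓜 : Set (AbelianProGroup.{u} ℓ), Small.{u} 𝓜 →
        (∃ M ∈ 𝓜, Nonempty (M.carrier ≃ₜ+ ZMod ℓ)) →
        IsFibrantlyGenerated (ProfiniteSpace.generatingFibrations 𝓜)
          (ProfiniteSpace.generatingTrivialFibrations 𝓜) :=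
  ⟨ProfiniteSpace.modelCategory ℓ, rfl, rfl, ProfiniteSpace.isSimplicialModelCategory,
    ProfiniteSpace.isLeftProper ℓ,
    ProfiniteSpace.generatesByLifting ℓ
      ⟨ProfiniteSpace.zmodGroup ℓ, Set.mem_univ _, ⟨ProfiniteSpace.zmodGroupEquiv ℓ⟩⟩,
    fun _ _ h𝓜 => ProfiniteSpace.isFibrantlyGenerated ℓ h𝓜⟩
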